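/- Let $F_1,F_2$ be probability distributions on $\mathbb R$ with variances $\sigma_1^2,\sigma_2^2$ ($\sigma_1,\sigma_2\ge 0$) and let $K$ be a constant. For every $n$ let $m(n)\ge 2$, let $V_1,\dots,V_{m(n)}$ be a partition of $[n]=\{1,\dots,n\}$ (the partition may depend on $n$; blocks may be empty), and put $\nu_k=\nu_k(n)=|V_k|/n$. On one probability space let, for every $n$, $A_n=(a_{ij})$ be a random real symmetric $n\times n$ matrix such that the entries $a_{ij}$, $i\le j$, are independent, $|a_{ij}|\le K$ almost surely, $a_{ij}$ has law $F_1$ if $i$ and $j$ lie in the same block (in particular if $i=j$), and $a_{ij}$ has law $F_2$ if $i$ and $j$ lie in different blocks; nothing is assumed on the joint law of the matrices $A_n$ for different $n$. Let $\Psi_n(x)=\frac1n\#\{k:\lambda_k\le x\}$, where $\lambda_1,\dots,\lambda_n$ are the eigenvalues, with multiplicity, of $B_n=\frac1{2\sqrt n}A_n$. For $r>0$ let $\Phi_r$ be the distribution function of the semicircle law of radius $r$, with density $\frac{2}{\pi r^2}\sqrt{r^2-x^2}$ for $|x|\le r$ and $0$ for $|x|>r$. (i) Suppose that $\lim_{n\to\infty}\max_k\nu_k(n)$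 exists and is positive, and that $\lim_{n\to\infty}\nu_i(n)/\nu_j(n)=1$ uniformly in $1\le i,j\le m(n)$, that is, for every $\varepsilon>0$ one has for all large $n$ that $|\nu_i(n)/\nu_j(n)-1|<\varepsilon$ for all $i,j\le m(n)$ (so all blocks are non-empty for large $n$). Then $m(n)$ is equal to a constant $m\ge2$ for all large $n$, and if $\sigma_1^2+(m-1)\sigma_2^2>0$, then almost surely $\lim_{n\to\infty}\Psi_n(x)=\Phi_r(x)$ for all $x\in\mathbb R$, where $r=\sqrt{\frac{\sigma_1^2+(m-1)\sigma_2^2}{m}}$. (ii) Suppose that $\lim_{n\to\infty}\max_k\nu_k(n)=0$ and $\sigma_2>0$. Then almost surely $\lim_{n\to\infty}\Psi_n(x)=\Phi_{\sigma_2}(x)$ for all $x\in\mathbb R$. -/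

import Mathlib

open MeasureTheory ProbabilityTheory Filter Topology

noncomputable section

/-- The proportion `ν_k = |V_k| / n` of the block `V_k = {i | part i = k}`, where the partition of
`Fin n` into `m` labelled blocks is given by the map `part` sending an index to the label of its
block. -/
def blockProportion {n m : ℕ} (part : Fin n → Fin m) (k : Fin m) : ℝ :=
  ((Finset.univ.filter fun i => part i = k).card : ℝ) / n

/-- `A` is a random real symmetric `n × n` matrix whose entries on and above the diagonal are
independent, almost surely bounded by `K`, with law `F₁` at positions `(i, j)` inside a block
(diagonal positions included) and law `F₂` at positions between two different blocks. -/
structure IsBlockRandomMatrix {Ω : Type*} [MeasurableSpace Ω] (P : Measure Ω) {n m : ℕ}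
    (part : Fin n → Fin m) (F₁ F₂ : Measure ℝ) (K : ℝ)
    (A : Ω → Matrix (Fin n) (Fin n) ℝ) : Prop where
  measurable_entry : ∀ i j, Measurable fun ω => A ω i j
  symmetric : ∀ ω, (A ω).IsSymm
  independent : iIndepFun
    (fun (p : {p : Fin n × Fin n // p.1 ≤ p.2}) (ω : Ω) => A ω p.1.1 p.1.2) P
  law_inside : ∀ i j, part i = part j → P.map (fun ω => A ω i j) = F₁
  law_between : ∀ i j, part i ≠ part j → P.map (fun ω => A ω i j) = F₂
  bounded : ∀ i j, ∀ᵐ ω ∂P, |A ω i j| ≤ K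

/-- Empirical spectral distribution function: the number of eigenvalues (roots of the
characteristic polynomial, with multiplicity) at most `x`, divided by the size of the matrix.
It is applied to real symmetric matrices only, all of whose eigenvalues are real. -/
def esd {n : ℕ} (B : Matrix (Fin n) (Fin n) ℝ) (x : ℝ) : ℝ :=
  ((B.charpoly.roots.filter fun t => t ≤ x).card : ℝ) / n

/-- Density of the semicircle law of radius `r` (for `0 < r`). -/
def semicircleDensity (r x : ℝ) : ℝ :=
  if |x| ≤ r then 2 / (Real.pi * r ^ 2) * Real.sqrt (r ^ 2 - x ^ 2) else 0

/-- Distribution function of the semicircle law of radius `r` (for `0 < r`). -/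
def semicircleCDF (r x : ℝ) : ℝ :=
  ∫ t in Set.Iic x, semicircleDensity r t

end

open scoped Matrix NNReal BoundedContinuousFunction

/-! The matrix splits into a centred part and its mean. The centred part `X` is a Wigner matrix with
a variance profile, entries of order `n^(-1/2)`, and row sums of variances tending uniformly to
`r²/4`. Equal row sums, not equal variances, are what produce a semicircle law. The mean takes only
two values on a block pattern and does not influence the limit.

For the centred part, let `G = (X - iη)⁻¹`. Expanding `G j i` in the single entry `X i j` around the
matrix with that entry erased gives `E[X i j * G j i] ≈ -s i j * E[G i i * G j j]`. Summing over `j`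
in `(X - iη)G = 1`, and decoupling the product because weighted resolvent traces concentrate
(McDiarmid), shows that `γ i = E[G i i]` nearly solves `γ i * (iη + ∑ s i j * γ j) = -1`
(`IsBoundedWigner.self_consistent`). For `η` above a constant multiple of the bound on the entries
of `A`, this equation is stable, so every `γ i` is close to the constant solution of `S(iη + r²S/4)
= -1` (`norm_sub_fixedPoint_le`). That solution is the Stieltjes transform of the semicircle law at
`iη` (`exists_semicircle_stieltjes`). The sub-Gaussian tails are summable, so Borel–Cantelli gives
almost sure convergence without any assumption linking different `n`
(`ae_tendsto_trace_imagResolvent`).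

Values at rational points high on the imaginary axis suffice: with their conjugates and the
constants, the kernels `(x - iq)⁻¹` span an algebra, up to closure, that separates points, and
second moments are bounded, so the spectral measures converge weakly
(`tendsto_measureReal_Iic_of_stieltjes`).

Restoring the mean changes the resolvent trace by `o(n)`. A rank one change costs at most `1/η`. In
(i) the mean has rank at most `m + 1`, with `m` eventually constant. In (ii) the rank may be large,
but after removing a multiple of the all-ones matrix the rest has squared Hilbert–Schmidt norm at
most a constant times `n * max ν`. -/

/-- The resolvent `(M - iη)⁻¹` of a real matrix at a point of the imaginary axis. -/
noncomputable def imagResolvent {V : Type*} [Fintype V] [DecidableEq V]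
    (M : Matrix V V ℝ) (η : ℝ) : Matrix V V ℂ :=
  (M.map Complex.ofReal - ((η : ℂ) * Complex.I) • (1 : Matrix V V ℂ))⁻¹

/-! ### Resolvents of real symmetric matrices on the imaginary axis. -/

section ImagResolvent

variable {V : Type*} [Fintype V] [DecidableEq V] {M N : Matrix V V ℝ} {η : ℝ}

theorem norm_sum_mul_sq_le {ι : Type*} (s : Finset ι) (a b : ι → ℂ) :
    ‖∑ i ∈ s, a i * b i‖ ^ 2 ≤ (∑ i ∈ s, ‖a i‖ ^ 2) * ∑ i ∈ s, ‖b i‖ ^ 2 := by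
  calc ‖∑ i ∈ s, a i * b i‖ ^ 2 ≤ (∑ i ∈ s, ‖a i‖ * ‖b i‖) ^ 2 := by
        gcongr
        exact (norm_sum_le _ _).trans_eq (by simp)
    _ ≤ _ := Finset.sum_mul_sq_le_sq_mul_sq _ _ _

theorem Matrix.IsSymm.isHermitian_ofReal {V : Type*} {M : Matrix V V ℝ} (hM : M.IsSymm) :
    (M.map Complex.ofReal).IsHermitian := by
  ext i j
  simp [Matrix.conjTranspose_apply, hM.apply]

/-- A Hermitian quadratic form is real, so only the shift by `iη` contributes an imaginary part.
Invertibility and every norm bound on the resolvent come from this identity. -/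
theorem im_star_dotProduct_sub_mulVec (hM : M.IsSymm) (u : V → ℂ) :
    (star u ⬝ᵥ ((M.map Complex.ofReal - ((η : ℂ) * Complex.I) • (1 : Matrix V V ℂ)) *ᵥ u)).im
      = -η * ∑ k, ‖u k‖ ^ 2 := by
  rw [Matrix.sub_mulVec, dotProduct_sub, Matrix.smul_mulVec, Matrix.one_mulVec, dotProduct_smul]
  have h1 : (star u ⬝ᵥ (M.map Complex.ofReal *ᵥ u)).im = 0 :=
    hM.isHermitian_ofReal.im_star_dotProduct_mulVec_self u
  have h2 : star u ⬝ᵥ u = ((∑ k, ‖u k‖ ^ 2 : ℝ) : ℂ) := by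
    simp only [dotProduct, Pi.star_apply, RCLike.star_def]
    push_cast
    exact Finset.sum_congr rfl fun k _ => Complex.conj_mul' (u k)
  rw [Complex.sub_im, h1, h2, smul_eq_mul, Complex.mul_im, Complex.ofReal_re, Complex.ofReal_im]
  simp

theorem isUnit_det_sub (hM : M.IsSymm) (hη : η ≠ 0) :
    IsUnit (M.map Complex.ofReal - ((η : ℂ) * Complex.I) • (1 : Matrix V V ℂ)).det := by
  rw [← Matrix.isUnit_iff_isUnit_det, ← Matrix.mulVec_injective_iff_isUnit]
  rw [← Matrix.coe_mulVecLin, injective_iff_map_eq_zero]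
  intro u hu
  have h := im_star_dotProduct_sub_mulVec (η := η) hM u
  rw [Matrix.mulVecLin_apply] at hu
  rw [hu, dotProduct_zero, Complex.zero_im, zero_eq_mul] at h
  rcases h with h | h
  · exact absurd (neg_eq_zero.1 h) hη
  · rw [Finset.sum_eq_zero_iff_of_nonneg fun _ _ => by positivity] at h
    funext k
    simpa using h k (Finset.mem_univ k)

theorem sub_mul_imagResolvent (hM : M.IsSymm) (hη : η ≠ 0) :
    (M.map Complex.ofReal - ((η : ℂ) * Complex.I) • (1 : Matrix V V ℂ)) * imagResolvent M η = 1 :=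
  Matrix.mul_nonsing_inv _ (isUnit_det_sub hM hη)

theorem imagResolvent_mul_sub (hM : M.IsSymm) (hη : η ≠ 0) :
    imagResolvent M η * (M.map Complex.ofReal - ((η : ℂ) * Complex.I) • (1 : Matrix V V ℂ)) = 1 :=
  Matrix.nonsing_inv_mul _ (isUnit_det_sub hM hη)

theorem imagResolvent_isSymm (hM : M.IsSymm) (η : ℝ) : (imagResolvent M η).IsSymm := by
  rw [Matrix.IsSymm, imagResolvent, Matrix.transpose_nonsing_inv, Matrix.transpose_sub,
    Matrix.transpose_smul, Matrix.transpose_one, ← Matrix.transpose_map, hM.eq]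

theorem im_dotProduct_imagResolvent_mulVec (hM : M.IsSymm) (hη : η ≠ 0) (v : V → ℂ) :
    (star (imagResolvent M η *ᵥ v) ⬝ᵥ v).im = -η * ∑ k, ‖(imagResolvent M η *ᵥ v) k‖ ^ 2 := by
  have h := im_star_dotProduct_sub_mulVec (η := η) hM (imagResolvent M η *ᵥ v)
  rwa [Matrix.mulVec_mulVec, sub_mul_imagResolvent hM hη, Matrix.one_mulVec] at h

/-- With `u = Gv`, the imaginary part of `⟨u, v⟩` has modulus `η‖u‖²`, while Cauchy–Schwarz bounds
it by `‖u‖‖v‖`. This is the operator norm bound `1/η`, obtained without diagonalising. -/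
theorem sum_norm_sq_imagResolvent_mulVec_le (hM : M.IsSymm) (hη : 0 < η) (v : V → ℂ) :
    ∑ k, ‖(imagResolvent M η *ᵥ v) k‖ ^ 2 ≤ (∑ k, ‖v k‖ ^ 2) / η ^ 2 := by
  set u := imagResolvent M η *ᵥ v
  have h := im_dotProduct_imagResolvent_mulVec hM hη.ne' v
  have h1 : ‖star u ⬝ᵥ v‖ ^ 2 ≤ (∑ k, ‖u k‖ ^ 2) * ∑ k, ‖v k‖ ^ 2 := by
    have := norm_sum_mul_sq_le Finset.univ (star u) v
    simpa only [dotProduct, Pi.star_apply, norm_star] using this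
  have h2 : (η * ∑ k, ‖u k‖ ^ 2) ^ 2 ≤ ‖star u ⬝ᵥ v‖ ^ 2 := by
    have h0 := Complex.abs_im_le_norm (star u ⬝ᵥ v)
    rw [h, neg_mul, abs_neg] at h0
    rwa [sq_le_sq, abs_norm]
  have h3 : 0 ≤ ∑ k, ‖u k‖ ^ 2 := Finset.sum_nonneg fun _ _ => sq_nonneg _
  have h4 : 0 ≤ ∑ k, ‖v k‖ ^ 2 := Finset.sum_nonneg fun _ _ => sq_nonneg _
  have h5 := h2.trans h1
  clear_value u
  generalize ∑ k, ‖u k‖ ^ 2 = S at *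
  generalize ∑ k, ‖v k‖ ^ 2 = T at *
  rw [le_div_iff₀ (by positivity)]
  rcases h3.eq_or_lt with h0 | h0
  · rw [← h0, zero_mul]; exact h4
  · refine le_of_mul_le_mul_left ?_ h0
    calc S * (S * η ^ 2) = (η * S) ^ 2 := by ring
      _ ≤ S * T := h5

theorem sum_norm_sq_imagResolvent_col_le (hM : M.IsSymm) (hη : 0 < η) (i : V) :
    ∑ k, ‖imagResolvent M η k i‖ ^ 2 ≤ 1 / η ^ 2 := by
  have h := sum_norm_sq_imagResolvent_mulVec_le hM hη (Pi.single i 1)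
  simp only [Matrix.mulVec_single_one, Matrix.col_apply] at h
  refine h.trans_eq ?_
  congr 1
  rw [Finset.sum_eq_single i (by intro b _ hb; simp [hb]) (by simp)]
  simp

theorem sum_norm_sq_imagResolvent_row_le (hM : M.IsSymm) (hη : 0 < η) (i : V) :
    ∑ k, ‖imagResolvent M η i k‖ ^ 2 ≤ 1 / η ^ 2 := by
  simpa only [(imagResolvent_isSymm hM η).apply] using sum_norm_sq_imagResolvent_col_le hM hη i

theorem norm_imagResolvent_apply_le (hM : M.IsSymm) (hη : 0 < η) (i j : V) :
    ‖imagResolvent M η i j‖ ≤ 1 / η := by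
  rw [← abs_of_nonneg (norm_nonneg (imagResolvent M η i j)), ← abs_of_pos (one_div_pos.2 hη),
    ← sq_le_sq, div_pow, one_pow]
  exact (Finset.single_le_sum (f := fun k => ‖imagResolvent M η k j‖ ^ 2)
    (fun _ _ => by positivity) (Finset.mem_univ i)).trans (sum_norm_sq_imagResolvent_col_le hM hη j)

theorem imagResolvent_sub_imagResolvent (hM : M.IsSymm) (hN : N.IsSymm) (hη : η ≠ 0) :
    imagResolvent M η - imagResolvent N η
      = -(imagResolvent M η * (M - N).map Complex.ofReal * imagResolvent N η) := by
  have h1 := imagResolvent_mul_sub hM hη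
  have h2 := sub_mul_imagResolvent hN hη
  set G := imagResolvent M η
  set H := imagResolvent N η
  have e : (M - N).map Complex.ofReal
      = (M.map Complex.ofReal - ((η : ℂ) * Complex.I) • (1 : Matrix V V ℂ))
        - (N.map Complex.ofReal - ((η : ℂ) * Complex.I) • (1 : Matrix V V ℂ)) := by
    ext i j; simp
  rw [e, mul_sub, sub_mul, h1, mul_assoc, h2]
  simp

/-- Cauchy–Schwarz in `j`, with the `ℓ²` bounds on a column and a row of the resolvents. Bounding
entry by entry would lose a factor `card V`, and concentration would then fail. -/
theorem norm_sum_weight_mul_le (hM : M.IsSymm) (hN : N.IsSymm) (hη : 0 < η) (a b : V)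
    (w : V → ℝ) {c : ℝ} (hw : ∀ j, |w j| ≤ c) :
    ‖∑ j, (w j : ℂ) * (imagResolvent M η j a * imagResolvent N η b j)‖ ≤ c / η ^ 2 := by
  have hc : 0 ≤ c := (abs_nonneg _).trans (hw a)
  have h := norm_sum_mul_sq_le Finset.univ (fun j => (w j : ℂ) * imagResolvent M η j a)
    (fun j => imagResolvent N η b j)
  have h1 : ∑ j, ‖(w j : ℂ) * imagResolvent M η j a‖ ^ 2 ≤ c ^ 2 * (1 / η ^ 2) := by
    calc ∑ j, ‖(w j : ℂ) * imagResolvent M η j a‖ ^ 2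
        ≤ ∑ j, c ^ 2 * ‖imagResolvent M η j a‖ ^ 2 := by
          gcongr with j
          rw [norm_mul, mul_pow, Complex.norm_real, Real.norm_eq_abs]
          gcongr
          exact hw j
      _ ≤ _ := by
          rw [← Finset.mul_sum]
          gcongr
          exact sum_norm_sq_imagResolvent_col_le hM hη a
  have h2 := sum_norm_sq_imagResolvent_row_le hN hη b
  refine le_of_sq_le_sq ?_ (by positivity)
  calc ‖∑ j, (w j : ℂ) * (imagResolvent M η j a * imagResolvent N η b j)‖ ^ 2
      = ‖∑ j, (w j : ℂ) * imagResolvent M η j a * imagResolvent N η b j‖ ^ 2 := by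
        simp only [mul_assoc]
    _ ≤ _ := h
    _ ≤ (c ^ 2 * (1 / η ^ 2)) * (1 / η ^ 2) := by gcongr
    _ = (c / η ^ 2) ^ 2 := by ring

/-- The symmetric matrix supported on the positions `(a, b)` and `(b, a)`, with entries `1`. -/
def symmUnit {V : Type*} [DecidableEq V] (a b : V) : Matrix V V ℝ :=
  if a = b then Matrix.single a a 1 else Matrix.single a b 1 + Matrix.single b a 1

theorem symmUnit_map_eq {V : Type*} [DecidableEq V] (a b : V) :
    (symmUnit a b).map Complex.ofReal = if a = b then Matrix.single a a 1
      else Matrix.single a b 1 + Matrix.single b a 1 := by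
  ext i j
  rw [symmUnit]
  split_ifs with h
  · simp only [Matrix.map_apply, Matrix.single_apply]
    split_ifs <;> simp
  · simp only [Matrix.map_apply, Matrix.add_apply, Matrix.single_apply]
    split_ifs <;> simp

theorem mul_symmUnit_mul_apply (P Q : Matrix V V ℂ) (a b i j : V) :
    (P * (symmUnit a b).map Complex.ofReal * Q) i j
      = P i a * Q b j + if a = b then 0 else P i b * Q a j := by
  have key : ∀ c d : V, (P * (Matrix.single c d 1 : Matrix V V ℂ) * Q) i j = P i c * Q d j := by
    intro c d
    rw [Matrix.mul_apply, Finset.sum_eq_single d]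
    · simp
    · intro k _ hk
      rw [Matrix.mul_single_apply_of_ne _ _ _ _ _ hk, zero_mul]
    · simp
  rw [symmUnit_map_eq]
  split_ifs with h
  · subst h; simp [key]
  · rw [mul_add, add_mul, Matrix.add_apply, key, key]

theorem symmUnit_isSymm {V : Type*} [DecidableEq V] (a b : V) : (symmUnit a b).IsSymm := by
  rw [symmUnit, Matrix.IsSymm]
  split_ifs with h
  · simp
  · simp [add_comm]

end ImagResolvent

/-! ### Perturbation of the resolvent: one entry, Hilbert–Schmidt, rank one. -/

section Perturbation

variable {V : Type*} [Fintype V] [DecidableEq V] {M N : Matrix V V ℝ} {η : ℝ}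

theorem map_smul_ofReal {V : Type*} (y : ℝ) (E : Matrix V V ℝ) :
    (y • E).map Complex.ofReal = (y : ℂ) • E.map Complex.ofReal := by
  ext i j; simp

theorem imagResolvent_apply_sub_apply (hM : M.IsSymm) (hN : N.IsSymm) (hη : η ≠ 0) {a b : V}
    {y : ℝ} (hMN : M - N = y • symmUnit a b) (i j : V) :
    imagResolvent M η i j - imagResolvent N η i j
      = -(y * (imagResolvent M η i a * imagResolvent N η b j
        + if a = b then 0 else imagResolvent M η i b * imagResolvent N η a j)) := by
  have h := congrFun (congrFun (imagResolvent_sub_imagResolvent hM hN hη) i) j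
  rw [hMN, map_smul_ofReal, Matrix.mul_smul, Matrix.smul_mul, Matrix.neg_apply, Matrix.smul_apply,
    mul_symmUnit_mul_apply, Matrix.sub_apply] at h
  simpa using h

theorem norm_mul_imagResolvent_apply_le (hM : M.IsSymm) (hN : N.IsSymm) (hη : 0 < η)
    (i j k l : V) : ‖imagResolvent M η i j * imagResolvent N η k l‖ ≤ 1 / η ^ 2 := by
  rw [norm_mul]
  calc _ ≤ (1 / η) * (1 / η) := by
        gcongr
        · exact norm_imagResolvent_apply_le hM hη _ _
        · exact norm_imagResolvent_apply_le hN hη _ _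
    _ = _ := by ring

theorem norm_imagResolvent_apply_sub_le (hM : M.IsSymm) (hN : N.IsSymm) (hη : 0 < η) {a b : V}
    {y : ℝ} (hMN : M - N = y • symmUnit a b) (i j : V) :
    ‖imagResolvent M η i j - imagResolvent N η i j‖ ≤ 2 * |y| / η ^ 2 := by
  rw [imagResolvent_apply_sub_apply hM hN hη.ne' hMN, norm_neg, norm_mul, Complex.norm_real,
    Real.norm_eq_abs]
  calc _ ≤ |y| * (1 / η ^ 2 + 1 / η ^ 2) := by
        gcongr
        refine norm_add_le_of_le (norm_mul_imagResolvent_apply_le hM hN hη _ _ _ _) ?_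
        split_ifs
        · simp only [norm_zero]; positivity
        · exact norm_mul_imagResolvent_apply_le hM hN hη _ _ _ _
    _ = _ := by ring

/-- This supplies the bounded-difference constant for McDiarmid's inequality; it does not depend on
the dimension. -/
theorem norm_sum_weight_sub_le (hM : M.IsSymm) (hN : N.IsSymm) (hη : 0 < η) {a b : V}
    {y : ℝ} (hMN : M - N = y • symmUnit a b) (w : V → ℝ) {c : ℝ} (hw : ∀ j, |w j| ≤ c) :
    ‖∑ j, (w j : ℂ) * imagResolvent M η j j - ∑ j, (w j : ℂ) * imagResolvent N η j j‖
      ≤ 2 * |y| * c / η ^ 2 := by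
  have hc : 0 ≤ c := (abs_nonneg _).trans (hw a)
  have e : ∑ j, (w j : ℂ) * imagResolvent M η j j - ∑ j, (w j : ℂ) * imagResolvent N η j j
      = -(y * (∑ j, (w j : ℂ) * (imagResolvent M η j a * imagResolvent N η b j)
        + if a = b then 0 else
          ∑ j, (w j : ℂ) * (imagResolvent M η j b * imagResolvent N η a j))) := by
    rw [← Finset.sum_sub_distrib]
    split_ifs with h
    · rw [add_zero, Finset.mul_sum, ← Finset.sum_neg_distrib]
      refine Finset.sum_congr rfl fun j _ => ?_
      rw [← mul_sub, imagResolvent_apply_sub_apply hM hN hη.ne' hMN, if_pos h]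
      ring
    · rw [← Finset.sum_add_distrib, Finset.mul_sum, ← Finset.sum_neg_distrib]
      refine Finset.sum_congr rfl fun j _ => ?_
      rw [← mul_sub, imagResolvent_apply_sub_apply hM hN hη.ne' hMN, if_neg h]
      ring
  rw [e, norm_neg, norm_mul, Complex.norm_real, Real.norm_eq_abs]
  calc _ ≤ |y| * (c / η ^ 2 + c / η ^ 2) := by
        gcongr
        refine norm_add_le_of_le (norm_sum_weight_mul_le hM hN hη _ _ w hw) ?_
        split_ifs
        · simp only [norm_zero]; positivity
        · exact norm_sum_weight_mul_le hM hN hη _ _ w hw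
    _ = _ := by ring

/-- The coefficient of the first order term in the expansion of the entry `(j, i)` of the resolvent
in the entry `(i, j)` of the matrix. -/
noncomputable def resolventSlope (N : Matrix V V ℝ) (η : ℝ) (i j : V) : ℂ :=
  imagResolvent N η j i * imagResolvent N η j i
    + if i = j then 0 else imagResolvent N η j j * imagResolvent N η i i

theorem norm_resolventSlope_le (hN : N.IsSymm) (hη : 0 < η) (i j : V) :
    ‖resolventSlope N η i j‖ ≤ 2 / η ^ 2 := by
  calc _ ≤ 1 / η ^ 2 + 1 / η ^ 2 := by
        refine norm_add_le_of_le (norm_mul_imagResolvent_apply_le hN hN hη _ _ _ _) ?_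
        split_ifs
        · simp only [norm_zero]; positivity
        · exact norm_mul_imagResolvent_apply_le hN hN hη _ _ _ _
    _ = _ := by ring

/-- The resolvent identity is exact but mixes entries of both resolvents; replacing those of `M` by
those of `N` costs a further factor `y`. The coefficients are taken at `N` because `N` will be the
matrix with the entry erased, hence independent of `y`. -/
theorem norm_imagResolvent_expansion_le (hM : M.IsSymm) (hN : N.IsSymm) (hη : 0 < η) {i j : V}
    {y : ℝ} (hMN : M - N = y • symmUnit i j) :
    ‖imagResolvent M η j i - (imagResolvent N η j i - y * resolventSlope N η i j)‖
      ≤ 4 * y ^ 2 / η ^ 3 := by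
  have hNM : N - M = (-y) • symmUnit i j := by rw [neg_smul, ← hMN, neg_sub]
  have h := imagResolvent_apply_sub_apply hN hM hη.ne' hNM j i
  have e : imagResolvent M η j i - (imagResolvent N η j i - y * resolventSlope N η i j)
      = y * (imagResolvent N η j i * (imagResolvent N η j i - imagResolvent M η j i)
        + if i = j then 0 else
          imagResolvent N η j j * (imagResolvent N η i i - imagResolvent M η i i)) := by
    rw [resolventSlope]
    split_ifs at h ⊢ with hij
    · push_cast at h; linear_combination -h
    · push_cast at h; linear_combination -h
  have hb : ∀ k l k' l', ‖imagResolvent N η k l * (imagResolvent N η k' l'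
      - imagResolvent M η k' l')‖ ≤ (1 / η) * (2 * |-y| / η ^ 2) := by
    intro k l k' l'
    rw [norm_mul]
    gcongr
    · exact norm_imagResolvent_apply_le hN hη _ _
    · exact norm_imagResolvent_apply_sub_le hN hM hη hNM _ _
  rw [e, norm_mul, Complex.norm_real, Real.norm_eq_abs]
  calc _ ≤ |y| * ((1 / η) * (2 * |-y| / η ^ 2) + (1 / η) * (2 * |-y| / η ^ 2)) := by
        gcongr
        refine norm_add_le_of_le (hb _ _ _ _) ?_
        split_ifs
        · simp only [norm_zero]; positivity
        · exact hb _ _ _ _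
    _ = 4 * |y| ^ 2 / η ^ 3 := by rw [abs_neg]; field_simp; ring
    _ = _ := by rw [sq_abs]

theorem norm_mul_sub_mul_le {a b c d : ℂ} {r e : ℝ} (ha : ‖a‖ ≤ r) (hd : ‖d‖ ≤ r)
    (hac : ‖a - c‖ ≤ e) (hbd : ‖b - d‖ ≤ e) : ‖a * b - c * d‖ ≤ 2 * r * e := by
  have : a * b - c * d = a * (b - d) + (a - c) * d := by ring
  have hr : 0 ≤ r := (norm_nonneg _).trans ha
  have he : 0 ≤ e := (norm_nonneg _).trans hac
  rw [this]
  calc _ ≤ r * e + e * r := by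
        refine norm_add_le_of_le ?_ ?_
        · rw [norm_mul]; gcongr
        · rw [norm_mul]; gcongr
    _ = _ := by ring

/-- Passing from `N` to `M` costs `4|y|/η³` per product of two entries. The off-diagonal square is
kept rather than bounded by `1/η²`, since its sum over `j` is still at most `1/η²`. -/
theorem norm_resolventSlope_sub_le (hM : M.IsSymm) (hN : N.IsSymm) (hη : 0 < η) {i j : V}
    {y : ℝ} (hMN : M - N = y • symmUnit i j) :
    ‖resolventSlope N η i j - imagResolvent M η i i * imagResolvent M η j j‖
      ≤ ‖imagResolvent M η j i‖ ^ 2 + 8 * |y| / η ^ 3 := by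
  have hNM : N - M = (-y) • symmUnit i j := by rw [neg_smul, ← hMN, neg_sub]
  have hb : ∀ k l k' l', ‖imagResolvent N η k l * imagResolvent N η k' l'
      - imagResolvent M η k l * imagResolvent M η k' l'‖ ≤ 4 * |y| / η ^ 3 := by
    intro k l k' l'
    refine (norm_mul_sub_mul_le (norm_imagResolvent_apply_le hN hη _ _)
      (norm_imagResolvent_apply_le hM hη _ _) (norm_imagResolvent_apply_sub_le hN hM hη hNM _ _)
      (norm_imagResolvent_apply_sub_le hN hM hη hNM _ _)).trans_eq ?_
    rw [abs_neg]; field_simp; ring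
  have h1 := hb j i j i
  have h2 := hb j j i i
  rw [resolventSlope]
  split_ifs with hij
  · subst hij
    rw [add_zero]
    refine h1.trans ?_
    have : 0 ≤ ‖imagResolvent M η i i‖ ^ 2 := by positivity
    have : 0 ≤ |y| / η ^ 3 := by positivity
    rw [mul_div_assoc, mul_div_assoc]
    linarith
  · have e : imagResolvent N η j i * imagResolvent N η j i
        + imagResolvent N η j j * imagResolvent N η i i
        - imagResolvent M η i i * imagResolvent M η j j
        = (imagResolvent N η j i * imagResolvent N η j i
          - imagResolvent M η j i * imagResolvent M η j i)
          + (imagResolvent N η j j * imagResolvent N η i i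
            - imagResolvent M η j j * imagResolvent M η i i)
          + imagResolvent M η j i * imagResolvent M η j i := by ring
    rw [e]
    refine (norm_add_le_of_le (norm_add_le_of_le h1 h2) (norm_mul _ _).le).trans_eq ?_
    ring

/-- By cyclicity the difference of traces is a Hilbert–Schmidt pairing of `M - N` with a product of
two resolvents, whose columns have norm at most `1/η²`. It serves for perturbations of large rank
but small Hilbert–Schmidt norm. -/
theorem norm_trace_imagResolvent_sub_sq_le (hM : M.IsSymm) (hN : N.IsSymm) (hη : 0 < η) :
    ‖(imagResolvent M η).trace - (imagResolvent N η).trace‖ ^ 2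
      ≤ Fintype.card V / η ^ 4 * ∑ i, ∑ j, (M i j - N i j) ^ 2 := by
  rw [← Matrix.trace_sub, imagResolvent_sub_imagResolvent hM hN hη.ne', Matrix.trace_neg, norm_neg,
    Matrix.mul_assoc, Matrix.trace_mul_comm, Matrix.mul_assoc, Matrix.trace_mul_comm]
  set P := imagResolvent N η * imagResolvent M η with hP
  have h1 : ∑ p : V × V, ‖P p.1 p.2‖ ^ 2 ≤ Fintype.card V / η ^ 4 := by
    rw [Fintype.sum_prod_type_right]
    calc ∑ i, ∑ j, ‖P j i‖ ^ 2 ≤ ∑ _i : V, (1 / η ^ 2) / η ^ 2 := by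
          refine Finset.sum_le_sum fun i _ => ?_
          have h := sum_norm_sq_imagResolvent_mulVec_le hN hη (fun k => imagResolvent M η k i)
          have h' := sum_norm_sq_imagResolvent_col_le hM hη i
          refine le_trans (le_of_eq ?_) (h.trans (by gcongr))
          rfl
      _ = _ := by simp; field_simp
  have e : ((M - N).map Complex.ofReal * P).trace
      = ∑ p : V × V, P p.1 p.2 * ((M p.2 p.1 - N p.2 p.1 : ℝ) : ℂ) := by
    rw [Fintype.sum_prod_type_right]
    simp only [Matrix.trace, Matrix.diag_apply, Matrix.mul_apply]
    refine Finset.sum_congr rfl fun i _ => Finset.sum_congr rfl fun j _ => ?_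
    rw [mul_comm]; rfl
  have h2 := norm_sum_mul_sq_le Finset.univ (fun p : V × V => P p.1 p.2)
    (fun p => ((M p.2 p.1 - N p.2 p.1 : ℝ) : ℂ))
  have h3 : ∑ p : V × V, ‖((M p.2 p.1 - N p.2 p.1 : ℝ) : ℂ)‖ ^ 2
      = ∑ i, ∑ j, (M i j - N i j) ^ 2 := by
    rw [Fintype.sum_prod_type_right]
    simp only [Complex.norm_real, Real.norm_eq_abs, sq_abs]
  have h4 : 0 ≤ ∑ i, ∑ j, (M i j - N i j) ^ 2 := by positivity
  rw [Matrix.trace_mul_comm, e]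
  rw [h3] at h2
  exact h2.trans (by gcongr)

/-- Sherman–Morrison: with `u = Gv` the difference of traces is `-c(u·u)/(1 + c(u·v))`. The
numerator is at most `|c|‖u‖²`, and the denominator is at least `|c|η‖u‖²` because `u·v` has
imaginary part `η‖u‖²`. The bound is therefore uniform in `c` and `v`. -/
theorem norm_trace_imagResolvent_rank_one_sub_le (hM : M.IsSymm) (hη : 0 < η) (c : ℝ)
    (v : V → ℝ) :
    ‖(imagResolvent (M + c • Matrix.vecMulVec v v) η).trace - (imagResolvent M η).trace‖
      ≤ 1 / η := by
  have hD : (c • Matrix.vecMulVec v v).IsSymm := by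
    ext i j; simp [Matrix.vecMulVec_apply, mul_comm]
  have hM' : (M + c • Matrix.vecMulVec v v).IsSymm := hM.add hD
  set M' := M + c • Matrix.vecMulVec v v with hM'_def
  set vc : V → ℂ := fun k => (v k : ℂ) with hvc
  have hmap : (M' - M).map Complex.ofReal = (c : ℂ) • Matrix.vecMulVec vc vc := by
    ext i j; simp [hM'_def, Matrix.vecMulVec_apply, hvc]
  have hr := imagResolvent_sub_imagResolvent hM' hM hη.ne'
  rw [hmap, Matrix.mul_smul, Matrix.smul_mul, Matrix.mul_vecMulVec, Matrix.vecMulVec_mul] at hr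
  set G := imagResolvent M η with hG
  set G' := imagResolvent M' η with hG'
  set u := G *ᵥ vc with hu
  set u' := G' *ᵥ vc with hu'
  have hGs : vc ᵥ* G = u := by
    rw [hu, ← Matrix.vecMul_transpose, (imagResolvent_isSymm hM η).eq]
  rw [hGs] at hr
  have hq : (u ⬝ᵥ vc).im = η * ∑ k, ‖u k‖ ^ 2 := by
    have h := im_dotProduct_imagResolvent_mulVec hM hη.ne' vc
    have e : star u ⬝ᵥ vc = star (u ⬝ᵥ vc) := by
      rw [← Matrix.star_dotProduct_star, dotProduct_comm]
      congr 1
      ext k; simp [hvc]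
    rw [← hu, e] at h
    simpa using h
  have hrel : ∀ k, u' k * (1 + c * (u ⬝ᵥ vc)) = u k := by
    intro k
    have h := congrFun (congrArg (fun A => A *ᵥ vc) hr) k
    simp only [Matrix.sub_mulVec, Matrix.neg_mulVec, Matrix.smul_mulVec, Matrix.vecMulVec_mulVec,
      Pi.sub_apply, Pi.neg_apply, Pi.smul_apply, smul_eq_mul, MulOpposite.smul_eq_mul_unop,
      MulOpposite.unop_op, ← hu, ← hu'] at h
    linear_combination h
  have htr : G'.trace - G.trace = -(c * (u' ⬝ᵥ u)) := by
    rw [← Matrix.trace_sub, hr, Matrix.trace_neg, Matrix.trace_smul, Matrix.trace_vecMulVec,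
      smul_eq_mul]
  have hdot : (u' ⬝ᵥ u) * (1 + c * (u ⬝ᵥ vc)) = u ⬝ᵥ u := by
    simp only [dotProduct] at hrel ⊢
    rw [Finset.sum_mul]
    refine Finset.sum_congr rfl fun k _ => ?_
    rw [mul_right_comm, hrel k]
  have huu : ‖u ⬝ᵥ u‖ ≤ ∑ k, ‖u k‖ ^ 2 := by
    refine (norm_sum_le _ _).trans_eq (Finset.sum_congr rfl fun k _ => ?_)
    rw [norm_mul, sq]
  have ht : |c| * (η * ∑ k, ‖u k‖ ^ 2) ≤ ‖1 + c * (u ⬝ᵥ vc)‖ := by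
    refine le_trans (le_of_eq ?_) (Complex.abs_im_le_norm _)
    have h0 : (1 + c * (u ⬝ᵥ vc)).im = c * (u ⬝ᵥ vc).im := by simp
    have hS : 0 ≤ ∑ k, ‖u k‖ ^ 2 := by positivity
    rw [h0, hq, abs_mul, abs_of_nonneg (mul_nonneg hη.le hS)]
  rw [htr, norm_neg, norm_mul, Complex.norm_real, Real.norm_eq_abs]
  have hS : 0 ≤ ∑ k, ‖u k‖ ^ 2 := by positivity
  rw [← hdot, norm_mul] at huu
  have hzero : ∑ k, ‖u k‖ ^ 2 = 0 → u' ⬝ᵥ u = 0 := by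
    intro h0
    rw [Finset.sum_eq_zero_iff_of_nonneg fun _ _ => by positivity] at h0
    refine Finset.sum_eq_zero fun k _ => ?_
    have := h0 k (Finset.mem_univ k)
    rw [norm_eq_zero.1 (pow_eq_zero_iff two_ne_zero |>.1 this), mul_zero]
  generalize ∑ k, ‖u k‖ ^ 2 = S at *
  generalize ‖1 + (c : ℂ) * (u ⬝ᵥ vc)‖ = t at *
  have hd : 0 ≤ ‖u' ⬝ᵥ u‖ := norm_nonneg _
  -- The estimate is proved after multiplication by `|c| * S`, so the degenerate cases `c = 0` and
  -- `u = 0` are split off.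
  by_cases hz : |c| * S = 0
  · rcases mul_eq_zero.1 hz with h0 | h0
    · rw [h0, zero_mul]; positivity
    · rw [hzero h0, norm_zero, mul_zero]; positivity
  · have hpos : 0 < |c| * S := lt_of_le_of_ne (by positivity) (Ne.symm hz)
    rw [le_div_iff₀ hη]
    refine le_of_mul_le_mul_right ?_ hpos
    calc |c| * ‖u' ⬝ᵥ u‖ * η * (|c| * S) = |c| * (‖u' ⬝ᵥ u‖ * (|c| * (η * S))) := by ring
      _ ≤ |c| * (‖u' ⬝ᵥ u‖ * t) := by gcongr
      _ ≤ |c| * S := by gcongr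
      _ = 1 * (|c| * S) := (one_mul _).symm

theorem trace_imagResolvent_eq (hM : M.IsSymm) (hη : η ≠ 0) :
    (imagResolvent M η).trace
      = (M.charpoly.roots.map fun t : ℝ => ((t : ℂ) - η * Complex.I)⁻¹).sum := by
  have hMr : M.IsHermitian := by
    ext i j; simp [Matrix.conjTranspose_apply, hM.apply]
  have hH := hM.isHermitian_ofReal
  have hroots : (M.map Complex.ofReal).charpoly.roots = M.charpoly.roots.map Complex.ofReal := by
    have h1 : (M.map Complex.ofReal).charpoly = M.charpoly.map Complex.ofRealHom :=
      Matrix.charpoly_map M Complex.ofRealHom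
    rw [h1, hMr.splits_charpoly.roots_map]
    rfl
  have e : (M.charpoly.roots.map fun t : ℝ => ((t : ℂ) - η * Complex.I)⁻¹)
      = ((M.map Complex.ofReal).charpoly.roots.map fun t : ℂ => (t - η * Complex.I)⁻¹) := by
    rw [hroots, Multiset.map_map]; rfl
  rw [e, hH.roots_charpoly_eq_eigenvalues, Multiset.map_map]
  change _ = ∑ i, ((hH.eigenvalues i : ℂ) - η * Complex.I)⁻¹
  set U : Matrix V V ℂ := hH.eigenvectorUnitary.1 with hU
  have hUU : U * star U = 1 := Unitary.coe_mul_star_self _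
  have hUU' : star U * U = 1 := Unitary.coe_star_mul_self _
  have hspec : M.map Complex.ofReal
      = U * Matrix.diagonal (fun i => (hH.eigenvalues i : ℂ)) * star U := hH.spectral_theorem
  clear_value U
  generalize hH.eigenvalues = lam at hspec ⊢
  have hne : ∀ i, (lam i : ℂ) - η * Complex.I ≠ 0 := by
    intro i h
    have := congrArg Complex.im h
    simp at this
    exact hη this
  have hinv : imagResolvent M η
      = U * Matrix.diagonal (fun i => ((lam i : ℂ) - η * Complex.I)⁻¹) * star U := by
    refine Matrix.inv_eq_right_inv ?_
    have h1 : M.map Complex.ofReal - ((η : ℂ) * Complex.I) • (1 : Matrix V V ℂ)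
        = U * Matrix.diagonal (fun i => (lam i : ℂ) - η * Complex.I) * star U := by
      rw [hspec, ← Matrix.diagonal_sub, mul_sub, sub_mul, ← Matrix.smul_one_eq_diagonal,
        Matrix.mul_smul, Matrix.smul_mul, mul_one, hUU]
    rw [h1]
    calc _ = U * (Matrix.diagonal (fun i => (lam i : ℂ) - η * Complex.I) *
          (star U * U) *
          Matrix.diagonal (fun i => ((lam i : ℂ) - η * Complex.I)⁻¹)) * star U := by
            simp only [mul_assoc]
      _ = 1 := by
        rw [hUU', mul_one, Matrix.diagonal_mul_diagonal]
        simp [mul_inv_cancel₀ (hne _), hUU]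
  rw [hinv, Matrix.trace_mul_comm, ← mul_assoc, hUU', one_mul, Matrix.trace_diagonal]

end Perturbation

/-! ### McDiarmid's inequality. -/

section BoundedDifferences

variable {E : Type*} [MeasurableSpace E]

theorem integrable_of_measurable_of_abs_le {Ω : Type*} [MeasurableSpace Ω] {P : Measure Ω}
    [IsFiniteMeasure P] {f : Ω → ℝ} (hf : Measurable f) {B : ℝ} (hB : ∀ x, |f x| ≤ B) :
    Integrable f P :=
  Integrable.of_bound hf.aestronglyMeasurable B (ae_of_all _ hB)

theorem integrable_exp_mul_of_abs_le {Ω : Type*} [MeasurableSpace Ω] {P : Measure Ω}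
    [IsFiniteMeasure P] {f : Ω → ℝ} (hf : Measurable f) {B : ℝ} (hB : ∀ x, |f x| ≤ B) (t : ℝ) :
    Integrable (fun x => Real.exp (t * f x)) P := by
  refine integrable_of_measurable_of_abs_le (by fun_prop) (B := Real.exp (|t| * B)) fun x => ?_
  rw [abs_of_pos (Real.exp_pos _), Real.exp_le_exp]
  calc t * f x ≤ |t * f x| := le_abs_self _
    _ = |t| * |f x| := abs_mul _ _
    _ ≤ |t| * B := by gcongr; exact hB x

/-- Induction on the number of coordinates: average out the first one to get `g`, which inherits the
bounded differences. For fixed remaining coordinates `f - g` is centred with values in `[-c, c]`, so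
Hoeffding's lemma bounds its moment generating function by `exp(c²t²/2)`, and these factors
multiply. -/
theorem hasSubgaussianMGF_pi_fin {c : ℝ≥0} :
    ∀ {N : ℕ} (ν : Fin N → Measure E) [∀ i, IsProbabilityMeasure (ν i)] {f : (Fin N → E) → ℝ},
      Measurable f → ∀ {B : ℝ}, (∀ x, |f x| ≤ B) →
      (∀ x i a, |f (Function.update x i a) - f x| ≤ c) →
      HasSubgaussianMGF (fun x => f x - ∫ y, f y ∂(Measure.pi ν)) (N * c ^ 2) (Measure.pi ν) := by
  intro N
  induction N with
  | zero =>
    intro ν _ f hf B hB hd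
    have h : (fun x => f x - ∫ y, f y ∂(Measure.pi ν)) = fun _ => 0 := by
      funext x
      have : ∀ y, f y = f x := fun y => congrArg f (Subsingleton.elim _ _)
      simp [this]
    rw [h]
    simp
  | succ N ih =>
    intro ν _ f hf B hB hd
    set π := Measure.pi fun i : Fin N => ν i.succ with hπ
    have hmp := (measurePreserving_piFinSuccAbove ν 0).symm
    have hsymm : ∀ p : E × (Fin N → E),
        (MeasurableEquiv.piFinSuccAbove (fun _ => E) 0).symm p = Fin.cons p.1 p.2 := by
      intro p
      simp [MeasurableEquiv.piFinSuccAbove, Fin.insertNthEquiv]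
    have hint : ∀ F : (Fin (N + 1) → E) → ℝ, Measurable F → ∀ C : ℝ, (∀ x, |F x| ≤ C) →
        ∫ x, F x ∂(Measure.pi ν) = ∫ y, ∫ x, F (Fin.cons x y) ∂(ν 0) ∂π := by
      intro F hF C hC
      rw [← hmp.integral_comp' F]
      simp only [hsymm]
      have hmeas : Measurable fun p : E × (Fin N → E) => F (Fin.cons p.1 p.2) := by
        simp only [← hsymm]
        exact hF.comp (MeasurableEquiv.measurable _)
      exact integral_prod_symm (fun p : E × (Fin N → E) => F (Fin.cons p.1 p.2))
        (integrable_of_measurable_of_abs_le hmeas fun _ => hC _)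
    have hcons : Measurable fun p : E × (Fin N → E) => f (Fin.cons p.1 p.2) := by
      simp only [← hsymm]
      exact hf.comp (MeasurableEquiv.measurable _)
    set g : (Fin N → E) → ℝ := fun y => ∫ x, f (Fin.cons x y) ∂(ν 0) with hg
    have hslice : ∀ y, Measurable fun x => f (Fin.cons x y) := fun y =>
      hcons.comp (measurable_id.prodMk measurable_const)
    have hslint : ∀ y, Integrable (fun x => f (Fin.cons x y)) (ν 0) := fun y =>
      integrable_of_measurable_of_abs_le (hslice y) fun _ => hB _
    have hgm : Measurable g := by
      have h : StronglyMeasurable (Function.uncurry fun (y : Fin N → E) (x : E) =>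
        f (Fin.cons x y)) := (hcons.comp measurable_swap).stronglyMeasurable
      exact (h.integral_prod_right (ν := ν 0)).measurable
    have hgB : ∀ y, |g y| ≤ B := fun y => by
      have := norm_integral_le_of_norm_le_const (μ := ν 0) (f := fun x => f (Fin.cons x y))
        (ae_of_all _ fun x => hB _)
      simpa using this
    have hgd : ∀ y i a, |g (Function.update y i a) - g y| ≤ c := by
      intro y i a
      have e : g (Function.update y i a) - g y
          = ∫ x, f (Fin.cons x (Function.update y i a)) - f (Fin.cons x y) ∂(ν 0) :=
        (integral_sub (hslint _) (hslint _)).symm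
      rw [e]
      have := norm_integral_le_of_norm_le_const (μ := ν 0) (C := c)
        (f := fun x => f (Fin.cons x (Function.update y i a)) - f (Fin.cons x y))
        (ae_of_all _ fun x => by rw [Fin.cons_update]; exact hd _ _ _)
      simpa using this
    have hm : ∫ x, f x ∂(Measure.pi ν) = ∫ y, g y ∂π := hint f hf B hB
    set m := ∫ x, f x ∂(Measure.pi ν) with hm'
    have hmB : |m| ≤ B := by
      have := norm_integral_le_of_norm_le_const (μ := Measure.pi ν) (f := f) (ae_of_all _ hB)
      simpa using this
    have hfB : ∀ x, |f x - m| ≤ B + B := fun x => (abs_sub _ _).trans (add_le_add (hB x) hmB)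
    have hgmB : ∀ y, |g y - m| ≤ B + B := fun x => (abs_sub _ _).trans (add_le_add (hgB x) hmB)
    refine ⟨fun t => integrable_exp_mul_of_abs_le (hf.sub_const m) hfB t, fun t => ?_⟩
    have hIH := (ih (fun i => ν i.succ) hgm hgB hgd).mgf_le t
    rw [← hm] at hIH
    have hstep : ∀ y, ∫ x, Real.exp (t * (f (Fin.cons x y) - g y)) ∂(ν 0)
        ≤ Real.exp ((c : ℝ) ^ 2 * t ^ 2 / 2) := by
      intro y
      -- The interval has length `2c`, so the parameter `(length/2)²` is `c²`.
      have hsub : HasSubgaussianMGF (fun x => f (Fin.cons x y) - g y)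
          ((‖(c : ℝ) - (-c)‖₊ / 2) ^ 2) (ν 0) := by
        refine hasSubgaussianMGF_of_mem_Icc_of_integral_eq_zero
          ((hslice y).sub_const _).aemeasurable (ae_of_all _ fun x => ?_) ?_
        · have e : f (Fin.cons x y) - g y = ∫ x', f (Fin.cons x y) - f (Fin.cons x' y) ∂(ν 0) := by
            rw [integral_sub (integrable_const _) (hslint y)]
            simp [hg]
          rw [Set.mem_Icc, ← abs_le, e]
          have := norm_integral_le_of_norm_le_const (μ := ν 0) (C := c)
            (f := fun x' => f (Fin.cons x y) - f (Fin.cons x' y))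
            (ae_of_all _ fun x' => by
              have := hd (Fin.cons x' y) 0 x
              rwa [Fin.update_cons_zero] at this)
          simpa using this
        · rw [integral_sub (hslint y) (integrable_const _)]
          simp [hg]
      have hc : ((‖(c : ℝ) - (-c)‖₊ / 2) ^ 2 : ℝ≥0) = c ^ 2 := by
        rw [sub_neg_eq_add, ← two_mul, nnnorm_mul]
        simp
      rw [hc] at hsub
      simpa [mgf] using hsub.mgf_le t
    calc mgf (fun x => f x - m) (Measure.pi ν) t
        = ∫ y, ∫ x, Real.exp (t * (f (Fin.cons x y) - m)) ∂(ν 0) ∂π := by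
          rw [mgf]
          refine hint (fun x => Real.exp (t * (f x - m))) (by fun_prop)
            (Real.exp (|t| * (B + B))) fun x => ?_
          rw [abs_of_pos (Real.exp_pos _), Real.exp_le_exp]
          refine (le_abs_self _).trans ?_
          rw [abs_mul]
          gcongr
          exact hfB x
      _ = ∫ y, Real.exp (t * (g y - m)) *
            ∫ x, Real.exp (t * (f (Fin.cons x y) - g y)) ∂(ν 0) ∂π := by
          refine integral_congr_ae (ae_of_all _ fun y => ?_)
          dsimp only
          rw [← integral_const_mul]
          refine integral_congr_ae (ae_of_all _ fun x => ?_)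
          dsimp only
          rw [← Real.exp_add]
          congr 1
          ring
      _ ≤ ∫ y, Real.exp (t * (g y - m)) * Real.exp ((c : ℝ) ^ 2 * t ^ 2 / 2) ∂π := by
          refine integral_mono_of_nonneg (ae_of_all _ fun y => ?_)
            ((integrable_exp_mul_of_abs_le (hgm.sub_const m) hgmB t).mul_const _)
            (ae_of_all _ fun y => ?_)
          · exact mul_nonneg (Real.exp_pos _).le (integral_nonneg fun _ => (Real.exp_pos _).le)
          · exact mul_le_mul_of_nonneg_left (hstep y) (Real.exp_pos _).le
      _ = mgf (fun y => g y - m) π t * Real.exp ((c : ℝ) ^ 2 * t ^ 2 / 2) := by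
          rw [integral_mul_const, mgf]
      _ ≤ Real.exp ((N * c ^ 2 : ℝ≥0) * t ^ 2 / 2) * Real.exp ((c : ℝ) ^ 2 * t ^ 2 / 2) := by
          gcongr
      _ = _ := by
          rw [← Real.exp_add]
          congr 1
          push_cast
          ring

/-- **McDiarmid's inequality** (sub-Gaussian form): a function of independent random variables with
bounded differences is sub-Gaussian around its mean. -/
theorem hasSubgaussianMGF_of_bounded_differences {Ω ι : Type*} [MeasurableSpace Ω] {P : Measure Ω}
    [IsProbabilityMeasure P] [Fintype ι] [DecidableEq ι] {X : ι → Ω → E}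
    (hX : ∀ i, Measurable (X i)) (hind : iIndepFun X P) {f : (ι → E) → ℝ} (hf : Measurable f)
    {B : ℝ} (hB : ∀ x, |f x| ≤ B) {c : ℝ≥0}
    (hd : ∀ x i a, |f (Function.update x i a) - f x| ≤ c) :
    HasSubgaussianMGF (fun ω => f (fun i => X i ω) - ∫ ω', f (fun i => X i ω') ∂P)
      (Fintype.card ι * c ^ 2) P := by
  set e := Fintype.equivFin ι with he
  have hind' : iIndepFun (fun i => X (e.symm i)) P := hind.precomp e.symm.injective
  have hmap := (iIndepFun_iff_map_fun_eq_pi_map fun i => (hX (e.symm i)).aemeasurable).1 hind'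
  have hprob : ∀ i, IsProbabilityMeasure (P.map (X (e.symm i))) := fun i =>
    Measure.isProbabilityMeasure_map (hX _).aemeasurable
  have hfm : Measurable fun y : Fin (Fintype.card ι) → E => f fun i => y (e i) :=
    hf.comp (measurable_pi_lambda _ fun i => measurable_pi_apply _)
  have h := hasSubgaussianMGF_pi_fin (c := c) (fun i => P.map (X (e.symm i)))
    (f := fun y => f fun i => y (e i)) hfm (fun _ => hB _) (fun x i a => by
      have := hd (fun j => x (e j)) (e.symm i) a
      convert this using 4
      funext j
      by_cases hj : e j = i
      · subst hj; simp
      · rw [Function.update_of_ne hj, Function.update_of_ne]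
        rintro rfl; simp at hj)
  have hXm : Measurable fun ω i => X (e.symm i) ω := measurable_pi_lambda _ fun i => hX _
  rw [← hmap] at h
  have h2 := HasSubgaussianMGF.of_map hXm.aemeasurable h
  rw [integral_map hXm.aemeasurable hfm.aestronglyMeasurable] at h2
  simpa [Function.comp_def] using h2

end BoundedDifferences

/-! ### Measurability of resolvent entries. -/

section Measurability

variable {V : Type*} [Fintype V] [DecidableEq V] {T : Type*} [MeasurableSpace T]

theorem measurable_det {A : T → Matrix V V ℂ} (hA : ∀ i j, Measurable fun t => A t i j) :
    Measurable fun t => (A t).det := by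
  simp only [Matrix.det_apply]
  exact Finset.measurable_sum _ fun σ _ =>
    (Finset.measurable_prod _ fun i _ => hA _ _).const_smul _

/-- Cramer's rule: each entry is a quotient of determinants, hence of polynomials in the entries of
`M`. -/
theorem measurable_imagResolvent_apply {M : T → Matrix V V ℝ}
    (hM : ∀ i j, Measurable fun t => M t i j) (η : ℝ) (i j : V) :
    Measurable fun t => imagResolvent (M t) η i j := by
  have hA : ∀ k l, Measurable fun t =>
      ((M t).map Complex.ofReal - ((η : ℂ) * Complex.I) • (1 : Matrix V V ℂ)) k l := fun k l =>
    (Complex.measurable_ofReal.comp (hM k l)).sub measurable_const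
  simp only [imagResolvent, Matrix.inv_def, Ring.inverse_eq_inv', Matrix.smul_apply, smul_eq_mul,
    Matrix.adjugate_apply]
  refine (measurable_det hA).inv.mul (measurable_det fun k l => ?_)
  simp only [Matrix.updateRow_apply]
  split_ifs
  · exact measurable_const
  · exact hA k l

end Measurability

/-! ### Bounded Wigner matrices and concentration of weighted resolvent traces. -/

/-- Integrate `|x| ≤ δ(exp(x/δ) + exp(-x/δ))`; both exponential moments are at most `exp(1/2) ≤ 2`.
-/
theorem ProbabilityTheory.HasSubgaussianMGF.integral_abs_le {Ω : Type*} [MeasurableSpace Ω]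
    {P : Measure Ω} {X : Ω → ℝ} {c : ℝ≥0} (h : HasSubgaussianMGF X c P)
    {δ : ℝ} (hδ : 0 < δ) (hc : (c : ℝ) ≤ δ ^ 2) : ∫ ω, |X ω| ∂P ≤ 4 * δ := by
  have h1 := h.mgf_le δ⁻¹
  have h2 := h.mgf_le (-δ⁻¹)
  have hle : Real.exp (c * δ⁻¹ ^ 2 / 2) ≤ 2 := by
    have : (c : ℝ) * δ⁻¹ ^ 2 ≤ 1 := by
      rw [inv_pow, ← div_eq_mul_inv, div_le_one (by positivity)]; exact hc
    calc Real.exp (c * δ⁻¹ ^ 2 / 2) ≤ Real.exp (1 / 2) := by gcongr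
      _ ≤ 2 := by
        have h3 : Real.exp (1 / 2) ^ 2 ≤ 2 ^ 2 := by
          rw [← Real.exp_nat_mul]
          have := Real.exp_one_lt_d9
          norm_num
          linarith
        exact le_of_sq_le_sq h3 (by norm_num)
  rw [neg_sq] at h2
  calc ∫ ω, |X ω| ∂P
      ≤ ∫ ω, δ * (Real.exp (δ⁻¹ * X ω) + Real.exp (-δ⁻¹ * X ω)) ∂P := by
        refine integral_mono_of_nonneg (ae_of_all _ fun ω => abs_nonneg _)
          (((h.integrable_exp_mul _).add (h.integrable_exp_mul _)).const_mul δ)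
          (ae_of_all _ fun ω => ?_)
        dsimp only
        have e : |X ω| = δ * (δ⁻¹ * |X ω|) := by field_simp
        rw [e]
        refine mul_le_mul_of_nonneg_left ?_ hδ.le
        have hx : ∀ x : ℝ, x ≤ Real.exp x := fun x => by linarith [Real.add_one_le_exp x]
        have p1 := Real.exp_pos (δ⁻¹ * X ω)
        have p2 := Real.exp_pos (-δ⁻¹ * X ω)
        rcases abs_cases (X ω) with ⟨ha, _⟩ | ⟨ha, _⟩
        · rw [ha]; linarith [hx (δ⁻¹ * X ω)]
        · rw [ha]
          have := hx (-δ⁻¹ * X ω)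
          have e2 : δ⁻¹ * -X ω = -δ⁻¹ * X ω := by ring
          rw [e2]; linarith
    _ = δ * (mgf X P δ⁻¹ + mgf X P (-δ⁻¹)) := by
        rw [integral_const_mul, integral_add (h.integrable_exp_mul _) (h.integrable_exp_mul _)]
        rfl
    _ ≤ δ * (2 + 2) := by gcongr <;> linarith
    _ = 4 * δ := by ring

/-- A random real symmetric matrix with centred entries, independent on and above the diagonal,
bounded by `κ`, the entry `(i, j)` having variance `s i j`. -/
structure IsBoundedWigner {Ω : Type*} [MeasurableSpace Ω] (P : Measure Ω) {V : Type*} [LinearOrder V]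
    (κ : ℝ) (s : V → V → ℝ) (X : Ω → Matrix V V ℝ) : Prop where
  measurable_entry : ∀ i j, Measurable fun ω => X ω i j
  isSymm : ∀ ω, (X ω).IsSymm
  independent : iIndepFun (fun (p : {p : V × V // p.1 ≤ p.2}) (ω : Ω) => X ω p.1.1 p.1.2) P
  bound : ∀ i j ω, |X ω i j| ≤ κ
  integral_entry : ∀ i j, ∫ ω, X ω i j ∂P = 0
  integral_entry_sq : ∀ i j, ∫ ω, X ω i j ^ 2 ∂P = s i j

/-- The position on or above the diagonal corresponding to `(i, j)`. -/
def upperIndex {V : Type*} [LinearOrder V] (i j : V) : {p : V × V // p.1 ≤ p.2} :=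
  ⟨(min i j, max i j), min_le_max⟩

theorem upperIndex_comm {V : Type*} [LinearOrder V] (i j : V) : upperIndex i j = upperIndex j i := by
  simp only [upperIndex, min_comm, max_comm]

theorem Matrix.IsSymm.apply_upperIndex {V : Type*} [LinearOrder V] {M : Matrix V V ℝ}
    (hM : M.IsSymm) (i j : V) : M (upperIndex i j).1.1 (upperIndex i j).1.2 = M i j := by
  rcases le_total i j with h | h
  · simp [upperIndex, h]
  · simp [upperIndex, h, hM.apply]

theorem upperIndex_eq_iff {V : Type*} [LinearOrder V] (i j k l : V) :
    upperIndex k l = upperIndex i j ↔ (i = k ∧ j = l) ∨ (j = k ∧ i = l) := by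
  constructor
  · intro h
    simp only [upperIndex, Subtype.mk.injEq, Prod.mk.injEq] at h
    rcases le_total i j with h1 | h1 <;> rcases le_total k l with h2 | h2 <;>
      simp only [min_eq_left, min_eq_right, max_eq_left, max_eq_right, h1, h2] at h <;>
      simp [h]
  · rintro (⟨rfl, rfl⟩ | ⟨rfl, rfl⟩)
    · rfl
    · exact upperIndex_comm _ _

theorem symmUnit_apply {V : Type*} [LinearOrder V] (i j k l : V) :
    symmUnit i j k l = if upperIndex k l = upperIndex i j then 1 else 0 := by
  simp only [upperIndex_eq_iff, symmUnit]
  by_cases hij : i = j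
  · subst hij
    simp only [if_true, Matrix.single_apply, or_self]
  · simp only [if_neg hij, Matrix.add_apply, Matrix.single_apply]
    split_ifs with h1 h2 h3 h4 h5 h6
    · exact absurd (h1.1.trans h2.1.symm) hij
    all_goals first | simp; done | (exfalso; tauto)

/-- The symmetric matrix with prescribed entries on and above the diagonal. -/
def symmOfUpper {V : Type*} [LinearOrder V] (x : {p : V × V // p.1 ≤ p.2} → ℝ) : Matrix V V ℝ :=
  Matrix.of fun i j => x (upperIndex i j)

theorem symmOfUpper_isSymm {V : Type*} [LinearOrder V] (x : {p : V × V // p.1 ≤ p.2} → ℝ) :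
    (symmOfUpper x).IsSymm := by
  ext i j
  simp [symmOfUpper, upperIndex_comm i j]

theorem symmOfUpper_sub {V : Type*} [LinearOrder V] (x y : {p : V × V // p.1 ≤ p.2} → ℝ)
    (p : {p : V × V // p.1 ≤ p.2}) (h : ∀ q, q ≠ p → x q = y q) :
    symmOfUpper x - symmOfUpper y = (x p - y p) • symmUnit p.1.1 p.1.2 := by
  have hp : upperIndex p.1.1 p.1.2 = p := by
    apply Subtype.ext
    simp [upperIndex, p.2]
  ext i j
  simp only [symmOfUpper, Matrix.sub_apply, Matrix.of_apply, Matrix.smul_apply, symmUnit_apply, hp]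
  split_ifs with hq
  · simp [hq]
  · simp [h _ hq]

section Concentration

variable {Ω : Type*} [MeasurableSpace Ω] {P : Measure Ω} [IsProbabilityMeasure P]
  {V : Type*} [Fintype V] [LinearOrder V] {κ : ℝ} {s : V → V → ℝ} {X : Ω → Matrix V V ℝ} {η : ℝ}

/-- McDiarmid applied to the trace as a function of the entries on and above the diagonal. The
functional `L` stands for the real or the imaginary part. An entry moves by at most `2κ`, which
gives the difference constant `2 * (2κ) * c / η²`. -/
theorem IsBoundedWigner.hasSubgaussianMGF (hX : IsBoundedWigner P κ s X) (hκ : 0 ≤ κ) (hη : 0 < η)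
    {w : V → ℝ} {c : ℝ≥0} (hw : ∀ j, |w j| ≤ c) (L : ℂ →L[ℝ] ℝ) (hL : ∀ z, |L z| ≤ ‖z‖) :
    HasSubgaussianMGF (fun ω => L (∑ j, (w j : ℂ) * imagResolvent (X ω) η j j)
        - ∫ ω', L (∑ j, (w j : ℂ) * imagResolvent (X ω') η j j) ∂P)
      (Fintype.card {p : V × V // p.1 ≤ p.2} * Real.toNNReal (4 * κ * c / η ^ 2) ^ 2) P := by
  have hκ' : -κ ≤ κ := by linarith
  -- Bounded differences are needed at all points of the product space, so the entries are regarded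
  -- as taking values in `[-κ, κ]`; the projection does not change them.
  set Y : {p : V × V // p.1 ≤ p.2} → Ω → Set.Icc (-κ) κ :=
    fun p ω => Set.projIcc (-κ) κ hκ' (X ω p.1.1 p.1.2) with hY
  have hproj : Measurable (Set.projIcc (-κ) κ hκ') := continuous_projIcc.measurable
  have hYm : ∀ p, Measurable (Y p) := fun p => hproj.comp (hX.measurable_entry _ _)
  have hYi : iIndepFun Y P := hX.independent.comp (fun _ => Set.projIcc (-κ) κ hκ') fun _ => hproj
  set F : ({p : V × V // p.1 ≤ p.2} → Set.Icc (-κ) κ) → ℝ := fun x =>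
    L (∑ j, (w j : ℂ) * imagResolvent (symmOfUpper fun p => (x p : ℝ)) η j j) with hF
  have hFm : Measurable F := by
    refine L.continuous.measurable.comp (Finset.measurable_sum _ fun j _ => ?_)
    refine measurable_const.mul (measurable_imagResolvent_apply (fun i j => ?_) η j j)
    exact measurable_subtype_coe.comp (measurable_pi_apply _)
  have hFB : ∀ x, |F x| ≤ ∑ j : V, (c : ℝ) * (1 / η) := fun x => by
    refine (hL _).trans ((norm_sum_le _ _).trans (Finset.sum_le_sum fun j _ => ?_))
    rw [norm_mul, Complex.norm_real]
    gcongr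
    · exact hw j
    · exact norm_imagResolvent_apply_le (symmOfUpper_isSymm _) hη j j
  have hFd : ∀ x p a, |F (Function.update x p a) - F x| ≤ Real.toNNReal (4 * κ * c / η ^ 2) := by
    intro x p a
    rw [Real.coe_toNNReal _ (by positivity), hF]
    dsimp only
    rw [← map_sub]
    refine (hL _).trans ?_
    have hd := symmOfUpper_sub (fun q => ((Function.update x p a q : Set.Icc (-κ) κ) : ℝ))
      (fun q => (x q : ℝ)) p (fun q hq => by rw [Function.update_of_ne hq])
    rw [Function.update_self] at hd
    refine (norm_sum_weight_sub_le (symmOfUpper_isSymm _) (symmOfUpper_isSymm _) hη hd w hw).trans ?_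
    gcongr ?_ * _ / _
    have h1 := a.2
    have h2 := (x p).2
    have : |(a : ℝ) - x p| ≤ 2 * κ := by
      rw [abs_le]; constructor <;> linarith [h1.1, h1.2, h2.1, h2.2]
    linarith
  have h := hasSubgaussianMGF_of_bounded_differences hYm hYi hFm hFB hFd
  have hXY : ∀ ω, F (fun p => Y p ω) = L (∑ j, (w j : ℂ) * imagResolvent (X ω) η j j) := by
    intro ω
    have e : (symmOfUpper fun p => ((Y p ω : Set.Icc (-κ) κ) : ℝ)) = X ω := by
      ext i j
      simp only [symmOfUpper, Matrix.of_apply, hY]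
      rw [Set.projIcc_of_mem hκ' (abs_le.1 (hX.bound _ _ ω))]
      exact (hX.isSymm ω).apply_upperIndex i j
    simp only [hF, e]
  simpa only [hXY] using h

theorem coe_card_mul_toNNReal_le {κ c η : ℝ} (h : 0 ≤ κ * c) :
    ((Fintype.card {p : V × V // p.1 ≤ p.2} * Real.toNNReal (4 * κ * c / η ^ 2) ^ 2 : ℝ≥0) : ℝ)
      ≤ (4 * Fintype.card V * κ * c / η ^ 2) ^ 2 := by
  have h1 : (Fintype.card {p : V × V // p.1 ≤ p.2} : ℝ) ≤ (Fintype.card V : ℝ) ^ 2 := by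
    have := Fintype.card_subtype_le (fun p : V × V => p.1 ≤ p.2)
    rw [Fintype.card_prod, ← sq] at this
    exact_mod_cast this
  have h0 : 0 ≤ 4 * κ * c / η ^ 2 := by
    rw [mul_assoc]; positivity
  push_cast
  rw [Real.coe_toNNReal _ h0]
  calc _ ≤ (Fintype.card V : ℝ) ^ 2 * (4 * κ * c / η ^ 2) ^ 2 := by gcongr
    _ = _ := by ring

theorem IsBoundedWigner.integrable_apply (hX : IsBoundedWigner P κ s X) (hη : 0 < η) (i j : V) :
    Integrable (fun ω => imagResolvent (X ω) η i j) P :=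
  Integrable.of_bound (measurable_imagResolvent_apply hX.measurable_entry η i j).aestronglyMeasurable
    (1 / η) (ae_of_all _ fun ω => norm_imagResolvent_apply_le (hX.isSymm ω) hη i j)

theorem IsBoundedWigner.integrable_weighted (hX : IsBoundedWigner P κ s X) (hη : 0 < η)
    (w : V → ℝ) : Integrable (fun ω => ∑ j, (w j : ℂ) * imagResolvent (X ω) η j j) P :=
  integrable_finsetSum _ fun j _ => (hX.integrable_apply hη j j).const_mul _

/-- The real and the imaginary part each contribute `4δ` with `δ = 4 * card V * κ * c / η²`, whence
the factor `32`. -/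
theorem IsBoundedWigner.integral_norm_sub_le (hX : IsBoundedWigner P κ s X) (hη : 0 < η)
    {w : V → ℝ} {c : ℝ} (hc : 0 < c) (hκ : 0 < κ) [Nonempty V] (hw : ∀ j, |w j| ≤ c) :
    ∫ ω, ‖∑ j, (w j : ℂ) * imagResolvent (X ω) η j j
        - ∫ ω', ∑ j, (w j : ℂ) * imagResolvent (X ω') η j j ∂P‖ ∂P
      ≤ 32 * Fintype.card V * κ * c / η ^ 2 := by
  set W : Ω → ℂ := fun ω => ∑ j, (w j : ℂ) * imagResolvent (X ω) η j j with hW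
  have hWi : Integrable W P := hX.integrable_weighted hη w
  have hδ : 0 < 4 * Fintype.card V * κ * c / η ^ 2 := by
    have : 0 < (Fintype.card V : ℝ) := by exact_mod_cast Fintype.card_pos
    positivity
  have hw' : ∀ j, |w j| ≤ Real.toNNReal c := fun j => by rw [Real.coe_toNNReal _ hc.le]; exact hw j
  have key : ∀ L : ℂ →L[ℝ] ℝ, (∀ z, |L z| ≤ ‖z‖) →
      ∫ ω, |L (W ω - ∫ ω', W ω' ∂P)| ∂P ≤ 4 * (4 * Fintype.card V * κ * c / η ^ 2) := by
    intro L hL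
    have h := (hX.hasSubgaussianMGF hκ.le hη hw' L hL).integral_abs_le hδ (by
      have := coe_card_mul_toNNReal_le (V := V) (η := η) (mul_pos hκ hc).le
      rw [Real.coe_toNNReal _ hc.le]
      exact this)
    refine le_trans (le_of_eq ?_) h
    congr 1
    funext ω
    rw [map_sub, ← L.integral_comp_comm hWi]
  have h1 := key Complex.reCLM Complex.abs_re_le_norm
  have h2 := key Complex.imCLM Complex.abs_im_le_norm
  have hD : Integrable (fun ω => W ω - ∫ ω', W ω' ∂P) P := hWi.sub (integrable_const _)
  calc ∫ ω, ‖W ω - ∫ ω', W ω' ∂P‖ ∂P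
      ≤ ∫ ω, |Complex.reCLM (W ω - ∫ ω', W ω' ∂P)| + |Complex.imCLM (W ω - ∫ ω', W ω' ∂P)| ∂P := by
        refine integral_mono hD.norm
          ((Complex.reCLM.integrable_comp hD).abs.add (Complex.imCLM.integrable_comp hD).abs)
          fun ω => ?_
        exact Complex.norm_le_abs_re_add_abs_im _
    _ = _ := integral_add (Complex.reCLM.integrable_comp hD).abs
          (Complex.imCLM.integrable_comp hD).abs
    _ ≤ _ := add_le_add h1 h2
    _ = _ := by ring

end Concentration

/-! ### Expansion of `E[X i j * G j i]` in a single entry. -/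

section SelfConsistent

/-- The matrix `M` with the entries at `(i, j)` and `(j, i)` set to zero. -/
def eraseEntry {V : Type*} [LinearOrder V] (M : Matrix V V ℝ) (i j : V) : Matrix V V ℝ :=
  M - M i j • symmUnit i j

theorem eraseEntry_isSymm {V : Type*} [LinearOrder V] {M : Matrix V V ℝ} (hM : M.IsSymm) (i j : V) :
    (eraseEntry M i j).IsSymm :=
  hM.sub ((symmUnit_isSymm i j).smul _)

theorem sub_eraseEntry {V : Type*} [LinearOrder V] (M : Matrix V V ℝ) (i j : V) :
    M - eraseEntry M i j = M i j • symmUnit i j := by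
  simp [eraseEntry]

theorem eraseEntry_apply {V : Type*} [LinearOrder V] {M : Matrix V V ℝ} (hM : M.IsSymm)
    (i j k l : V) : eraseEntry M i j k l
      = if upperIndex k l = upperIndex i j then 0
        else M (upperIndex k l).1.1 (upperIndex k l).1.2 := by
  simp only [eraseEntry, Matrix.sub_apply, Matrix.smul_apply, symmUnit_apply, smul_eq_mul]
  split_ifs with h
  · rw [← hM.apply_upperIndex k l, ← hM.apply_upperIndex i j, h]; simp
  · rw [hM.apply_upperIndex]; simp

theorem measurable_resolventSlope {V : Type*} [Fintype V] [DecidableEq V] {T : Type*}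
    [MeasurableSpace T] {M : T → Matrix V V ℝ}
    (hM : ∀ i j, Measurable fun t => M t i j) (η : ℝ) (i j : V) :
    Measurable fun t => resolventSlope (M t) η i j := by
  have h := measurable_imagResolvent_apply hM η
  simp only [resolventSlope]
  refine ((h j i).mul (h j i)).add ?_
  split_ifs
  · exact measurable_const
  · exact (h j j).mul (h i i)

/-- The erased matrix is a function of the other entries on and above the diagonal only. -/
theorem IsBoundedWigner.indepFun_eraseEntry {Ω : Type*} [MeasurableSpace Ω]
    {P : Measure Ω} {V : Type*} [Fintype V] [LinearOrder V] {κ : ℝ} {s : V → V → ℝ}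
    {X : Ω → Matrix V V ℝ} (hX : IsBoundedWigner P κ s X) (i j : V)
    {φ : Matrix V V ℝ → ℂ} (hφ : Measurable fun M : V → V → ℝ => φ (Matrix.of M)) :
    IndepFun (fun ω => X ω i j) (fun ω => φ (eraseEntry (X ω) i j)) P := by
  classical
  set p := upperIndex i j with hp
  have h := hX.independent.indepFun_finset {p} (Finset.univ.erase p) (by simp)
    (fun q => hX.measurable_entry _ _)
  set ψ : (↥(Finset.univ.erase p : Finset {p : V × V // p.1 ≤ p.2}) → ℝ) → Matrix V V ℝ :=
    fun y => Matrix.of fun k l =>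
      if hk : upperIndex k l = p then 0 else y ⟨upperIndex k l, by simp [hk]⟩ with hψ
  have hψm : Measurable fun y => φ (ψ y) := by
    refine hφ.comp (g := fun M : V → V → ℝ => φ (Matrix.of M)) (f := fun y k l => ψ y k l)
      (measurable_pi_lambda _ fun k => measurable_pi_lambda _ fun l => ?_)
    simp only [hψ, Matrix.of_apply]
    split_ifs
    · exact measurable_const
    · exact measurable_pi_apply _
  have hpm : Measurable fun y : ↥({p} : Finset {p : V × V // p.1 ≤ p.2}) → ℝ =>
      y ⟨p, Finset.mem_singleton_self p⟩ := measurable_pi_apply _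
  have h2 := h.comp hpm hψm
  have e1 : (fun ω => X ω i j)
      = (fun y : ↥({p} : Finset {p : V × V // p.1 ≤ p.2}) → ℝ => y ⟨p, Finset.mem_singleton_self p⟩) ∘
        fun (ω : Ω) (q : ↥({p} : Finset {p : V × V // p.1 ≤ p.2})) => X ω q.1.1.1 q.1.1.2 := by
    funext ω
    exact ((hX.isSymm ω).apply_upperIndex i j).symm
  have e2 : (fun ω => φ (eraseEntry (X ω) i j)) = (fun y => φ (ψ y)) ∘
        fun (ω : Ω) (q : ↥(Finset.univ.erase p : Finset {p : V × V // p.1 ≤ p.2})) =>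
          X ω q.1.1.1 q.1.1.2 := by
    funext ω
    simp only [Function.comp_apply]
    congr 1
    ext k l
    rw [eraseEntry_apply (hX.isSymm ω)]
    simp only [hψ, Matrix.of_apply]
    split_ifs <;> rfl
  rw [e1, e2]
  exact h2

variable {Ω : Type*} [MeasurableSpace Ω] {P : Measure Ω} [IsProbabilityMeasure P]
  {V : Type*} [Fintype V] [LinearOrder V] {κ : ℝ} {s : V → V → ℝ} {X : Ω → Matrix V V ℝ} {η : ℝ}

theorem integral_norm_le_of_forall {f : Ω → ℂ} {C : ℝ} (h : ∀ ω, ‖f ω‖ ≤ C) :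
    ‖∫ ω, f ω ∂P‖ ≤ C := by
  simpa using norm_integral_le_of_norm_le_const (μ := P) (ae_of_all _ h)

/-- Approximate integration by parts. In the expansion around the erased matrix the zeroth order
term has mean zero, the first order term factors into `-s i j` times the mean slope, and the
remainder is at most `4κ³/η³`. Replacing the slope by `G i i * G j j` adds `8κ³/η³` and the term
with `‖G j i‖²`. -/
theorem IsBoundedWigner.norm_integral_entry_mul_add_le (hX : IsBoundedWigner P κ s X)
    (hκ : 0 ≤ κ) (hη : 0 < η) (i j : V) :
    ‖∫ ω, (X ω i j : ℂ) * imagResolvent (X ω) η j i ∂P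
        + s i j * ∫ ω, imagResolvent (X ω) η i i * imagResolvent (X ω) η j j ∂P‖
      ≤ 12 * κ ^ 3 / η ^ 3 + κ ^ 2 * ∫ ω, ‖imagResolvent (X ω) η j i‖ ^ 2 ∂P := by
  set G : Ω → Matrix V V ℂ := fun ω => imagResolvent (X ω) η with hG
  set N : Ω → Matrix V V ℝ := fun ω => eraseEntry (X ω) i j with hN
  have hNs : ∀ ω, (N ω).IsSymm := fun ω => eraseEntry_isSymm (hX.isSymm ω) i j
  have hXN : ∀ ω, X ω - N ω = X ω i j • symmUnit i j := fun ω => sub_eraseEntry _ _ _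
  have hNm : ∀ k l, Measurable fun ω => N ω k l := fun k l => by
    simp only [hN, eraseEntry, Matrix.sub_apply, Matrix.smul_apply, smul_eq_mul]
    exact (hX.measurable_entry k l).sub ((hX.measurable_entry i j).mul_const _)
  have hxm : Measurable fun ω => (X ω i j : ℂ) :=
    Complex.measurable_ofReal.comp (hX.measurable_entry i j)
  have hGm : ∀ k l, Measurable fun ω => G ω k l :=
    measurable_imagResolvent_apply hX.measurable_entry η
  have hHm := measurable_imagResolvent_apply hNm η j i
  have hSm := measurable_resolventSlope hNm η i j
  have hxb : ∀ ω, ‖(X ω i j : ℂ)‖ ≤ κ := fun ω => by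
    rw [Complex.norm_real]; exact hX.bound i j ω
  have hHb : ∀ ω, ‖imagResolvent (N ω) η j i‖ ≤ 1 / η := fun ω =>
    norm_imagResolvent_apply_le (hNs ω) hη j i
  have hSb : ∀ ω, ‖resolventSlope (N ω) η i j‖ ≤ 2 / η ^ 2 := fun ω =>
    norm_resolventSlope_le (hNs ω) hη i j
  have hGb : ∀ ω k l, ‖G ω k l‖ ≤ 1 / η := fun ω =>
    norm_imagResolvent_apply_le (hX.isSymm ω) hη
  have bdd : ∀ {f : Ω → ℂ} {C : ℝ}, Measurable f → (∀ ω, ‖f ω‖ ≤ C) → Integrable f P :=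
    fun hf hC => Integrable.of_bound hf.aestronglyMeasurable _ (ae_of_all _ hC)
  have ix : Integrable (fun ω => (X ω i j : ℂ)) P := bdd hxm hxb
  have iH : Integrable (fun ω => imagResolvent (N ω) η j i) P := bdd hHm hHb
  have iS : Integrable (fun ω => resolventSlope (N ω) η i j) P := bdd hSm hSb
  have iG2 : Integrable (fun ω => ‖G ω j i‖ ^ 2) P := by
    refine Integrable.of_bound ((hGm j i).norm.pow_const 2).aestronglyMeasurable ((1 / η) ^ 2)
      (ae_of_all _ fun ω => ?_)
    rw [norm_pow, norm_norm]
    gcongr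
    exact hGb ω j i
  have iGG : Integrable (fun ω => G ω i i * G ω j j) P :=
    bdd ((hGm i i).mul (hGm j j)) fun ω =>
      norm_mul_imagResolvent_apply_le (hX.isSymm ω) (hX.isSymm ω) hη _ _ _ _
  have hind1 : ∫ ω, (X ω i j : ℂ) * imagResolvent (N ω) η j i ∂P = 0 := by
    have h := hX.indepFun_eraseEntry i j (φ := fun M => imagResolvent M η j i)
      (measurable_imagResolvent_apply (fun k l => (measurable_pi_apply l).comp
        (measurable_pi_apply k)) η j i)
    have h' := h.comp (φ := fun x : ℝ => (x : ℂ)) (ψ := id) Complex.measurable_ofReal measurable_id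
    have := h'.integral_fun_mul_eq_mul_integral hxm.aestronglyMeasurable hHm.aestronglyMeasurable
    refine this.trans ?_
    have h0 : ∫ ω, ((fun x : ℝ => (x : ℂ)) ∘ fun ω => X ω i j) ω ∂P = 0 := by
      simp only [Function.comp_apply]
      rw [integral_complex_ofReal, hX.integral_entry, Complex.ofReal_zero]
    rw [h0, zero_mul]
  have hind2 : ∫ ω, (X ω i j : ℂ) ^ 2 * resolventSlope (N ω) η i j ∂P
      = s i j * ∫ ω, resolventSlope (N ω) η i j ∂P := by
    have h := hX.indepFun_eraseEntry i j (φ := fun M => resolventSlope M η i j)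
      (measurable_resolventSlope (fun k l => (measurable_pi_apply l).comp
        (measurable_pi_apply k)) η i j)
    have h' := h.comp (φ := fun x : ℝ => (x : ℂ) ^ 2) (ψ := id)
      (Complex.measurable_ofReal.pow_const 2) measurable_id
    have := h'.integral_fun_mul_eq_mul_integral (hxm.pow_const 2).aestronglyMeasurable
      hSm.aestronglyMeasurable
    refine this.trans ?_
    have h0 : ∫ ω, ((fun x : ℝ => (x : ℂ) ^ 2) ∘ fun ω => X ω i j) ω ∂P = s i j := by
      simp only [Function.comp_apply, ← Complex.ofReal_pow]
      rw [integral_complex_ofReal, hX.integral_entry_sq]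
    rw [h0]; rfl
  have ixS : Integrable (fun ω => (X ω i j : ℂ) ^ 2 * resolventSlope (N ω) η i j) P := by
    refine bdd (C := κ ^ 2 * (2 / η ^ 2)) ((hxm.pow_const 2).mul hSm) fun ω => ?_
    rw [norm_mul, norm_pow]
    gcongr
    · exact hxb ω
    · exact hSb ω
  have ixH : Integrable (fun ω => (X ω i j : ℂ) * imagResolvent (N ω) η j i) P := by
    refine bdd (C := κ * (1 / η)) (hxm.mul hHm) fun ω => ?_
    rw [norm_mul]
    gcongr
    · exact hxb ω
    · exact hHb ω
  have ixG : Integrable (fun ω => (X ω i j : ℂ) * G ω j i) P := by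
    refine bdd (C := κ * (1 / η)) (hxm.mul (hGm j i)) fun ω => ?_
    rw [norm_mul]
    gcongr
    · exact hxb ω
    · exact hGb ω j i
  have hR : ‖∫ ω, (X ω i j : ℂ) * (G ω j i - (imagResolvent (N ω) η j i
      - X ω i j * resolventSlope (N ω) η i j)) ∂P‖ ≤ 4 * κ ^ 3 / η ^ 3 := by
    refine integral_norm_le_of_forall fun ω => ?_
    rw [norm_mul]
    have h1 := norm_imagResolvent_expansion_le (hX.isSymm ω) (hNs ω) hη (hXN ω)
    have h2 : X ω i j ^ 2 ≤ κ ^ 2 := by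
      rw [← sq_abs]; gcongr; exact hX.bound i j ω
    calc _ ≤ κ * (4 * κ ^ 2 / η ^ 3) := by
          gcongr
          · exact hxb ω
          · exact h1.trans (by gcongr)
      _ = _ := by ring
  have hsplit : ∫ ω, (X ω i j : ℂ) * G ω j i ∂P
      = ∫ ω, (X ω i j : ℂ) * (G ω j i - (imagResolvent (N ω) η j i
      - X ω i j * resolventSlope (N ω) η i j)) ∂P - s i j * ∫ ω, resolventSlope (N ω) η i j ∂P := by
    have e : ∀ ω, (X ω i j : ℂ) * (G ω j i - (imagResolvent (N ω) η j i
      - X ω i j * resolventSlope (N ω) η i j)) = (X ω i j : ℂ) * G ω j i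
        - (X ω i j : ℂ) * imagResolvent (N ω) η j i
        + (X ω i j : ℂ) ^ 2 * resolventSlope (N ω) η i j := fun ω => by ring
    simp only [e]
    have h1 := integral_add (ixG.sub ixH) ixS
    have h2 := integral_sub ixG ixH
    simp only [Pi.sub_apply] at h1
    rw [h1, h2, hind1, hind2]
    ring
  have hs0 : 0 ≤ s i j := by
    rw [← hX.integral_entry_sq]; exact integral_nonneg fun ω => sq_nonneg _
  have hsκ : s i j ≤ κ ^ 2 := by
    rw [← hX.integral_entry_sq]
    have := norm_integral_le_of_norm_le_const (μ := P) (f := fun ω => X ω i j ^ 2) (C := κ ^ 2)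
      (ae_of_all _ fun ω => by
        rw [norm_pow]; gcongr; exact hX.bound i j ω)
    exact (le_abs_self _).trans (by simpa using this)
  have hS : ‖∫ ω, resolventSlope (N ω) η i j ∂P - ∫ ω, G ω i i * G ω j j ∂P‖
      ≤ ∫ ω, ‖G ω j i‖ ^ 2 ∂P + 8 * κ / η ^ 3 := by
    rw [← integral_sub iS iGG]
    calc _ ≤ ∫ ω, ‖G ω j i‖ ^ 2 + 8 * κ / η ^ 3 ∂P := by
          refine norm_integral_le_of_norm_le (iG2.add (integrable_const _)) (ae_of_all _ fun ω => ?_)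
          refine (norm_resolventSlope_sub_le (hX.isSymm ω) (hNs ω) hη (hXN ω)).trans ?_
          gcongr
          exact hX.bound i j ω
      _ = _ := by rw [integral_add iG2 (integrable_const _)]; simp
  have e : ∫ ω, (X ω i j : ℂ) * G ω j i ∂P + s i j * ∫ ω, G ω i i * G ω j j ∂P
      = ∫ ω, (X ω i j : ℂ) * (G ω j i - (imagResolvent (N ω) η j i
        - X ω i j * resolventSlope (N ω) η i j)) ∂P
        - s i j * (∫ ω, resolventSlope (N ω) η i j ∂P - ∫ ω, G ω i i * G ω j j ∂P) := by
    rw [hsplit]; ring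
  have hI : 0 ≤ ∫ ω, ‖G ω j i‖ ^ 2 ∂P := integral_nonneg fun ω => by positivity
  rw [e]
  calc _ ≤ 4 * κ ^ 3 / η ^ 3 + κ ^ 2 * (∫ ω, ‖G ω j i‖ ^ 2 ∂P + 8 * κ / η ^ 3) := by
        refine norm_sub_le_of_le hR ?_
        rw [norm_mul, Complex.norm_real, Real.norm_of_nonneg hs0]
        gcongr
    _ = _ := by ring

end SelfConsistent

/-! ### The self-consistent equation and its stability. -/

theorem IsBoundedWigner.variance_nonneg {Ω : Type*} [MeasurableSpace Ω] {P : Measure Ω}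
    {V : Type*} [LinearOrder V] {κ : ℝ} {s : V → V → ℝ} {X : Ω → Matrix V V ℝ}
    (hX : IsBoundedWigner P κ s X) (i j : V) : 0 ≤ s i j := by
  rw [← hX.integral_entry_sq]; exact integral_nonneg fun ω => sq_nonneg _

theorem IsBoundedWigner.variance_le {Ω : Type*} [MeasurableSpace Ω] {P : Measure Ω}
    [IsProbabilityMeasure P] {V : Type*} [LinearOrder V] {κ : ℝ} {s : V → V → ℝ}
    {X : Ω → Matrix V V ℝ} (hX : IsBoundedWigner P κ s X) (i j : V) : s i j ≤ κ ^ 2 := by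
  rw [← hX.integral_entry_sq]
  have := norm_integral_le_of_norm_le_const (μ := P) (f := fun ω => X ω i j ^ 2) (C := κ ^ 2)
    (ae_of_all _ fun ω => by
      rw [norm_pow]; gcongr; exact hX.bound i j ω)
  exact (le_abs_self _).trans (by simpa using this)

section FixedPoint

variable {Ω : Type*} [MeasurableSpace Ω] {P : Measure Ω} [IsProbabilityMeasure P]
  {V : Type*} [Fintype V] [LinearOrder V] {κ : ℝ} {s : V → V → ℝ} {X : Ω → Matrix V V ℝ} {η : ℝ}

/-- The diagonal of `(X - iη)G = 1`, in expectation. Summing the one-entry errors over `j` gives `12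
* card V * κ³/η³ + κ²/η²`, and decoupling `G i i` from the weighted trace adds `32 * card V *
κ³/η³`. For `κ` of order `n^(-1/2)` all of this vanishes. -/
theorem IsBoundedWigner.self_consistent (hX : IsBoundedWigner P κ s X) (hκ : 0 < κ) (hη : 0 < η)
    (i : V) :
    ‖(η : ℂ) * Complex.I * (∫ ω, imagResolvent (X ω) η i i ∂P) + 1
        + (∫ ω, imagResolvent (X ω) η i i ∂P)
          * ∑ j, (s i j : ℂ) * ∫ ω, imagResolvent (X ω) η j j ∂P‖
      ≤ 44 * Fintype.card V * κ ^ 3 / η ^ 3 + κ ^ 2 / η ^ 2 := by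
  have : Nonempty V := ⟨i⟩
  set G : Ω → Matrix V V ℂ := fun ω => imagResolvent (X ω) η with hG
  have iG : ∀ k l, Integrable (fun ω => G ω k l) P := hX.integrable_apply hη
  have hGm : ∀ k l, Measurable fun ω => G ω k l :=
    measurable_imagResolvent_apply hX.measurable_entry η
  have hGb : ∀ ω k l, ‖G ω k l‖ ≤ 1 / η := fun ω =>
    norm_imagResolvent_apply_le (hX.isSymm ω) hη
  have bdd : ∀ {f : Ω → ℂ} {C : ℝ}, Measurable f → (∀ ω, ‖f ω‖ ≤ C) → Integrable f P :=
    fun hf hC => Integrable.of_bound hf.aestronglyMeasurable _ (ae_of_all _ hC)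
  have iG2 : ∀ j, Integrable (fun ω => ‖G ω j i‖ ^ 2) P := fun j => by
    refine Integrable.of_bound ((hGm j i).norm.pow_const 2).aestronglyMeasurable ((1 / η) ^ 2)
      (ae_of_all _ fun ω => ?_)
    rw [norm_pow, norm_norm]
    gcongr
    exact hGb ω j i
  have iGG : ∀ j, Integrable (fun ω => G ω i i * G ω j j) P := fun j =>
    bdd ((hGm i i).mul (hGm j j)) fun ω =>
      norm_mul_imagResolvent_apply_le (hX.isSymm ω) (hX.isSymm ω) hη _ _ _ _
  have ixG : ∀ j, Integrable (fun ω => (X ω i j : ℂ) * G ω j i) P := fun j => by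
    refine bdd (C := κ * (1 / η))
      ((Complex.measurable_ofReal.comp (hX.measurable_entry i j)).mul (hGm j i)) fun ω => ?_
    rw [norm_mul, Complex.norm_real]
    gcongr
    · exact hX.bound i j ω
    · exact hGb ω j i
  set γ : V → ℂ := fun j => ∫ ω, G ω j j ∂P with hγ
  set W : Ω → ℂ := fun ω => ∑ j, (s i j : ℂ) * G ω j j with hW
  have hWi : Integrable W P := hX.integrable_weighted hη (s i)
  have hWint : ∫ ω, W ω ∂P = ∑ j, (s i j : ℂ) * γ j := by
    rw [hW, integral_finsetSum _ fun j _ => (iG j j).const_mul _]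
    exact Finset.sum_congr rfl fun j _ => integral_const_mul _ _
  have hent : ∀ ω, ∑ j, (X ω i j : ℂ) * G ω j i = η * Complex.I * G ω i i + 1 := by
    intro ω
    have h := congrFun (congrFun (sub_mul_imagResolvent (hX.isSymm ω) hη.ne') i) i
    rw [sub_mul, Matrix.smul_mul, one_mul, Matrix.sub_apply, Matrix.mul_apply, Matrix.smul_apply,
      Matrix.one_apply_eq, smul_eq_mul] at h
    simp only [Matrix.map_apply] at h
    linear_combination h
  have h1 : ∑ j, ∫ ω, (X ω i j : ℂ) * G ω j i ∂P = η * Complex.I * γ i + 1 := by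
    rw [← integral_finsetSum _ fun j _ => ixG j]
    simp only [hent]
    rw [integral_add ((iG i i).const_mul _) (integrable_const _), integral_const_mul]
    simp [hγ]
  have h2 : ∑ j, (s i j : ℂ) * ∫ ω, G ω i i * G ω j j ∂P = ∫ ω, G ω i i * W ω ∂P := by
    simp only [hW, Finset.mul_sum]
    rw [integral_finsetSum]
    · refine Finset.sum_congr rfl fun j _ => ?_
      rw [← integral_const_mul]
      congr 1; funext ω; ring
    · intro j _
      refine ((iGG j).const_mul (s i j : ℂ)).congr (ae_of_all _ fun ω => ?_)
      dsimp only; ring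
  have iGW : Integrable (fun ω => G ω i i * W ω) P :=
    hWi.bdd_mul (hGm i i).aestronglyMeasurable (ae_of_all _ fun ω => hGb ω i i)
  -- The covariance is at most `1/η` times the mean deviation of `W`, whose weights `s i j` are at
  -- most `κ²`.
  have h3 : ‖∫ ω, G ω i i * W ω ∂P - γ i * ∫ ω, W ω ∂P‖ ≤ 32 * Fintype.card V * κ ^ 3 / η ^ 3 := by
    have e : ∫ ω, G ω i i * W ω ∂P - γ i * ∫ ω, W ω ∂P
        = ∫ ω, G ω i i * (W ω - ∫ ω', W ω' ∂P) ∂P := by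
      simp only [mul_sub]
      rw [integral_sub iGW ((iG i i).mul_const _), integral_mul_const]
    rw [e]
    have iD : Integrable (fun ω => W ω - ∫ ω', W ω' ∂P) P := hWi.sub (integrable_const _)
    calc _ ≤ ∫ ω, (1 / η) * ‖W ω - ∫ ω', W ω' ∂P‖ ∂P := by
          refine norm_integral_le_of_norm_le (iD.norm.const_mul _) (ae_of_all _ fun ω => ?_)
          rw [norm_mul]
          gcongr
          exact hGb ω i i
      _ ≤ (1 / η) * (32 * Fintype.card V * κ * κ ^ 2 / η ^ 2) := by
          rw [integral_const_mul]
          gcongr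
          refine hX.integral_norm_sub_le hη (by positivity) hκ fun j => ?_
          rw [abs_of_nonneg (hX.variance_nonneg i j)]
          exact hX.variance_le i j
      _ = _ := by field_simp
  have h4 : ‖∑ j, (∫ ω, (X ω i j : ℂ) * G ω j i ∂P + s i j * ∫ ω, G ω i i * G ω j j ∂P)‖
      ≤ 12 * Fintype.card V * κ ^ 3 / η ^ 3 + κ ^ 2 / η ^ 2 := by
    calc _ ≤ ∑ j, (12 * κ ^ 3 / η ^ 3 + κ ^ 2 * ∫ ω, ‖G ω j i‖ ^ 2 ∂P) :=
          norm_sum_le_of_le _ fun j _ => hX.norm_integral_entry_mul_add_le hκ.le hη i j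
      _ = 12 * Fintype.card V * κ ^ 3 / η ^ 3 + κ ^ 2 * ∫ ω, ∑ j, ‖G ω j i‖ ^ 2 ∂P := by
          rw [integral_finsetSum _ fun j _ => iG2 j, Finset.sum_add_distrib, ← Finset.mul_sum]
          simp
          ring
      _ ≤ 12 * Fintype.card V * κ ^ 3 / η ^ 3 + κ ^ 2 * ∫ _ω, 1 / η ^ 2 ∂P := by
          gcongr
          · exact integrable_finsetSum _ fun j _ => iG2 j
          · exact integrable_const _
          intro ω
          exact sum_norm_sq_imagResolvent_col_le (hX.isSymm ω) hη i
      _ = _ := by simp; ring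
  rw [Finset.sum_add_distrib, h1, h2] at h4
  rw [← hWint]
  have e : (η : ℂ) * Complex.I * γ i + 1 + γ i * ∫ ω, W ω ∂P
      = (η * Complex.I * γ i + 1 + ∫ ω, G ω i i * W ω ∂P)
        - (∫ ω, G ω i i * W ω ∂P - γ i * ∫ ω, W ω ∂P) := by ring
  rw [e]
  refine (norm_sub_le_of_le h4 h3).trans_eq ?_
  ring

/-- Take the index `k` with the largest deviation `D` and subtract the two equations: `(γ k - S)(iη
+ ρS)` equals the error minus `γ k` times the difference of the weighted sums. The equation for `S`
with `‖S‖ ≤ 1/η` forces `‖iη + ρS‖ ≥ η`, while `2R ≤ η²` makes the feedback at most `Dη/2`, which is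
absorbed on the left. -/
theorem norm_sub_fixedPoint_le {V : Type*} [Fintype V] {s : V → V → ℝ} {γ : V → ℂ} {S : ℂ}
    {η ρ R d e : ℝ} (hη : 0 < η) (hs : ∀ i j, 0 ≤ s i j) (hR : ∀ i, ∑ j, s i j ≤ R)
    (hd : ∀ i, |∑ j, s i j - ρ| ≤ d) (hγ : ∀ i, ‖γ i‖ ≤ 1 / η)
    (hself : ∀ i, ‖(η : ℂ) * Complex.I * γ i + 1 + γ i * ∑ j, (s i j : ℂ) * γ j‖ ≤ e)
    (hS : S * (η * Complex.I + ρ * S) = -1) (hSη : ‖S‖ ≤ 1 / η) (hRη : 2 * R ≤ η ^ 2) (i : V) :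
    ‖γ i - S‖ ≤ 2 * (e + d / η ^ 2) / η := by
  have : Nonempty V := ⟨i⟩
  obtain ⟨k, hk⟩ := Finite.exists_max fun i => ‖γ i - S‖
  refine (hk i).trans ?_
  set D := ‖γ k - S‖ with hD
  have hD0 : 0 ≤ D := norm_nonneg _
  have hd0 : 0 ≤ d := (abs_nonneg _).trans (hd k)
  have hR0 : 0 ≤ R := (Finset.sum_nonneg fun j _ => hs k j).trans (hR k)
  have h1 : ‖∑ j, (s k j : ℂ) * γ j - ρ * S‖ ≤ R * D + d * (1 / η) := by
    have e1 : ∑ j, (s k j : ℂ) * γ j - ρ * S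
        = ∑ j, (s k j : ℂ) * (γ j - S) + ((∑ j, s k j - ρ : ℝ) : ℂ) * S := by
      push_cast
      simp only [mul_sub, Finset.sum_sub_distrib, sub_mul, Finset.sum_mul]
      ring
    rw [e1]
    refine norm_add_le_of_le ?_ ?_
    · calc _ ≤ ∑ j, s k j * D := norm_sum_le_of_le _ fun j _ => by
            rw [norm_mul, Complex.norm_real, Real.norm_of_nonneg (hs k j)]
            exact mul_le_mul_of_nonneg_left (hk j) (hs k j)
        _ ≤ _ := by
            rw [← Finset.sum_mul]
            exact mul_le_mul_of_nonneg_right (hR k) hD0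
    · rw [norm_mul, Complex.norm_real]
      exact mul_le_mul (hd k) hSη (norm_nonneg _) hd0
  have h2 : η ≤ ‖η * Complex.I + ρ * S‖ := by
    have h := congrArg norm hS
    rw [norm_mul, norm_neg, norm_one] at h
    have h' : 1 ≤ (1 / η) * ‖η * Complex.I + ρ * S‖ := by
      exact h.symm.le.trans (mul_le_mul_of_nonneg_right hSη (norm_nonneg _))
    rw [one_div, ← div_eq_inv_mul, le_div_iff₀ hη, one_mul] at h'
    exact h'
  have h3 : (γ k - S) * (η * Complex.I + ρ * S)
      = (η * Complex.I * γ k + 1 + γ k * ∑ j, (s k j : ℂ) * γ j)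
        - γ k * (∑ j, (s k j : ℂ) * γ j - ρ * S) := by
    linear_combination -hS
  have h4 : D * η ≤ e + (1 / η) * (R * D + d * (1 / η)) := by
    calc D * η ≤ D * ‖η * Complex.I + ρ * S‖ := by gcongr
      _ = ‖(γ k - S) * (η * Complex.I + ρ * S)‖ := (norm_mul _ _).symm
      _ ≤ _ := by
        rw [h3]
        refine norm_sub_le_of_le (hself k) ?_
        rw [norm_mul]
        gcongr
        exact hγ k
  rw [le_div_iff₀ hη]
  have h5 : (1 / η) * (R * D) ≤ D * η / 2 := by
    rw [one_div, ← div_eq_inv_mul, div_le_iff₀ hη]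
    nlinarith
  have h6 : (1 / η) * (R * D + d * (1 / η)) = (1 / η) * (R * D) + d / η ^ 2 := by
    field_simp
  linarith

theorem IsBoundedWigner.norm_integral_trace_sub_le [Nonempty V] (hX : IsBoundedWigner P κ s X)
    (hκ : 0 < κ) (hη : 0 < η) {ρ d : ℝ} {S : ℂ} (hd : ∀ i, |∑ j, s i j - ρ| ≤ d)
    (hS : S * (η * Complex.I + ρ * S) = -1) (hSη : ‖S‖ ≤ 1 / η)
    (hκη : 2 * (Fintype.card V * κ ^ 2) ≤ η ^ 2) :
    ‖∫ ω, ∑ j, (((Fintype.card V : ℝ)⁻¹ : ℝ) : ℂ) * imagResolvent (X ω) η j j ∂P - S‖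
      ≤ 2 * (44 * Fintype.card V * κ ^ 3 / η ^ 3 + κ ^ 2 / η ^ 2 + d / η ^ 2) / η := by
  have hn : (0 : ℝ) < Fintype.card V := by exact_mod_cast Fintype.card_pos
  have h := norm_sub_fixedPoint_le (γ := fun i => ∫ ω, imagResolvent (X ω) η i i ∂P) hη
    hX.variance_nonneg (fun i => (Finset.sum_le_sum fun j _ => hX.variance_le i j).trans_eq
      (by simp)) hd
    (fun i => integral_norm_le_of_forall fun ω =>
      norm_imagResolvent_apply_le (hX.isSymm ω) hη i i)
    (fun i => hX.self_consistent hκ hη i) hS hSη hκη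
  have e : ∫ ω, ∑ j, (((Fintype.card V : ℝ)⁻¹ : ℝ) : ℂ) * imagResolvent (X ω) η j j ∂P - S
      = ∑ j : V, (((Fintype.card V : ℝ)⁻¹ : ℝ) : ℂ) * (∫ ω, imagResolvent (X ω) η j j ∂P - S) := by
    rw [integral_finsetSum _ fun j _ => (hX.integrable_apply hη j j).const_mul _]
    simp only [mul_sub, Finset.sum_sub_distrib, integral_const_mul]
    simp only [Finset.sum_const, Finset.card_univ, nsmul_eq_mul, ← mul_assoc]
    rw [show (Fintype.card V : ℂ) = ((Fintype.card V : ℝ) : ℂ) by simp, ← Complex.ofReal_mul,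
      mul_inv_cancel₀ hn.ne', Complex.ofReal_one, one_mul]
  rw [e]
  set r := 2 * (44 * Fintype.card V * κ ^ 3 / η ^ 3 + κ ^ 2 / η ^ 2 + d / η ^ 2) / η
  calc _ ≤ ∑ _j : V, (Fintype.card V : ℝ)⁻¹ * r := norm_sum_le_of_le _ fun j _ => by
        rw [norm_mul, Complex.norm_real, Real.norm_of_nonneg (by positivity)]
        gcongr
        exact h j
    _ = r := by
        rw [Finset.sum_const, Finset.card_univ, nsmul_eq_mul, ← mul_assoc, mul_inv_cancel₀ hn.ne',
          one_mul]

end FixedPoint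

/-! ### Almost sure convergence of resolvent traces. -/

section AlmostSure

variable {Ω : Type*} [MeasurableSpace Ω] {P : Measure Ω} [IsProbabilityMeasure P]

theorem ProbabilityTheory.HasSubgaussianMGF.mono {Ω : Type*} [MeasurableSpace Ω] {P : Measure Ω}
    {X : Ω → ℝ} {c c' : ℝ≥0} (h : HasSubgaussianMGF X c P) (hc : c ≤ c') :
    HasSubgaussianMGF X c' P :=
  ⟨h.integrable_exp_mul, fun t => (h.mgf_le t).trans (by gcongr)⟩

/-- The Chernoff bound `exp(-ε²n/(2C))` is summable, and the first Borel–Cantelli lemma needs no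
independence between different `n`. -/
theorem ae_eventually_lt_of_hasSubgaussianMGF {Z : ℕ → Ω → ℝ} {c : ℕ → ℝ≥0}
    (hZ : ∀ n, n ≠ 0 → HasSubgaussianMGF (Z n) (c n) P) {C : ℝ≥0} (hC : 0 < C)
    (hc : ∀ n, n ≠ 0 → c n ≤ C / n) {ε : ℝ} (hε : 0 < ε) :
    ∀ᵐ ω ∂P, ∀ᶠ n in atTop, Z n ω < ε := by
  set a : ℝ := ε ^ 2 / (2 * C) with ha
  have ha0 : 0 < a := by positivity
  have hle : ∀ n, P {ω | ε ≤ Z n ω} ≤ ENNReal.ofReal (Real.exp (-a) ^ n) := by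
    intro n
    rcases eq_or_ne n 0 with rfl | hn
    · simpa using prob_le_one
    · have h := ((hZ n hn).mono (hc n hn)).measure_ge_le hε.le
      rw [← ENNReal.ofReal_toReal (measure_ne_top P _)]
      refine ENNReal.ofReal_le_ofReal (h.trans_eq ?_)
      rw [← Real.exp_nat_mul, ha]
      congr 1
      have : (0 : ℝ) < C := hC
      push_cast
      field_simp
  have hsum : Summable fun n : ℕ => Real.exp (-a) ^ n :=
    summable_geometric_of_lt_one (Real.exp_pos _).le (by rw [Real.exp_lt_one_iff]; linarith)
  have hne : ∑' n, P {ω | ε ≤ Z n ω} ≠ ⊤ :=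
    ne_top_of_le_ne_top hsum.tsum_ofReal_ne_top (ENNReal.tsum_le_tsum hle)
  filter_upwards [ae_eventually_notMem hne] with ω hω
  filter_upwards [hω] with n hn
  exact not_le.1 hn

theorem ae_tendsto_zero_of_hasSubgaussianMGF {Z : ℕ → Ω → ℝ} {c : ℕ → ℝ≥0}
    (hZ : ∀ n, n ≠ 0 → HasSubgaussianMGF (Z n) (c n) P) {C : ℝ≥0} (hC : 0 < C)
    (hc : ∀ n, n ≠ 0 → c n ≤ C / n) :
    ∀ᵐ ω ∂P, Tendsto (fun n => Z n ω) atTop (𝓝 0) := by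
  have h1 : ∀ᵐ ω ∂P, ∀ k : ℕ, ∀ᶠ n in atTop, Z n ω < 1 / ((k : ℝ) + 1) :=
    ae_all_iff.2 fun k => ae_eventually_lt_of_hasSubgaussianMGF hZ hC hc (by positivity)
  have h2 : ∀ᵐ ω ∂P, ∀ k : ℕ, ∀ᶠ n in atTop, (-Z n) ω < 1 / ((k : ℝ) + 1) :=
    ae_all_iff.2 fun k => ae_eventually_lt_of_hasSubgaussianMGF (Z := fun n => -Z n)
      (fun n hn => (hZ n hn).neg) hC hc (by positivity)
  filter_upwards [h1, h2] with ω h1 h2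
  rw [Metric.tendsto_nhds]
  intro ε hε
  obtain ⟨k, hk⟩ := exists_nat_one_div_lt hε
  filter_upwards [h1 k, h2 k] with n h1 h2
  rw [Real.dist_eq, sub_zero, abs_lt]
  rw [Pi.neg_apply] at h2
  constructor <;> linarith

theorem sum_weight_eq_trace {n : ℕ} (M : Matrix (Fin n) (Fin n) ℂ) :
    ∑ j, (((n : ℝ)⁻¹ : ℝ) : ℂ) * M j j = (n : ℂ)⁻¹ * M.trace := by
  rw [← Finset.mul_sum]; simp [Matrix.trace]

theorem ae_tendsto_trace_imagResolvent {K ρ η : ℝ} (hK : 0 < K) (hη : 0 < η)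
    (hKη : 2 * K ^ 2 ≤ η ^ 2) {s : (n : ℕ) → Fin n → Fin n → ℝ}
    {X : (n : ℕ) → Ω → Matrix (Fin n) (Fin n) ℝ}
    (hX : ∀ n : ℕ, n ≠ 0 → IsBoundedWigner P (K / √n) (s n) (X n))
    (hρ : ∀ ε > 0, ∀ᶠ n in atTop, ∀ i, |∑ j, s n i j - ρ| ≤ ε) {S : ℂ}
    (hS : S * (η * Complex.I + ρ * S) = -1) (hSη : ‖S‖ ≤ 1 / η) :
    ∀ᵐ ω ∂P, Tendsto (fun n : ℕ => (n : ℂ)⁻¹ * (imagResolvent (X n ω) η).trace) atTop (𝓝 S) := by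
  set W : (n : ℕ) → Ω → ℂ := fun n ω =>
    ∑ j, (((n : ℝ)⁻¹ : ℝ) : ℂ) * imagResolvent (X n ω) η j j with hW
  have hmean : Tendsto (fun n => ∫ ω, W n ω ∂P) atTop (𝓝 S) := by
    rw [Metric.tendsto_nhds]
    intro ε hε
    -- The row-sum tolerance `η³ε/4` contributes exactly `ε/2` to the bound; the other terms tend to
    -- zero.
    have hlim : Tendsto (fun n : ℕ => 2 * (44 * n * (K / √n) ^ 3 / η ^ 3 + (K / √n) ^ 2 / η ^ 2
        + (η ^ 3 * ε / 4) / η ^ 2) / η) atTop (𝓝 (ε / 2)) := by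
      have h0 : Tendsto (fun n : ℕ => (√n)⁻¹) atTop (𝓝 0) :=
        (Real.tendsto_sqrt_atTop.comp tendsto_natCast_atTop_atTop).inv_tendsto_atTop
      have h1 : Tendsto (fun n : ℕ => 2 * (44 * K ^ 3 * (√n)⁻¹ / η ^ 3 + (K * (√n)⁻¹) ^ 2 / η ^ 2
        + (η ^ 3 * ε / 4) / η ^ 2) / η) atTop
          (𝓝 (2 * (44 * K ^ 3 * 0 / η ^ 3 + (K * 0) ^ 2 / η ^ 2 + (η ^ 3 * ε / 4) / η ^ 2) / η)) := by
        refine Tendsto.div_const (Tendsto.const_mul _ (Tendsto.add (Tendsto.add ?_ ?_)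
          tendsto_const_nhds)) _
        · exact (h0.const_mul _).div_const _
        · exact ((h0.const_mul _).pow 2).div_const _
      have e : 2 * (44 * K ^ 3 * 0 / η ^ 3 + (K * 0) ^ 2 / η ^ 2 + (η ^ 3 * ε / 4) / η ^ 2) / η
          = ε / 2 := by
        field_simp; ring
      rw [e] at h1
      refine h1.congr fun n => ?_
      rcases eq_or_ne n 0 with rfl | hn
      · simp
      · have hn' : (0 : ℝ) < n := by positivity
        have hsq : (√n : ℝ) ^ 2 = n := Real.sq_sqrt hn'.le
        have e1 : 44 * (n : ℝ) * (K / √n) ^ 3 = 44 * K ^ 3 * (√n)⁻¹ := by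
          have : (0 : ℝ) < √n := Real.sqrt_pos.2 hn'
          nth_rewrite 1 [← hsq]
          field_simp
        rw [e1, div_eq_mul_inv K]
    filter_upwards [hlim.eventually_lt_const (half_lt_self hε), hρ (η ^ 3 * ε / 4) (by positivity),
      eventually_ne_atTop 0] with n h1 h2 hn
    have : Nonempty (Fin n) := ⟨⟨0, Nat.pos_of_ne_zero hn⟩⟩
    have hn' : (0 : ℝ) < n := by positivity
    have hκ : 0 < K / √n := div_pos hK (Real.sqrt_pos.2 hn')
    have h3 := (hX n hn).norm_integral_trace_sub_le hκ hη h2 hS hSη (by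
      rw [Fintype.card_fin, div_pow, Real.sq_sqrt hn'.le, mul_div_cancel₀ _ hn'.ne']
      exact hKη)
    rw [Fintype.card_fin] at h3
    rw [dist_eq_norm]
    exact h3.trans_lt h1
  -- With at most `n²` independent entries, `κ = K/√n` and weights `1/n`, the sub-Gaussian parameter
  -- is at most `n² * (4K/(n√n η²))² = C/n`.
  set C : ℝ≥0 := Real.toNNReal ((4 * K / η ^ 2) ^ 2) with hCdef
  have hC : 0 < C := Real.toNNReal_pos.2 (by positivity)
  have key : ∀ L : ℂ →L[ℝ] ℝ, (∀ z, |L z| ≤ ‖z‖) →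
      ∀ᵐ ω ∂P, Tendsto (fun n => L (W n ω) - ∫ ω', L (W n ω') ∂P) atTop (𝓝 0) := by
    intro L hL
    refine ae_tendsto_zero_of_hasSubgaussianMGF (c := fun n : ℕ =>
      Fintype.card {p : Fin n × Fin n // p.1 ≤ p.2}
        * Real.toNNReal (4 * (K / √n) * (Real.toNNReal (n : ℝ)⁻¹) / η ^ 2) ^ 2) ?_ hC ?_
    · intro n hn
      refine (hX n hn).hasSubgaussianMGF (by positivity) hη (fun j => ?_) L hL
      rw [Real.coe_toNNReal _ (by positivity), abs_of_nonneg (by positivity)]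
    · intro n hn
      have hn' : (0 : ℝ) < n := by positivity
      have hs : (0 : ℝ) < √n := Real.sqrt_pos.2 hn'
      rw [← NNReal.coe_le_coe]
      refine (coe_card_mul_toNNReal_le (V := Fin n) (by positivity)).trans_eq ?_
      rw [Fintype.card_fin, Real.coe_toNNReal _ (by positivity), NNReal.coe_div, hCdef,
        Real.coe_toNNReal _ (by positivity), NNReal.coe_natCast]
      have hsq : (√n : ℝ) ^ 2 = n := Real.sq_sqrt hn'.le
      have e : 4 * (n : ℝ) * (K / √n) * (n : ℝ)⁻¹ / η ^ 2 = (4 * K / η ^ 2) / √n := by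
        field_simp
      rw [e, div_pow, hsq]
  filter_upwards [key Complex.reCLM Complex.abs_re_le_norm,
    key Complex.imCLM Complex.abs_im_le_norm] with ω hre him
  have hWi : ∀ᶠ n in atTop, Integrable (W n) P := by
    filter_upwards [eventually_ne_atTop 0] with n hn
    exact (hX n hn).integrable_weighted hη _
  have hdiff : Tendsto (fun n => W n ω - ∫ ω', W n ω' ∂P) atTop (𝓝 0) := by
    rw [tendsto_zero_iff_norm_tendsto_zero]
    refine squeeze_zero' (Eventually.of_forall fun _ => norm_nonneg _) ?_
      (by simpa using hre.abs.add him.abs)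
    filter_upwards [hWi] with n hn
    have h1 := Complex.reCLM.integral_comp_comm hn
    have h2 := Complex.imCLM.integral_comp_comm hn
    simp only [Complex.reCLM_apply, Complex.imCLM_apply] at h1 h2 ⊢
    rw [h1, h2, ← Complex.sub_re, ← Complex.sub_im]
    exact Complex.norm_le_abs_re_add_abs_im _
  have h := hdiff.add hmean
  simp only [sub_add_cancel, zero_add] at h
  refine h.congr fun n => ?_
  exact sum_weight_eq_trace _

end AlmostSure

/-! ### The semicircle law and its Stieltjes transform. -/

section Semicircle

/-- The generating function of the Chebyshev polynomials of the second kind, multiplied by `sin θ`: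
two geometric series in `w * exp(±iθ)`. -/
theorem hasSum_pow_mul_sin {w : ℂ} (hw : ‖w‖ < 1) (θ : ℝ) :
    HasSum (fun k : ℕ => w ^ k * Real.sin ((k + 1 : ℕ) * θ))
      (Real.sin θ / (1 - 2 * w * Real.cos θ + w ^ 2)) := by
  set u : ℂ := Complex.exp (θ * Complex.I) with hu
  set v : ℂ := Complex.exp (-θ * Complex.I) with hv
  have huv : u * v = 1 := by rw [hu, hv, ← Complex.exp_add]; simp
  have hsin : ∀ m : ℕ, (Real.sin (m * θ) : ℂ) = (v ^ m - u ^ m) * Complex.I / 2 := by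
    intro m
    rw [Complex.ofReal_sin, Complex.sin, hu, hv, ← Complex.exp_nat_mul, ← Complex.exp_nat_mul]
    push_cast
    ring_nf
  have hcos : 2 * (Real.cos θ : ℂ) = u + v := by
    rw [Complex.ofReal_cos, Complex.cos, hu, hv]; ring
  have hnu : ‖w * u‖ < 1 := by rw [norm_mul, hu, Complex.norm_exp_ofReal_mul_I, mul_one]; exact hw
  have hnv : ‖w * v‖ < 1 := by
    rw [norm_mul, hv, ← Complex.ofReal_neg, Complex.norm_exp_ofReal_mul_I, mul_one]; exact hw
  have hu0 : 1 - w * u ≠ 0 := fun h => by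
    rw [← sub_eq_zero.1 h, norm_one] at hnu; exact lt_irrefl _ hnu
  have hv0 : 1 - w * v ≠ 0 := fun h => by
    rw [← sub_eq_zero.1 h, norm_one] at hnv; exact lt_irrefl _ hnv
  have h := (((hasSum_geometric_of_norm_lt_one hnv).mul_left v).sub
    ((hasSum_geometric_of_norm_lt_one hnu).mul_left u)).mul_right (Complex.I / 2)
  have hden : 1 - 2 * w * Real.cos θ + w ^ 2 = (1 - w * u) * (1 - w * v) := by
    have : 1 - 2 * w * Real.cos θ + w ^ 2 = 1 - w * (2 * Real.cos θ) + w ^ 2 := by ring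
    rw [this, hcos]
    linear_combination -(w ^ 2) * huv
  have hval : (Real.sin θ : ℂ) / (1 - 2 * w * Real.cos θ + w ^ 2)
      = (v * (1 - w * v)⁻¹ - u * (1 - w * u)⁻¹) * (Complex.I / 2) := by
    have h1 := hsin 1
    simp only [Nat.cast_one, one_mul, pow_one] at h1
    have ha := inv_mul_cancel₀ hu0
    have hb := inv_mul_cancel₀ hv0
    rw [hden, h1, div_eq_iff (mul_ne_zero hu0 hv0)]
    linear_combination -(Complex.I / 2) * (v * (1 - w * u) * hb - u * (1 - w * v) * ha)
  rw [hval]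
  have e : (fun k : ℕ => w ^ k * Real.sin ((k + 1 : ℕ) * θ))
      = fun k => (v * (w * v) ^ k - u * (w * u) ^ k) * (Complex.I / 2) := by
    funext k
    rw [hsin]
    ring
  rw [e]
  exact h

theorem integral_cos_nat_mul {m : ℕ} (hm : m ≠ 0) : ∫ θ in (0 : ℝ)..Real.pi, Real.cos (m * θ) = 0 := by
  have hm' : (m : ℝ) ≠ 0 := Nat.cast_ne_zero.2 hm
  rw [intervalIntegral.integral_comp_mul_left (fun x => Real.cos x) hm', integral_cos]
  simp [Real.sin_nat_mul_pi]

theorem integral_sin_mul_sin_nat (k : ℕ) :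
    ∫ θ in (0 : ℝ)..Real.pi, Real.sin ((k + 1 : ℕ) * θ) * Real.sin θ
      = if k = 0 then Real.pi / 2 else 0 := by
  have e : ∀ θ : ℝ, Real.sin ((k + 1 : ℕ) * θ) * Real.sin θ
      = (Real.cos (k * θ) - Real.cos ((k + 2 : ℕ) * θ)) / 2 := by
    intro θ
    rw [Real.cos_sub_cos]
    push_cast
    have h1 : ((k : ℝ) * θ + (k + 2) * θ) / 2 = (k + 1) * θ := by ring
    have h2 : ((k : ℝ) * θ - (k + 2) * θ) / 2 = -θ := by ring
    rw [h1, h2, Real.sin_neg]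
    ring
  simp only [e]
  rw [intervalIntegral.integral_div, intervalIntegral.integral_sub
    (Continuous.intervalIntegrable (by fun_prop) _ _)
    (Continuous.intervalIntegrable (by fun_prop) _ _),
    integral_cos_nat_mul (m := k + 2) (Nat.succ_ne_zero _)]
  split_ifs with hk
  · subst hk; simp
  · rw [integral_cos_nat_mul hk]; simp

/-- Integrate the Chebyshev series term by term against `sin θ`; by orthogonality only `k = 0`
survives. The substitution `x = r cos θ` brings the Stieltjes integral to this form. -/
theorem integral_sin_sq_div {w : ℂ} (hw : ‖w‖ < 1) :
    ∫ θ in (0 : ℝ)..Real.pi, (Real.sin θ : ℂ) ^ 2 / (1 - 2 * w * Real.cos θ + w ^ 2)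
      = (Real.pi : ℂ) / 2 := by
  have h := intervalIntegral.hasSum_integral_of_dominated_convergence (μ := volume)
    (a := 0) (b := Real.pi)
    (F := fun (k : ℕ) (θ : ℝ) => w ^ k * Real.sin ((k + 1 : ℕ) * θ) * (Real.sin θ : ℂ))
    (f := fun θ => (Real.sin θ : ℂ) ^ 2 / (1 - 2 * w * Real.cos θ + w ^ 2))
    (fun k _ => ‖w‖ ^ k)
    (fun k => (Continuous.aestronglyMeasurable (by fun_prop)))
    (fun k => ae_of_all _ fun θ _ => by
      rw [norm_mul, norm_mul, norm_pow, Complex.norm_real, Complex.norm_real]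
      calc _ ≤ ‖w‖ ^ k * 1 * 1 := by
            gcongr
            · exact Real.abs_sin_le_one _
            · exact Real.abs_sin_le_one _
        _ = _ := by ring)
    (ae_of_all _ fun θ _ => summable_geometric_of_lt_one (norm_nonneg _) hw)
    (by simp)
    (ae_of_all _ fun θ _ => by
      have := (hasSum_pow_mul_sin hw θ).mul_right (Real.sin θ : ℂ)
      rw [div_mul_eq_mul_div, ← sq] at this
      exact this)
  have h2 : HasSum (fun k : ℕ => ∫ θ in (0 : ℝ)..Real.pi,
      w ^ k * Real.sin ((k + 1 : ℕ) * θ) * (Real.sin θ : ℂ)) (Real.pi / 2) := by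
    have e : ∀ k : ℕ, ∫ θ in (0 : ℝ)..Real.pi,
        w ^ k * Real.sin ((k + 1 : ℕ) * θ) * (Real.sin θ : ℂ)
        = if k = 0 then (Real.pi / 2 : ℂ) else 0 := by
      intro k
      have h3 : ∀ θ : ℝ, w ^ k * Real.sin ((k + 1 : ℕ) * θ) * (Real.sin θ : ℂ)
          = w ^ k * ((Real.sin ((k + 1 : ℕ) * θ) * Real.sin θ : ℝ) : ℂ) := fun θ => by
        push_cast; ring
      simp only [h3]
      rw [intervalIntegral.integral_const_mul, intervalIntegral.integral_ofReal,
        integral_sin_mul_sin_nat]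
      split_ifs with hk
      · subst hk; simp
      · simp
    simp only [e]
    exact hasSum_ite_eq 0 _
  exact h.unique h2

/-- `Real.sqrt` vanishes on negative numbers, so the cutoff is automatic and continuity becomes
evident. -/
theorem semicircleDensity_eq {r : ℝ} (hr : 0 < r) (x : ℝ) :
    semicircleDensity r x = 2 / (Real.pi * r ^ 2) * √(r ^ 2 - x ^ 2) := by
  rw [semicircleDensity]
  split_ifs with h
  · rfl
  · rw [Real.sqrt_eq_zero_of_nonpos, mul_zero]
    have : r ^ 2 < |x| ^ 2 := by
      rw [not_le] at h; gcongr
    rw [sq_abs] at this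
    linarith

theorem continuous_semicircleDensity {r : ℝ} (hr : 0 < r) : Continuous (semicircleDensity r) := by
  have : semicircleDensity r = fun x => 2 / (Real.pi * r ^ 2) * √(r ^ 2 - x ^ 2) :=
    funext (semicircleDensity_eq hr)
  rw [this]
  fun_prop

theorem semicircleDensity_nonneg {r : ℝ} (hr : 0 < r) (x : ℝ) : 0 ≤ semicircleDensity r x := by
  rw [semicircleDensity_eq hr]
  have := Real.pi_pos
  positivity

theorem integrable_semicircleDensity {r : ℝ} (hr : 0 < r) : Integrable (semicircleDensity r) := by
  refine (continuous_semicircleDensity hr).integrable_of_hasCompactSupport ?_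
  refine HasCompactSupport.intro (isCompact_Icc (a := -r) (b := r)) fun x hx => ?_
  rw [semicircleDensity, if_neg]
  rwa [abs_le]

theorem integral_semicircleDensity_smul {r : ℝ} (hr : 0 < r) (h : ℝ → ℂ) :
    ∫ x, semicircleDensity r x • h x
      = ∫ θ in (0 : ℝ)..Real.pi, (2 / Real.pi * Real.sin θ ^ 2) • h (r * Real.cos θ) := by
  have hpi := Real.pi_pos
  have h1 : ∫ x, semicircleDensity r x • h x
      = ∫ x in (fun θ => r * Real.cos θ) '' Set.Icc 0 Real.pi, semicircleDensity r x • h x := by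
    have himg : (fun θ => r * Real.cos θ) '' Set.Icc 0 Real.pi = Set.Icc (-r) r := by
      have : (fun θ => r * Real.cos θ) = (fun y => r * y) ∘ Real.cos := rfl
      rw [this, Set.image_comp, Real.bijOn_cos.image_eq, Set.image_mul_left_Icc hr.le (by norm_num)]
      simp
    rw [himg]
    refine (setIntegral_eq_integral_of_forall_compl_eq_zero fun x hx => ?_).symm
    rw [semicircleDensity, if_neg, zero_smul]
    rwa [abs_le]
  rw [h1, integral_image_eq_integral_abs_deriv_smul measurableSet_Icc
    (f' := fun θ => r * -Real.sin θ)
    (fun θ _ => ((Real.hasDerivAt_cos θ).const_mul r).hasDerivWithinAt)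
    (fun a ha b hb hab => Real.injOn_cos ha hb (mul_left_cancel₀ hr.ne' hab)),
    intervalIntegral.integral_of_le hpi.le, ← integral_Icc_eq_integral_Ioc]
  refine setIntegral_congr_fun measurableSet_Icc fun θ hθ => ?_
  have hs : 0 ≤ Real.sin θ := Real.sin_nonneg_of_mem_Icc hθ
  have hsq : r ^ 2 - (r * Real.cos θ) ^ 2 = (r * Real.sin θ) ^ 2 := by
    rw [mul_pow, mul_pow, Real.sin_sq]; ring
  rw [semicircleDensity_eq hr, hsq, Real.sqrt_sq (by positivity), smul_smul, abs_mul, abs_neg,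
    abs_of_pos hr, abs_of_nonneg hs]
  congr 1
  field_simp

theorem integral_semicircleDensity {r : ℝ} (hr : 0 < r) : ∫ x, semicircleDensity r x = 1 := by
  have h := integral_semicircleDensity_smul hr fun _ => 1
  have h2 : ∫ x, semicircleDensity r x • (1 : ℂ) = ((∫ x, semicircleDensity r x : ℝ) : ℂ) := by
    rw [← integral_complex_ofReal]
    simp
  have h3 : ∫ θ in (0 : ℝ)..Real.pi, (2 / Real.pi * Real.sin θ ^ 2) • (1 : ℂ) = 1 := by
    have : ∀ θ : ℝ, (2 / Real.pi * Real.sin θ ^ 2) • (1 : ℂ)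
        = ((2 / Real.pi * Real.sin θ ^ 2 : ℝ) : ℂ) := fun θ => by simp
    simp only [this]
    rw [intervalIntegral.integral_ofReal, intervalIntegral.integral_const_mul, integral_sin_sq]
    have := Real.pi_pos.ne'
    simp
  rw [h2, h3] at h
  exact_mod_cast h

/-- The semicircle law of radius `r`. -/
noncomputable def semicircleMeasure (r : ℝ) : Measure ℝ :=
  volume.withDensity fun x => ENNReal.ofReal (semicircleDensity r x)

theorem isProbabilityMeasure_semicircleMeasure {r : ℝ} (hr : 0 < r) :
    IsProbabilityMeasure (semicircleMeasure r) := by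
  refine ⟨?_⟩
  rw [semicircleMeasure, withDensity_apply _ MeasurableSet.univ, Measure.restrict_univ,
    ← ofReal_integral_eq_lintegral_ofReal (integrable_semicircleDensity hr)
      (ae_of_all _ (semicircleDensity_nonneg hr)), integral_semicircleDensity hr, ENNReal.ofReal_one]

theorem semicircleMeasure_Iic {r : ℝ} (hr : 0 < r) (x : ℝ) :
    (semicircleMeasure r).real (Set.Iic x) = semicircleCDF r x := by
  rw [Measure.real, semicircleMeasure, withDensity_apply _ measurableSet_Iic, semicircleCDF,
    ← ofReal_integral_eq_lintegral_ofReal (integrable_semicircleDensity hr).integrableOn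
      (ae_of_all _ (semicircleDensity_nonneg hr)), ENNReal.toReal_ofReal]
  exact integral_nonneg (semicircleDensity_nonneg hr)

theorem semicircleMeasure_singleton (r x : ℝ) : semicircleMeasure r {x} = 0 :=
  withDensity_absolutelyContinuous _ _ Real.volume_singleton

/-- The Stieltjes transform of the semicircle law on the imaginary axis solves the quadratic
self-consistent equation. -/
theorem exists_semicircle_stieltjes {r η : ℝ} (hr : 0 < r) (hη : 0 < η) :
    ∃ S : ℂ, ∫ x : ℝ, ((x : ℂ) - η * Complex.I)⁻¹ ∂(semicircleMeasure r) = S ∧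
      S * (η * Complex.I + ((r ^ 2 / 4 : ℝ) : ℂ) * S) = -1 ∧ ‖S‖ ≤ 1 / η := by
  set D := √(η ^ 2 + r ^ 2) with hD
  have hD2 : D ^ 2 = η ^ 2 + r ^ 2 := Real.sq_sqrt (by positivity)
  have hD0 : 0 ≤ D := Real.sqrt_nonneg _
  -- The root in `(0, 1)` of `q² + (2η/r)q = 1`. With `w = -iq` it factors `r cos θ - iη` as
  -- `-(r/(2w)) * (1 - 2w cos θ + w²)`.
  set q : ℝ := (D - η) / r with hq
  have hDη : η < D := by nlinarith
  have hq0 : 0 < q := div_pos (by linarith) hr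
  have hqeq : q ^ 2 + 2 * η / r * q = 1 := by
    rw [hq]; field_simp; nlinarith
  have hq1 : q < 1 := by
    have : 0 < 2 * η / r * q := by positivity
    nlinarith
  set w : ℂ := -(q * Complex.I) with hw
  have hwn : ‖w‖ < 1 := by
    rw [hw, norm_neg, norm_mul, Complex.norm_I, mul_one, Complex.norm_real, Real.norm_of_nonneg hq0.le]
    exact hq1
  have hw0 : w ≠ 0 := by
    rw [hw, neg_ne_zero]
    exact mul_ne_zero (Complex.ofReal_ne_zero.2 hq0.ne') Complex.I_ne_zero
  have hrc : (r : ℂ) ≠ 0 := Complex.ofReal_ne_zero.2 hr.ne'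
  have hqc : (q : ℂ) ^ 2 * r + 2 * η * q = r := by
    have : q ^ 2 * r + 2 * η * q = r := by
      field_simp at hqeq; linarith
    exact_mod_cast this
  refine ⟨2 * q / r * Complex.I, ?_, ?_, ?_⟩
  · rw [semicircleMeasure, integral_withDensity_eq_integral_toReal_smul
      (continuous_semicircleDensity hr).measurable.ennreal_ofReal (ae_of_all _ fun _ => by simp)]
    simp only [ENNReal.toReal_ofReal (semicircleDensity_nonneg hr _)]
    rw [integral_semicircleDensity_smul hr]
    have e : ∀ θ : ℝ, (2 / Real.pi * Real.sin θ ^ 2) • (((r * Real.cos θ : ℝ) : ℂ) - η * Complex.I)⁻¹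
        = (4 * q / (Real.pi * r) * Complex.I)
          * ((Real.sin θ : ℂ) ^ 2 / (1 - 2 * w * Real.cos θ + w ^ 2)) := by
      intro θ
      have hden : ((r * Real.cos θ : ℝ) : ℂ) - η * Complex.I
          = (-(r / (2 * w))) * (1 - 2 * w * Real.cos θ + w ^ 2) := by
        have hh : (1 + w ^ 2) * r = 2 * w * (η * Complex.I) := by
          rw [hw]
          linear_combination (q ^ 2 * r + 2 * q * η) * Complex.I_sq - hqc
        push_cast
        field_simp
        linear_combination hh
      rw [hden, mul_inv, Complex.real_smul]
      have hpi : (Real.pi : ℂ) ≠ 0 := Complex.ofReal_ne_zero.2 Real.pi_ne_zero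
      rw [hw]
      push_cast
      rw [div_eq_mul_inv ((Complex.sin (θ : ℂ)) ^ 2)]
      rw [← mul_assoc, ← mul_assoc]
      congr 1
      rw [inv_neg, inv_div]
      field_simp
      ring
    simp only [e]
    rw [intervalIntegral.integral_const_mul, integral_sin_sq_div hwn]
    have hpi : (Real.pi : ℂ) ≠ 0 := Complex.ofReal_ne_zero.2 Real.pi_ne_zero
    field_simp
    ring
  · push_cast
    field_simp
    linear_combination 4 * ((2 * q * η + q ^ 2 * r) * Complex.I_sq - hqc)
  · rw [norm_mul, Complex.norm_I, mul_one, norm_div, norm_mul, Complex.norm_real, Complex.norm_real,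
      Real.norm_of_nonneg hq0.le, Real.norm_of_nonneg hr.le, le_div_iff₀ hη]
    have : 2 * η / r * q ≤ 1 := by nlinarith
    calc ‖(2 : ℂ)‖ * q / r * η = 2 * η / r * q := by simp; ring
      _ ≤ 1 := this

end Semicircle

/-! ### From Stieltjes transforms on part of the imaginary axis to distribution functions. -/

section Stieltjes

theorem ofReal_sub_mul_I_ne_zero {q : ℝ} (hq : q ≠ 0) (x : ℝ) : (x : ℂ) - q * Complex.I ≠ 0 := by
  intro h
  have := congrArg Complex.im h
  simp at this
  exact hq this

theorem norm_stieltjesKernel_le {q : ℝ} (hq : q ≠ 0) (x : ℝ) :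
    ‖((x : ℂ) - q * Complex.I)⁻¹‖ ≤ |q|⁻¹ := by
  rw [norm_inv]
  refine inv_anti₀ (abs_pos.2 hq) ?_
  have := Complex.abs_im_le_norm ((x : ℂ) - q * Complex.I)
  simpa using this

/-- The bounded continuous function `x ↦ (x - iq)⁻¹`. -/
noncomputable def stieltjesKernel (q : ℝ) (hq : q ≠ 0) : ℝ →ᵇ ℂ :=
  BoundedContinuousFunction.ofNormedAddCommGroup (fun x : ℝ => ((x : ℂ) - q * Complex.I)⁻¹)
    (Continuous.inv₀ (by fun_prop) (ofReal_sub_mul_I_ne_zero hq)) |q|⁻¹ (norm_stieltjesKernel_le hq)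

theorem stieltjesKernel_apply (q : ℝ) (hq : q ≠ 0) (x : ℝ) :
    stieltjesKernel q hq x = ((x : ℂ) - q * Complex.I)⁻¹ := rfl

/-- The constant function `1` and the kernels `x ↦ (x - iq)⁻¹` with `q` rational and `a ≤ |q|`. -/
def stieltjesKernels (a : ℝ) : Set (ℝ →ᵇ ℂ) :=
  {f | f = 1 ∨ ∃ (q : ℚ) (hq : (q : ℝ) ≠ 0), a ≤ |(q : ℝ)| ∧ f = stieltjesKernel q hq}

/-- Partial fractions; this is why a linear span of kernels is almost an algebra. -/
theorem stieltjesKernel_mul_of_ne {p q : ℝ} (hp : p ≠ 0) (hq : q ≠ 0) (hpq : p ≠ q) :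
    stieltjesKernel p hp * stieltjesKernel q hq
      = ((p - q : ℂ) * Complex.I)⁻¹ • (stieltjesKernel p hp - stieltjesKernel q hq) := by
  ext x
  have h1 := ofReal_sub_mul_I_ne_zero hp x
  have h2 := ofReal_sub_mul_I_ne_zero hq x
  have h3 : (p - q : ℂ) ≠ 0 := by
    rw [sub_ne_zero]; exact_mod_cast hpq
  simp only [BoundedContinuousFunction.coe_mul, Pi.mul_apply, BoundedContinuousFunction.coe_smul,
    BoundedContinuousFunction.coe_sub, Pi.sub_apply, stieltjesKernel_apply, smul_eq_mul]
  rw [inv_sub_inv h1 h2]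
  have e : (x : ℂ) - q * Complex.I - (x - p * Complex.I) = (p - q : ℂ) * Complex.I := by ring
  rw [e, ← mul_div_assoc, inv_mul_cancel₀ (mul_ne_zero h3 Complex.I_ne_zero), one_div, mul_inv]

theorem norm_stieltjesKernel_sub_le {p q : ℝ} (hp : p ≠ 0) (hq : q ≠ 0) :
    ‖stieltjesKernel p hp - stieltjesKernel q hq‖ ≤ |p - q| * (|p|⁻¹ * |q|⁻¹) := by
  refine (BoundedContinuousFunction.norm_le (by positivity)).2 fun x => ?_
  have h1 := ofReal_sub_mul_I_ne_zero hp x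
  have h2 := ofReal_sub_mul_I_ne_zero hq x
  simp only [BoundedContinuousFunction.coe_sub, Pi.sub_apply, stieltjesKernel_apply]
  have e : ((x : ℂ) - p * Complex.I)⁻¹ - ((x : ℂ) - q * Complex.I)⁻¹
      = ((p - q : ℝ) : ℂ) * Complex.I * (((x : ℂ) - p * Complex.I)⁻¹ * ((x : ℂ) - q * Complex.I)⁻¹) := by
    rw [inv_sub_inv h1 h2, ← mul_inv, div_eq_mul_inv]
    push_cast
    ring
  rw [e, norm_mul, norm_mul, norm_mul, Complex.norm_I, mul_one, Complex.norm_real, Real.norm_eq_abs]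
  gcongr
  · exact norm_stieltjesKernel_le hp x
  · exact norm_stieltjesKernel_le hq x

/-- The closed linear span of the Stieltjes kernels. -/
noncomputable def stieltjesSpan (a : ℝ) : Submodule ℂ (ℝ →ᵇ ℂ) :=
  (Submodule.span ℂ (stieltjesKernels a)).topologicalClosure

theorem stieltjesKernels_subset_span (a : ℝ) :
    stieltjesKernels a ⊆ (stieltjesSpan a : Set (ℝ →ᵇ ℂ)) :=
  Submodule.subset_span.trans (Submodule.le_topologicalClosure _)

theorem isClosed_stieltjesSpan (a : ℝ) : IsClosed (stieltjesSpan a : Set (ℝ →ᵇ ℂ)) :=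
  Submodule.isClosed_topologicalClosure _

theorem stieltjesSpan_le {a : ℝ} {T : Submodule ℂ (ℝ →ᵇ ℂ)} (hT : IsClosed (T : Set (ℝ →ᵇ ℂ)))
    (h : stieltjesKernels a ⊆ T) : stieltjesSpan a ≤ T :=
  Submodule.topologicalClosure_minimal _ (Submodule.span_le.2 h) hT

/-- Distinct poles are handled by partial fractions. The square of a kernel is only a uniform limit
of products with distinct poles, so the closure of the span is needed. -/
theorem mul_mem_stieltjesSpan_of_kernels {a : ℝ} {f g : ℝ →ᵇ ℂ}
    (hf : f ∈ stieltjesKernels a) (hg : g ∈ stieltjesKernels a) : f * g ∈ stieltjesSpan a := by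
  rcases hf with rfl | ⟨p, hp, hap, rfl⟩
  · rw [one_mul]; exact stieltjesKernels_subset_span a hg
  rcases hg with rfl | ⟨q, hq, haq, rfl⟩
  · rw [mul_one]; exact stieltjesKernels_subset_span a (Or.inr ⟨p, hp, hap, rfl⟩)
  have hne : ∀ (q' : ℚ) (hq' : (q' : ℝ) ≠ 0), a ≤ |(q' : ℝ)| → (p : ℝ) ≠ q' →
      stieltjesKernel p hp * stieltjesKernel q' hq' ∈ stieltjesSpan a := by
    intro q' hq' haq' hpq
    rw [stieltjesKernel_mul_of_ne hp hq' hpq]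
    exact Submodule.smul_mem _ _ (Submodule.sub_mem _
      (stieltjesKernels_subset_span a (Or.inr ⟨p, hp, hap, rfl⟩))
      (stieltjesKernels_subset_span a (Or.inr ⟨q', hq', haq', rfl⟩)))
  by_cases hpq : (p : ℝ) = q
  swap
  · exact hne q hq haq hpq
  obtain rfl : p = q := by exact_mod_cast hpq
  -- Moving the pole away from the origin keeps it rational and in the region `a ≤ |q|`, whatever
  -- its sign.
  set u : ℕ → ℚ := fun k => p * (1 + 1 / ((k : ℚ) + 1)) with hu
  have hfac : ∀ k : ℕ, (1 : ℝ) < 1 + 1 / ((k : ℝ) + 1) := fun k => by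
    have : (0 : ℝ) < 1 / ((k : ℝ) + 1) := by positivity
    linarith
  have huR : ∀ k, (u k : ℝ) = p * (1 + 1 / ((k : ℝ) + 1)) := fun k => by simp [hu]
  have hu0 : ∀ k, (u k : ℝ) ≠ 0 := fun k => by
    rw [huR]; exact mul_ne_zero hp (by linarith [hfac k])
  have hua : ∀ k, |(p : ℝ)| ≤ |(u k : ℝ)| := fun k => by
    rw [huR, abs_mul, abs_of_pos (zero_lt_one.trans (hfac k))]
    exact le_mul_of_one_le_right (abs_nonneg _) (hfac k).le
  have hup : ∀ k, (p : ℝ) ≠ u k := fun k => by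
    rw [huR]
    intro h
    have : (p : ℝ) * 1 = p * (1 + 1 / ((k : ℝ) + 1)) := by rw [mul_one]; exact h
    exact (hfac k).ne (mul_left_cancel₀ hp this)
  have hlim : Tendsto (fun k => stieltjesKernel (u k) (hu0 k)) atTop (𝓝 (stieltjesKernel p hp)) := by
    rw [tendsto_iff_norm_sub_tendsto_zero]
    have h0 : Tendsto (fun k : ℕ => |(p : ℝ)| * (1 / ((k : ℝ) + 1)) * (|(p : ℝ)|⁻¹ * |(p : ℝ)|⁻¹))
        atTop (𝓝 0) := by
      simpa using (tendsto_one_div_add_atTop_nhds_zero_nat.const_mul |(p : ℝ)|).mul_const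
        (|(p : ℝ)|⁻¹ * |(p : ℝ)|⁻¹)
    refine squeeze_zero (fun _ => norm_nonneg _) (fun k => ?_) h0
    refine (norm_stieltjesKernel_sub_le _ _).trans ?_
    have e : (u k : ℝ) - p = p * (1 / ((k : ℝ) + 1)) := by rw [huR]; ring
    rw [e, abs_mul, abs_of_pos (show (0 : ℝ) < 1 / ((k : ℝ) + 1) by positivity)]
    exact mul_le_mul_of_nonneg_left (mul_le_mul_of_nonneg_right
      (inv_anti₀ (abs_pos.2 hp) (hua k)) (by positivity)) (by positivity)
  exact (isClosed_stieltjesSpan a).mem_of_tendsto (hlim.const_mul (stieltjesKernel p hp))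
    (Eventually.of_forall fun k => hne _ (hu0 k) (hap.trans (hua k)) (hup k))

theorem mul_mem_stieltjesSpan {a : ℝ} {f g : ℝ →ᵇ ℂ} (hf : f ∈ stieltjesSpan a)
    (hg : g ∈ stieltjesSpan a) : f * g ∈ stieltjesSpan a := by
  have h1 : ∀ f' ∈ stieltjesKernels a, ∀ g' ∈ stieltjesSpan a, f' * g' ∈ stieltjesSpan a := by
    intro f' hf' g' hg'
    exact stieltjesSpan_le (T := (stieltjesSpan a).comap (LinearMap.mulLeft ℂ f'))
      ((isClosed_stieltjesSpan a).preimage (continuous_const.mul continuous_id))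
      (fun k hk => mul_mem_stieltjesSpan_of_kernels hf' hk) hg'
  exact stieltjesSpan_le (T := (stieltjesSpan a).comap (LinearMap.mulRight ℂ g))
      ((isClosed_stieltjesSpan a).preimage (continuous_id.mul continuous_const))
      (fun k hk => h1 k hk g hg) hf

theorem star_mem_stieltjesSpan {a : ℝ} {f : ℝ →ᵇ ℂ} (hf : f ∈ stieltjesSpan a) :
    star f ∈ stieltjesSpan a := by
  refine map_mem_closure (s := (Submodule.span ℂ (stieltjesKernels a) : Set (ℝ →ᵇ ℂ)))
    (t := (Submodule.span ℂ (stieltjesKernels a) : Set (ℝ →ᵇ ℂ))) continuous_star hf ?_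
  intro g hg
  induction hg using Submodule.span_induction with
  | mem g hg =>
    refine Submodule.subset_span ?_
    rcases hg with rfl | ⟨q, hq, haq, rfl⟩
    · left; exact star_one _
    · right
      have hq' : ((-q : ℚ) : ℝ) ≠ 0 := by push_cast; exact neg_ne_zero.2 hq
      refine ⟨-q, hq', by push_cast; rwa [abs_neg], ?_⟩
      ext x
      simp only [BoundedContinuousFunction.star_apply, stieltjesKernel_apply]
      simp
  | zero => rw [star_zero]; exact Submodule.zero_mem _
  | add g g' _ _ h h' => rw [star_add]; exact Submodule.add_mem _ h h'
  | smul c g _ h => rw [star_smul]; exact Submodule.smul_mem _ _ h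

/-- The closed linear span of the Stieltjes kernels is a star subalgebra. -/
noncomputable def stieltjesAlgebra (a : ℝ) : StarSubalgebra ℂ (ℝ →ᵇ ℂ) where
  carrier := stieltjesSpan a
  mul_mem' := mul_mem_stieltjesSpan
  add_mem' := Submodule.add_mem _
  algebraMap_mem' c := by
    rw [Algebra.algebraMap_eq_smul_one]
    exact Submodule.smul_mem _ _ (stieltjesKernels_subset_span a (Or.inl rfl))
  star_mem' := star_mem_stieltjesSpan

theorem separatesPoints_stieltjesAlgebra {a : ℝ} (ha : 0 < a) :
    ((stieltjesAlgebra a).map (BoundedContinuousFunction.toContinuousMapStarₐ ℂ)).SeparatesPoints := by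
  intro x y hxy
  obtain ⟨q, hq⟩ := exists_rat_gt a
  have hq0 : (q : ℝ) ≠ 0 := (ha.trans hq).ne'
  refine ⟨stieltjesKernel q hq0, ⟨_, ⟨stieltjesKernel q hq0, ?_, rfl⟩, rfl⟩, ?_⟩
  · exact stieltjesKernels_subset_span a (Or.inr ⟨q, hq0, hq.le.trans (le_abs_self _), rfl⟩)
  · rw [stieltjesKernel_apply, stieltjesKernel_apply]
    intro h
    have := inv_injective h
    have h2 := congrArg Complex.re this
    simp at h2
    exact hxy h2

theorem tendsto_integral_of_mem_stieltjesSpan {ι : Type*} {l : Filter ι} {μ : ι → Measure ℝ}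
    [∀ i, IsProbabilityMeasure (μ i)] {ν : Measure ℝ} [IsProbabilityMeasure ν] {a : ℝ}
    (h : ∀ q : ℚ, (ha : (q : ℝ) ≠ 0) → a ≤ |(q : ℝ)| → Tendsto
      (fun i => ∫ x, stieltjesKernel q ha x ∂(μ i)) l (𝓝 (∫ x, stieltjesKernel q ha x ∂ν)))
    {f : ℝ →ᵇ ℂ} (hf : f ∈ stieltjesSpan a) :
    Tendsto (fun i => ∫ x, f x ∂(μ i)) l (𝓝 (∫ x, f x ∂ν)) := by
  have hspan : ∀ g ∈ Submodule.span ℂ (stieltjesKernels a),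
      Tendsto (fun i => ∫ x, g x ∂(μ i)) l (𝓝 (∫ x, g x ∂ν)) := by
    intro g hg
    induction hg using Submodule.span_induction with
    | mem g hg =>
      rcases hg with rfl | ⟨q, hq, haq, rfl⟩
      · simpa using tendsto_const_nhds
      · exact h q hq haq
    | zero => simpa using tendsto_const_nhds
    | add g g' _ _ h h' =>
      have e : ∀ (m : Measure ℝ) [IsProbabilityMeasure m],
          ∫ x, (g + g') x ∂m = ∫ x, g x ∂m + ∫ x, g' x ∂m := fun m _ =>
        integral_add (g.integrable m) (g'.integrable m)
      simp only [e]
      exact h.add h'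
    | smul c g _ h =>
      have e : ∀ (m : Measure ℝ) [IsProbabilityMeasure m],
          ∫ x, (c • g) x ∂m = c * ∫ x, g x ∂m := fun m _ => integral_const_mul c _
      simp only [e]
      exact h.const_mul c
  rw [Metric.tendsto_nhds]
  intro ε hε
  obtain ⟨g, hg, hfg⟩ := Metric.mem_closure_iff.1 hf (ε / 3) (by positivity)
  have hclose : ∀ (m : Measure ℝ) [IsProbabilityMeasure m],
      ‖∫ x, f x ∂m - ∫ x, g x ∂m‖ ≤ ε / 3 := by
    intro m _
    rw [← integral_sub (f.integrable m) (g.integrable m)]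
    refine integral_norm_le_of_forall fun x => ?_
    rw [dist_eq_norm] at hfg
    exact ((f - g).norm_coe_le_norm x).trans hfg.le
  filter_upwards [Metric.tendsto_nhds.1 (hspan g hg) (ε / 3) (by positivity)] with i hi
  rw [dist_eq_norm] at hi ⊢
  have h1 := hclose (μ i)
  have h2 := hclose ν
  have e : ∫ x, f x ∂(μ i) - ∫ x, f x ∂ν = (∫ x, f x ∂(μ i) - ∫ x, g x ∂(μ i))
      + (∫ x, g x ∂(μ i) - ∫ x, g x ∂ν) - (∫ x, f x ∂ν - ∫ x, g x ∂ν) := by ring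
  rw [e]
  calc _ ≤ ‖∫ x, f x ∂(μ i) - ∫ x, g x ∂(μ i)‖ + ‖∫ x, g x ∂(μ i) - ∫ x, g x ∂ν‖
        + ‖∫ x, f x ∂ν - ∫ x, g x ∂ν‖ := (norm_sub_le _ _).trans (by gcongr; exact norm_add_le _ _)
    _ < ε := by linarith

theorem isTightMeasureSet_of_second_moment_le {ι : Type*} {μ : ι → Measure ℝ}
    [∀ i, IsProbabilityMeasure (μ i)] {C : ℝ} (hint : ∀ i, Integrable (fun x => x ^ 2) (μ i))
    (hC : ∀ i, ∫ x, x ^ 2 ∂(μ i) ≤ C) : IsTightMeasureSet {m | ∃ i, μ i = m} := by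
  rw [isTightMeasureSet_iff_exists_isCompact_measure_compl_le]
  intro ε hε
  have hlim : Tendsto (fun R : ℝ => ENNReal.ofReal (C / R ^ 2)) atTop (𝓝 0) := by
    rw [← ENNReal.ofReal_zero]
    exact ENNReal.tendsto_ofReal ((tendsto_pow_atTop two_ne_zero).const_div_atTop C)
  obtain ⟨R, hR, hR0⟩ := ((hlim.eventually_le_const hε).and (eventually_gt_atTop 0)).exists
  refine ⟨Metric.closedBall 0 R, isCompact_closedBall _ _, ?_⟩
  rintro _ ⟨i, rfl⟩
  refine le_trans ?_ hR
  have h := mul_meas_ge_le_integral_of_nonneg (ae_of_all _ fun x => sq_nonneg x) (hint i) (R ^ 2)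
  have hsub : (Metric.closedBall (0 : ℝ) R)ᶜ ⊆ {x | R ^ 2 ≤ x ^ 2} := by
    intro x hx
    rw [Set.mem_compl_iff, Metric.mem_closedBall, dist_zero_right, Real.norm_eq_abs, not_le] at hx
    rw [Set.mem_ofPred_eq, ← sq_abs x]
    gcongr
  rw [← ENNReal.ofReal_toReal (measure_ne_top (μ i) _)]
  refine ENNReal.ofReal_le_ofReal ?_
  rw [le_div_iff₀' (by positivity)]
  calc R ^ 2 * (μ i).real (Metric.closedBall 0 R)ᶜ ≤ R ^ 2 * (μ i).real {x | R ^ 2 ≤ x ^ 2} :=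
        mul_le_mul_of_nonneg_left (measureReal_mono hsub (measure_ne_top (μ i) _)) (by positivity)
    _ ≤ C := h.trans (hC i)

/-- Convergence of Stieltjes transforms high up the imaginary axis, together with bounded second
moments, implies convergence of distribution functions to that of an atomless law. -/
theorem tendsto_measureReal_Iic_of_stieltjes {μ : ℕ → Measure ℝ} [∀ i, IsProbabilityMeasure (μ i)]
    {ν : Measure ℝ} [IsProbabilityMeasure ν] (hν : ∀ x, ν {x} = 0) {C a : ℝ} (ha : 0 < a)
    (hint : ∀ i, Integrable (fun x => x ^ 2) (μ i)) (hC : ∀ i, ∫ x, x ^ 2 ∂(μ i) ≤ C)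
    (h : ∀ q : ℚ, a ≤ q → Tendsto (fun i => ∫ x : ℝ, ((x : ℂ) - (q : ℝ) * Complex.I)⁻¹ ∂(μ i)) atTop
      (𝓝 (∫ x : ℝ, ((x : ℂ) - (q : ℝ) * Complex.I)⁻¹ ∂ν))) (x : ℝ) :
    Tendsto (fun i => (μ i).real (Set.Iic x)) atTop (𝓝 (ν.real (Set.Iic x))) := by
  have hker : ∀ q : ℚ, (ha : (q : ℝ) ≠ 0) → a ≤ |(q : ℝ)| → Tendsto
      (fun i => ∫ x, stieltjesKernel q ha x ∂(μ i)) atTop (𝓝 (∫ x, stieltjesKernel q ha x ∂ν)) := by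
    intro q hq haq
    simp only [stieltjesKernel_apply]
    -- Negative poles, needed for closure under conjugation, follow from positive ones by
    -- conjugating the integral.
    rcases le_total 0 (q : ℝ) with h0 | h0
    · rw [abs_of_nonneg h0] at haq
      exact h q haq
    · rw [abs_of_nonpos h0] at haq
      have h1 := h (-q) (by exact_mod_cast haq)
      have e : ∀ m : Measure ℝ, ∫ x : ℝ, ((x : ℂ) - (q : ℝ) * Complex.I)⁻¹ ∂m
          = (starRingEnd ℂ) (∫ x : ℝ, ((x : ℂ) - ((-q : ℚ) : ℝ) * Complex.I)⁻¹ ∂m) := by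
        intro m
        rw [← integral_conj]
        congr 1
        funext x
        simp [sub_eq_add_neg]
      simp only [e]
      exact (Complex.continuous_conj.tendsto _).comp h1
  set μ' : ℕ → ProbabilityMeasure ℝ := fun i => ⟨μ i, inferInstance⟩ with hμ'
  set ν' : ProbabilityMeasure ℝ := ⟨ν, inferInstance⟩ with hν'
  have hconv : Tendsto μ' atTop (𝓝 ν') := by
    refine ProbabilityMeasure.tendsto_of_tight_of_separatesPoints ℂ
      (isTightMeasureSet_of_second_moment_le hint hC) (separatesPoints_stieltjesAlgebra ha) ?_
    intro g hg
    exact tendsto_integral_of_mem_stieltjesSpan hker hg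
  have h1 := ProbabilityMeasure.tendsto_measure_of_null_frontier_of_tendsto' hconv
    (E := Set.Iic x) (by rw [frontier_Iic]; exact hν x)
  exact (ENNReal.tendsto_toReal (measure_ne_top ν _)).comp h1

end Stieltjes

/-! ### The empirical spectral measure. -/

section EmpiricalSpectrum

/-- The uniform distribution on a finite family of reals. -/
noncomputable def empiricalMeasure {n : ℕ} (lam : Fin n → ℝ) : Measure ℝ :=
  (n : ENNReal)⁻¹ • ∑ i, Measure.dirac (lam i)

theorem isProbabilityMeasure_empiricalMeasure {n : ℕ} (hn : n ≠ 0) (lam : Fin n → ℝ) :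
    IsProbabilityMeasure (empiricalMeasure lam) := by
  refine ⟨?_⟩
  simp [empiricalMeasure, Measure.finsetSum_apply]
  exact ENNReal.inv_mul_cancel (by exact_mod_cast hn) (ENNReal.natCast_ne_top n)

theorem integral_empiricalMeasure {E : Type*} [NormedAddCommGroup E] [NormedSpace ℝ E]
    [CompleteSpace E] {n : ℕ} (lam : Fin n → ℝ) (g : ℝ → E) :
    ∫ x, g x ∂(empiricalMeasure lam) = (n : ℝ)⁻¹ • ∑ i, g (lam i) := by
  rw [empiricalMeasure, integral_smul_measure, integral_finsetSum_measure]
  · simp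
  · intro i _
    exact integrable_dirac (by simp)

theorem integrable_empiricalMeasure {n : ℕ} (hn : n ≠ 0) (lam : Fin n → ℝ) (g : ℝ → ℝ) :
    Integrable g (empiricalMeasure lam) := by
  refine Integrable.smul_measure ?_ (ENNReal.inv_ne_top.2 (by exact_mod_cast hn))
  exact integrable_finsetSum_measure.2 fun i _ => integrable_dirac (by simp)

theorem isHermitian_of_isSymm {n : ℕ} {B : Matrix (Fin n) (Fin n) ℝ} (hB : B.IsSymm) :
    B.IsHermitian := by
  ext i j; simp [Matrix.conjTranspose_apply, hB.apply]

theorem empiricalMeasure_Iic_eq_esd {n : ℕ} {B : Matrix (Fin n) (Fin n) ℝ}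
    (hB : B.IsHermitian) (x : ℝ) :
    (empiricalMeasure hB.eigenvalues).real (Set.Iic x) = esd B x := by
  rw [esd, hB.roots_charpoly_eq_eigenvalues, Multiset.filter_map, Multiset.card_map, Measure.real,
    empiricalMeasure, Measure.smul_apply, Measure.finsetSum_apply, smul_eq_mul, ENNReal.toReal_mul,
    ENNReal.toReal_inv, ENNReal.toReal_natCast, div_eq_inv_mul]
  congr 1
  have h : ∀ i, Measure.dirac (hB.eigenvalues i) (Set.Iic x)
      = if hB.eigenvalues i ≤ x then (1 : ENNReal) else 0 := fun i => by
    rw [Measure.dirac_apply' _ measurableSet_Iic, Set.indicator_apply]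
    rfl
  simp only [h]
  rw [Finset.sum_boole, ENNReal.toReal_natCast]
  rfl

theorem sum_eigenvalues_sq {n : ℕ} {B : Matrix (Fin n) (Fin n) ℝ} (hB : B.IsHermitian) :
    ∑ i, hB.eigenvalues i ^ 2 = ∑ i, ∑ j, B i j ^ 2 := by
  have h1 : (B * B).trace = ∑ i, ∑ j, B i j ^ 2 := by
    simp only [Matrix.trace, Matrix.diag_apply, Matrix.mul_apply]
    refine Finset.sum_congr rfl fun i _ => Finset.sum_congr rfl fun j _ => ?_
    have : B j i = B i j := by simpa using hB.apply i j
    rw [this, sq]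
  rw [← h1]
  set U : Matrix (Fin n) (Fin n) ℝ := hB.eigenvectorUnitary.1 with hU
  have hUU' : star U * U = 1 := Unitary.coe_star_mul_self _
  have hspec : B = U * Matrix.diagonal (fun i => hB.eigenvalues i) * star U := hB.spectral_theorem
  clear_value U
  generalize hB.eigenvalues = lam at hspec ⊢
  have e : B * B = U * (Matrix.diagonal lam * (star U * U) * Matrix.diagonal lam) * star U := by
    rw [hspec]
    simp only [mul_assoc]
  rw [e, Matrix.trace_mul_comm, ← mul_assoc, hUU', one_mul, mul_one, Matrix.diagonal_mul_diagonal,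
    Matrix.trace_diagonal]
  exact Finset.sum_congr rfl fun i _ => sq _

theorem trace_imagResolvent_eq_sum_eigenvalues {n : ℕ} {B : Matrix (Fin n) (Fin n) ℝ}
    (hB : B.IsSymm) {η : ℝ} (hη : η ≠ 0) :
    (imagResolvent B η).trace
      = ∑ i, (((isHermitian_of_isSymm hB).eigenvalues i : ℂ) - η * Complex.I)⁻¹ := by
  rw [trace_imagResolvent_eq hB hη, (isHermitian_of_isSymm hB).roots_charpoly_eq_eigenvalues,
    Multiset.map_map]
  rfl

/-- The hypothesis `hC` bounds the second moments of the spectral measures, since the squared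
eigenvalues sum to the squared entries; tightness follows. -/
theorem tendsto_esd_of_stieltjes {B : (n : ℕ) → Matrix (Fin n) (Fin n) ℝ}
    (hB : ∀ n, (B n).IsSymm) {C a r : ℝ} (hr : 0 < r) (ha : 0 < a)
    (hC : ∀ n, ∑ i, ∑ j, B n i j ^ 2 ≤ n * C)
    (h : ∀ q : ℚ, a ≤ q → Tendsto (fun n : ℕ => (n : ℂ)⁻¹ * (imagResolvent (B n) q).trace) atTop
      (𝓝 (∫ x : ℝ, ((x : ℂ) - (q : ℝ) * Complex.I)⁻¹ ∂(semicircleMeasure r)))) (x : ℝ) :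
    Tendsto (fun n => esd (B n) x) atTop (𝓝 (semicircleCDF r x)) := by
  set lam : (n : ℕ) → Fin n → ℝ := fun n => (isHermitian_of_isSymm (hB n)).eigenvalues with hlam
  -- Sizes are shifted by one because the empirical measure of a matrix of size `0` is not a
  -- probability measure.
  have hp : ∀ n, IsProbabilityMeasure (empiricalMeasure (lam (n + 1))) := fun n =>
    isProbabilityMeasure_empiricalMeasure n.succ_ne_zero _
  have := isProbabilityMeasure_semicircleMeasure hr
  have hconv := tendsto_measureReal_Iic_of_stieltjes (μ := fun n => empiricalMeasure (lam (n + 1)))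
    (ν := semicircleMeasure r) (semicircleMeasure_singleton r) (C := C) ha
    (fun n => integrable_empiricalMeasure n.succ_ne_zero _ _) (fun n => by
      rw [integral_empiricalMeasure, sum_eigenvalues_sq, smul_eq_mul, inv_mul_le_iff₀ (by positivity)]
      exact hC (n + 1)) (fun q hq => by
      have hq0 : (q : ℝ) ≠ 0 := (ha.trans_le hq).ne'
      have h1 := (tendsto_add_atTop_iff_nat 1).2 (h q hq)
      refine h1.congr fun n => ?_
      rw [integral_empiricalMeasure, trace_imagResolvent_eq_sum_eigenvalues (hB _) hq0,
        Complex.real_smul]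
      push_cast
      rfl) x
  rw [semicircleMeasure_Iic hr] at hconv
  rw [← tendsto_add_atTop_iff_nat 1]
  refine hconv.congr fun n => ?_
  exact empiricalMeasure_Iic_eq_esd _ x

end EmpiricalSpectrum

/-! ### Reduction of the block model to a centred Wigner matrix. -/

section BlockModel

/-- The point of `[-κ, κ]` closest to `x` (for `0 ≤ κ`). -/
def clip (κ x : ℝ) : ℝ := max (-κ) (min κ x)

theorem measurable_clip (κ : ℝ) : Measurable (clip κ) := by
  unfold clip; fun_prop

theorem abs_clip_le {κ : ℝ} (hκ : 0 ≤ κ) (x : ℝ) : |clip κ x| ≤ κ :=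
  abs_le.2 ⟨le_max_left _ _, max_le (by linarith) (min_le_left _ _)⟩

theorem clip_eq_self {κ x : ℝ} (h : |x| ≤ κ) : clip κ x = x := by
  rw [abs_le] at h
  rw [clip, min_eq_right h.2, max_eq_right h.1]

theorem abs_integral_id_map_le {Ω : Type*} [MeasurableSpace Ω] {P : Measure Ω}
    [IsProbabilityMeasure P] {Y : Ω → ℝ} (hY : Measurable Y) {K : ℝ} (hb : ∀ᵐ ω ∂P, |Y ω| ≤ K) :
    |∫ x, x ∂(P.map Y)| ≤ K := by
  rw [integral_map hY.aemeasurable (by fun_prop), ← Real.norm_eq_abs]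
  simpa using norm_integral_le_of_norm_le_const (f := Y) hb

/-- Clipping turns an almost sure bound into one valid everywhere, as `IsBoundedWigner` requires,
while altering nothing outside a null set: an entry and its mean differ by at most `2K`. -/
theorem clip_centered_ae_eq {Ω : Type*} [MeasurableSpace Ω] {P : Measure Ω}
    [IsProbabilityMeasure P] {Y : Ω → ℝ} (hY : Measurable Y) {K t κ : ℝ} (ht : 0 ≤ t)
    (hκ : t * (2 * K) ≤ κ) (hb : ∀ᵐ ω ∂P, |Y ω| ≤ K) :
    ∀ᵐ ω ∂P, clip κ (t * (Y ω - ∫ x, x ∂(P.map Y))) = t * (Y ω - ∫ x, x ∂(P.map Y)) := by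
  have hm := abs_integral_id_map_le hY hb
  filter_upwards [hb] with ω hω
  refine clip_eq_self (le_trans ?_ hκ)
  rw [abs_mul, abs_of_nonneg ht]
  refine mul_le_mul_of_nonneg_left ((abs_sub _ _).trans ?_) ht
  linarith

theorem integral_clip_centered {Ω : Type*} [MeasurableSpace Ω] {P : Measure Ω}
    [IsProbabilityMeasure P] {Y : Ω → ℝ} (hY : Measurable Y) {K t κ : ℝ} (ht : 0 ≤ t)
    (hκ : t * (2 * K) ≤ κ) (hb : ∀ᵐ ω ∂P, |Y ω| ≤ K) :
    ∫ ω, clip κ (t * (Y ω - ∫ x, x ∂(P.map Y))) ∂P = 0 := by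
  rw [integral_congr_ae (clip_centered_ae_eq hY ht hκ hb), integral_const_mul,
    integral_map hY.aemeasurable (by fun_prop),
    integral_sub (Integrable.of_bound hY.aestronglyMeasurable K hb) (integrable_const _)]
  simp

theorem integral_clip_centered_sq {Ω : Type*} [MeasurableSpace Ω] {P : Measure Ω}
    [IsProbabilityMeasure P] {Y : Ω → ℝ} (hY : Measurable Y) {K t κ : ℝ} (ht : 0 ≤ t)
    (hκ : t * (2 * K) ≤ κ) (hb : ∀ᵐ ω ∂P, |Y ω| ≤ K) :
    ∫ ω, clip κ (t * (Y ω - ∫ x, x ∂(P.map Y))) ^ 2 ∂P = t ^ 2 * variance id (P.map Y) := by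
  rw [integral_congr_ae ((clip_centered_ae_eq hY ht hκ hb).mono fun ω h => by
      show _ = t ^ 2 * (Y ω - ∫ x, x ∂(P.map Y)) ^ 2
      rw [h, mul_pow]), integral_const_mul, variance_id_map hY.aemeasurable,
    variance_eq_integral hY.aemeasurable, integral_map hY.aemeasurable (by fun_prop)]

/-- The matrix with entry `a` inside the blocks and `b` between different blocks. -/
def blockMatrix {n m : ℕ} (part : Fin n → Fin m) (a b : ℝ) : Matrix (Fin n) (Fin n) ℝ :=
  Matrix.of fun i j => if part i = part j then a else b

theorem blockMatrix_apply {n m : ℕ} (part : Fin n → Fin m) (a b : ℝ) (i j : Fin n) :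
    blockMatrix part a b i j = if part i = part j then a else b := rfl

theorem isSymm_blockMatrix {n m : ℕ} (part : Fin n → Fin m) (a b : ℝ) :
    (blockMatrix part a b).IsSymm := by
  ext i j
  simp [blockMatrix_apply, eq_comm]

theorem sum_blockMatrix {n m : ℕ} (part : Fin n → Fin m) (a b : ℝ) (i : Fin n) :
    ∑ j, blockMatrix part a b i j
      = n * (blockProportion part (part i) * a + (1 - blockProportion part (part i)) * b) := by
  have hn : (n : ℝ) ≠ 0 := by
    have := i.pos
    positivity
  have h1 : ∀ j, blockMatrix part a b i j = b + (if part j = part i then a - b else 0) := by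
    intro j
    rw [blockMatrix_apply]
    by_cases h : part i = part j
    · simp [h]
    · simp [h, Ne.symm h]
  simp only [h1]
  rw [Finset.sum_add_distrib, ← Finset.sum_filter, Finset.sum_const, Finset.sum_const,
    blockProportion]
  simp only [nsmul_eq_mul, Finset.card_univ, Fintype.card_fin]
  field_simp
  ring

variable {Ω : Type*} [MeasurableSpace Ω] {P : Measure Ω} {F₁ F₂ : Measure ℝ} {K : ℝ}

theorem IsBlockRandomMatrix.map_entry {n m : ℕ} {part : Fin n → Fin m}
    {A : Ω → Matrix (Fin n) (Fin n) ℝ} (hA : IsBlockRandomMatrix P part F₁ F₂ K A) (i j : Fin n) :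
    P.map (fun ω => A ω i j) = if part i = part j then F₁ else F₂ := by
  split_ifs with h
  · exact hA.law_inside i j h
  · exact hA.law_between i j h

theorem IsBlockRandomMatrix.blockMatrix_eq_integral {n m : ℕ} {part : Fin n → Fin m}
    {A : Ω → Matrix (Fin n) (Fin n) ℝ} (hA : IsBlockRandomMatrix P part F₁ F₂ K A) (i j : Fin n) :
    blockMatrix part (∫ x, x ∂F₁) (∫ x, x ∂F₂) i j = ∫ x, x ∂(P.map fun ω => A ω i j) := by
  rw [hA.map_entry, blockMatrix_apply]
  split_ifs <;> rfl

/-- The matrix `t • (A - M)`, with the entries clipped to `[-κ, κ]`. -/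
def clippedMatrix {n : ℕ} (κ t : ℝ) (M A : Matrix (Fin n) (Fin n) ℝ) : Matrix (Fin n) (Fin n) ℝ :=
  Matrix.of fun i j => clip κ (t * (A i j - M i j))

theorem isSymm_clippedMatrix {n : ℕ} (κ t : ℝ) {M A : Matrix (Fin n) (Fin n) ℝ} (hM : M.IsSymm)
    (hA : A.IsSymm) : (clippedMatrix κ t M A).IsSymm := by
  ext i j
  simp [clippedMatrix, hM.apply i j, hA.apply i j]

theorem IsBlockRandomMatrix.isBoundedWigner [IsProbabilityMeasure P] {n m : ℕ}
    {part : Fin n → Fin m} {A : Ω → Matrix (Fin n) (Fin n) ℝ}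
    (hA : IsBlockRandomMatrix P part F₁ F₂ K A) {t κ : ℝ} (ht : 0 ≤ t) (hκ0 : 0 ≤ κ)
    (hκ : t * (2 * K) ≤ κ) :
    IsBoundedWigner P κ
      (fun i j => t ^ 2 * blockMatrix part (variance id F₁) (variance id F₂) i j)
      (fun ω => clippedMatrix κ t (blockMatrix part (∫ x, x ∂F₁) (∫ x, x ∂F₂)) (A ω)) where
  measurable_entry i j :=
    (measurable_clip κ).comp (((hA.measurable_entry i j).sub_const _).const_mul t)
  isSymm ω := isSymm_clippedMatrix κ t (isSymm_blockMatrix _ _ _) (hA.symmetric ω)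
  independent := hA.independent.comp
    (fun p y => clip κ (t * (y - blockMatrix part (∫ x, x ∂F₁) (∫ x, x ∂F₂) p.1.1 p.1.2)))
    fun p => (measurable_clip κ).comp ((measurable_id.sub_const _).const_mul t)
  bound i j ω := abs_clip_le hκ0 _
  integral_entry i j := by
    simp only [clippedMatrix, Matrix.of_apply, hA.blockMatrix_eq_integral]
    exact integral_clip_centered (hA.measurable_entry i j) ht hκ (hA.bounded i j)
  integral_entry_sq i j := by
    simp only [clippedMatrix, Matrix.of_apply, hA.blockMatrix_eq_integral]
    rw [integral_clip_centered_sq (hA.measurable_entry i j) ht hκ (hA.bounded i j), hA.map_entry,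
      blockMatrix_apply]
    split_ifs <;> rfl

theorem IsBlockRandomMatrix.ae_smul_eq [IsProbabilityMeasure P] {n m : ℕ}
    {part : Fin n → Fin m} {A : Ω → Matrix (Fin n) (Fin n) ℝ}
    (hA : IsBlockRandomMatrix P part F₁ F₂ K A) {t κ : ℝ} (ht : 0 ≤ t)
    (hκ : t * (2 * K) ≤ κ) :
    ∀ᵐ ω ∂P, t • A ω = clippedMatrix κ t (blockMatrix part (∫ x, x ∂F₁) (∫ x, x ∂F₂)) (A ω)
      + t • blockMatrix part (∫ x, x ∂F₁) (∫ x, x ∂F₂) := by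
  have h := ae_all_iff.2 fun i => ae_all_iff.2 fun j =>
    clip_centered_ae_eq (hA.measurable_entry i j) ht hκ (hA.bounded i j)
  filter_upwards [h] with ω h
  ext i j
  simp only [Matrix.smul_apply, Matrix.add_apply, clippedMatrix, Matrix.of_apply,
    hA.blockMatrix_eq_integral, h i j, smul_eq_mul]
  ring

/-- Convergence of the empirical spectral distributions when the row averages of the variance
profile converge uniformly and adding the mean is a negligible perturbation of the resolvent
trace. -/
theorem ae_tendsto_esd_of_row_averages [IsProbabilityMeasure P] {m : ℕ → ℕ}
    {part : (n : ℕ) → Fin n → Fin (m n)} {A : (n : ℕ) → Ω → Matrix (Fin n) (Fin n) ℝ}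
    (hA : ∀ n, IsBlockRandomMatrix P (part n) F₁ F₂ K (A n)) {r : ℝ} (hr : 0 < r)
    (hrow : ∀ ε > 0, ∀ᶠ n in atTop, ∀ i : Fin n,
      |blockProportion (part n) (part n i) * variance id F₁
        + (1 - blockProportion (part n) (part n i)) * variance id F₂ - r ^ 2| ≤ ε)
    (hpert : ∀ η : ℝ, 0 < η → ∃ δ : ℕ → ℝ, Tendsto δ atTop (𝓝 0) ∧ ∀ᶠ n in atTop,
      ∀ X : Matrix (Fin n) (Fin n) ℝ, X.IsSymm →
        ‖(imagResolvent (X + (1 / (2 * √n)) •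
          blockMatrix (part n) (∫ x, x ∂F₁) (∫ x, x ∂F₂)) η).trace
            - (imagResolvent X η).trace‖ ≤ n * δ n) :
    ∀ᵐ ω ∂P, ∀ x : ℝ, Tendsto (fun n : ℕ => esd ((1 / (2 * √n)) • A n ω) x) atTop
      (𝓝 (semicircleCDF r x)) := by
  -- A strictly positive bound is needed for the concentration estimates, and `K` may be zero.
  set K' : ℝ := |K| + 1 with hK'
  have hK'0 : 0 < K' := by positivity
  set t : ℕ → ℝ := fun n => 1 / (2 * √n) with ht
  have ht0 : ∀ n, 0 ≤ t n := fun n => by positivity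
  have htsq : ∀ n : ℕ, n ≠ 0 → t n ^ 2 = (4 * (n : ℝ))⁻¹ := fun n hn => by
    rw [ht]
    simp only [one_div, inv_pow, mul_pow, Real.sq_sqrt (Nat.cast_nonneg n)]
    norm_num
  have hκ : ∀ n : ℕ, t n * (2 * K) ≤ K' / √n := fun n => by
    have : t n * (2 * K) = K / √n := by
      rw [ht]; simp only [mul_inv, div_eq_mul_inv]; ring
    rw [this]
    gcongr
    linarith [le_abs_self K]
  set M : (n : ℕ) → Matrix (Fin n) (Fin n) ℝ := fun n =>
    blockMatrix (part n) (∫ x, x ∂F₁) (∫ x, x ∂F₂) with hM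
  set X : (n : ℕ) → Ω → Matrix (Fin n) (Fin n) ℝ := fun n ω =>
    clippedMatrix (K' / √n) (t n) (M n) (A n ω) with hX
  have hXsymm : ∀ n ω, (X n ω).IsSymm := fun n ω =>
    isSymm_clippedMatrix _ _ (isSymm_blockMatrix _ _ _) ((hA n).symmetric ω)
  -- Since `t² = 1/(4n)`, a row sum of variances is a quarter of the row average; this turns `r²`
  -- into the `r²/4` of the semicircle equation.
  have hρ : ∀ ε > 0, ∀ᶠ n in atTop, ∀ i, |∑ j, t n ^ 2 *
      blockMatrix (part n) (variance id F₁) (variance id F₂) i j - r ^ 2 / 4| ≤ ε := by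
    intro ε hε
    filter_upwards [hrow ε hε, eventually_ne_atTop 0] with n hn hn0 i
    have hn' : (n : ℝ) ≠ 0 := by exact_mod_cast hn0
    rw [← Finset.mul_sum, sum_blockMatrix, htsq n hn0]
    have e : ∀ u : ℝ, (4 * (n : ℝ))⁻¹ * (n * u) - r ^ 2 / 4 = (u - r ^ 2) / 4 := fun u => by
      field_simp
    rw [e, abs_div, abs_of_pos (by norm_num : (0 : ℝ) < 4)]
    have := hn i
    linarith [abs_nonneg (blockProportion (part n) (part n i) * variance id F₁
        + (1 - blockProportion (part n) (part n i)) * variance id F₂ - r ^ 2)]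
  -- Rational `q` give a single null set, and `q ≥ 2K'` ensures the stability condition `2K'² ≤ q²`.
  have hlim : ∀ᵐ ω ∂P, ∀ q : ℚ, 2 * K' ≤ q → Tendsto
      (fun n : ℕ => (n : ℂ)⁻¹ * (imagResolvent (X n ω) q).trace) atTop
      (𝓝 (∫ x : ℝ, ((x : ℂ) - (q : ℝ) * Complex.I)⁻¹ ∂(semicircleMeasure r))) := by
    refine ae_all_iff.2 fun q => ?_
    by_cases hq : 2 * K' ≤ q
    · have hq0 : (0 : ℝ) < q := by linarith
      obtain ⟨S, hS, hSeq, hSn⟩ := exists_semicircle_stieltjes hr hq0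
      rw [hS]
      filter_upwards [ae_tendsto_trace_imagResolvent hK'0 hq0 (by nlinarith)
        (fun n _ => (hA n).isBoundedWigner (ht0 n) (by positivity) (hκ n)) hρ hSeq hSn] with ω h _
      exact h
    · exact ae_of_all _ fun ω h => absurd h hq
  have heq := ae_all_iff.2 fun n => (hA n).ae_smul_eq (ht0 n) (hκ n)
  have hbd := ae_all_iff.2 fun n => ae_all_iff.2 fun i => ae_all_iff.2 fun j => (hA n).bounded i j
  filter_upwards [hlim, heq, hbd] with ω hlim heq hbd
  refine tendsto_esd_of_stieltjes (C := K ^ 2 / 4) (a := 2 * K')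
    (fun n => ((hA n).symmetric ω).smul _) hr (by positivity) (fun n => ?_) fun q hq => ?_
  · rcases eq_or_ne n 0 with rfl | hn
    · simp
    have hn' : (n : ℝ) ≠ 0 := by exact_mod_cast hn
    calc ∑ i, ∑ j, (t n • A n ω) i j ^ 2 ≤ ∑ _i : Fin n, ∑ _j : Fin n, t n ^ 2 * K ^ 2 := by
          refine Finset.sum_le_sum fun i _ => Finset.sum_le_sum fun j _ => ?_
          rw [Matrix.smul_apply, smul_eq_mul, mul_pow]
          refine mul_le_mul_of_nonneg_left ?_ (sq_nonneg _)
          exact sq_le_sq' (by linarith [(abs_le.1 (hbd n i j)).1]) (abs_le.1 (hbd n i j)).2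
      _ = n * (K ^ 2 / 4) := by
          simp only [Finset.sum_const, Finset.card_univ, Fintype.card_fin, nsmul_eq_mul, htsq n hn]
          field_simp
  · have hq0 : (0 : ℝ) < q := by linarith
    obtain ⟨δ, hδ, hδ'⟩ := hpert q hq0
    -- The perturbation bound holds for every symmetric matrix, so the mean can be restored
    -- separately for each `ω`.
    have h0 : Tendsto (fun n : ℕ => (n : ℂ)⁻¹ * (imagResolvent (t n • A n ω) q).trace
        - (n : ℂ)⁻¹ * (imagResolvent (X n ω) q).trace) atTop (𝓝 0) := by
      refine squeeze_zero_norm' ?_ hδ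
      filter_upwards [hδ', eventually_ne_atTop 0] with n hn hn0
      have hn' : 0 < (n : ℝ) := by positivity
      rw [← mul_sub, norm_mul, norm_inv, Complex.norm_natCast, inv_mul_le_iff₀ hn', heq n]
      exact hn _ (hXsymm n ω)
    have h1 := h0.add (hlim q hq)
    simp only [sub_add_cancel, zero_add] at h1
    exact h1

end BlockModel

/-! ### The mean as a negligible perturbation. -/

section MeanPerturbation

theorem blockMatrix_eq_add {n m : ℕ} (part : Fin n → Fin m) (a b : ℝ) :
    blockMatrix part a b = blockMatrix part (a - b) 0 + b • Matrix.vecMulVec 1 1 := by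
  ext i j
  simp only [blockMatrix_apply, Matrix.add_apply, Matrix.smul_apply, Matrix.vecMulVec_apply,
    Pi.one_apply, smul_eq_mul]
  split_ifs <;> ring

theorem blockMatrix_zero_eq_sum {n m : ℕ} (part : Fin n → Fin m) (a : ℝ) :
    blockMatrix part a 0 = ∑ k, a • Matrix.vecMulVec (fun i => if part i = k then (1 : ℝ) else 0)
      (fun i => if part i = k then (1 : ℝ) else 0) := by
  ext i j
  simp [blockMatrix_apply, Matrix.sum_apply, Matrix.vecMulVec_apply, eq_comm]

theorem norm_trace_imagResolvent_sum_rank_one_sub_le {n : ℕ} {ι : Type*}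
    {X : Matrix (Fin n) (Fin n) ℝ} (hX : X.IsSymm) {η : ℝ} (hη : 0 < η) (c : ℝ)
    (v : ι → Fin n → ℝ) (s : Finset ι) :
    ‖(imagResolvent (X + ∑ k ∈ s, c • Matrix.vecMulVec (v k) (v k)) η).trace
      - (imagResolvent X η).trace‖ ≤ s.card / η := by
  classical
  induction s using Finset.induction_on with
  | empty => simp
  | insert k s hk ih =>
    have hs : (X + ∑ k ∈ s, c • Matrix.vecMulVec (v k) (v k)).IsSymm := by
      ext i j
      simp [Matrix.sum_apply, Matrix.vecMulVec_apply, hX.apply i j, mul_comm (v _ i)]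
    have h := norm_trace_imagResolvent_rank_one_sub_le hs hη c (v k)
    rw [Finset.sum_insert hk, add_comm (c • Matrix.vecMulVec (v k) (v k)), ← add_assoc,
      Finset.card_insert_of_notMem hk]
    refine (norm_sub_le_norm_sub_add_norm_sub _ _ _).trans ((add_le_add h ih).trans_eq ?_)
    push_cast
    ring

theorem norm_trace_imagResolvent_add_blockMatrix_sub_le {n m : ℕ} (part : Fin n → Fin m)
    (a b : ℝ) (t : ℝ) {X : Matrix (Fin n) (Fin n) ℝ} (hX : X.IsSymm) {η : ℝ} (hη : 0 < η) :
    ‖(imagResolvent (X + t • blockMatrix part a b) η).trace - (imagResolvent X η).trace‖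
      ≤ 1 / η + ‖(imagResolvent (X + t • blockMatrix part (a - b) 0) η).trace
        - (imagResolvent X η).trace‖ := by
  have hs : (X + t • blockMatrix part (a - b) 0).IsSymm :=
    hX.add ((isSymm_blockMatrix _ _ _).smul _)
  have h := norm_trace_imagResolvent_rank_one_sub_le hs hη (t * b) 1
  rw [blockMatrix_eq_add, smul_add, smul_smul, ← add_assoc]
  refine (norm_sub_le_norm_sub_add_norm_sub _ _ _).trans (add_le_add h le_rfl)

/-- One rank one matrix per block and one for the all-ones matrix. This is useful when the number of
blocks stays bounded. -/
theorem norm_trace_imagResolvent_add_blockMatrix_sub_le_card {n m : ℕ} (part : Fin n → Fin m)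
    (a b : ℝ) (t : ℝ) {X : Matrix (Fin n) (Fin n) ℝ} (hX : X.IsSymm) {η : ℝ} (hη : 0 < η) :
    ‖(imagResolvent (X + t • blockMatrix part a b) η).trace - (imagResolvent X η).trace‖
      ≤ (1 + m) / η := by
  refine (norm_trace_imagResolvent_add_blockMatrix_sub_le part a b t hX hη).trans ?_
  rw [add_div]
  have h := norm_trace_imagResolvent_sum_rank_one_sub_le hX hη (t * (a - b))
    (fun k i => if part i = k then (1 : ℝ) else 0) Finset.univ
  rw [Finset.card_univ, Fintype.card_fin] at h
  rw [blockMatrix_zero_eq_sum, Finset.smul_sum]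
  simp only [smul_smul]
  gcongr

theorem blockProportion_le_iSup {n m : ℕ} (part : Fin n → Fin m) (k : Fin m) :
    blockProportion part k ≤ ⨆ k, blockProportion part k :=
  le_ciSup (Set.finite_range _).bddAbove k

theorem blockProportion_nonneg {n m : ℕ} (part : Fin n → Fin m) (k : Fin m) :
    0 ≤ blockProportion part k := by
  unfold blockProportion; positivity

theorem sum_blockProportion {n m : ℕ} (hn : n ≠ 0) (part : Fin n → Fin m) :
    ∑ k, blockProportion part k = 1 := by
  have hn' : (n : ℝ) ≠ 0 := by exact_mod_cast hn
  simp only [blockProportion]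
  rw [← Finset.sum_div, div_eq_one_iff_eq hn', ← Nat.cast_sum,
    ← Finset.card_eq_sum_card_fiberwise fun _ _ => Finset.mem_coe.2 (Finset.mem_univ _)]
  simp

/-- When blocks are small the rank may be of order `n`, so only the all-ones part is treated by
rank. The block-diagonal remainder has squared Hilbert–Schmidt norm at most `(a - b)² * n * max ν /
4`, because each row meets only its own block. -/
theorem norm_trace_imagResolvent_add_blockMatrix_sub_le_iSup {n m : ℕ} (hn : n ≠ 0)
    (part : Fin n → Fin m) (a b : ℝ) {X : Matrix (Fin n) (Fin n) ℝ} (hX : X.IsSymm) {η : ℝ}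
    (hη : 0 < η) :
    ‖(imagResolvent (X + (1 / (2 * √n)) • blockMatrix part a b) η).trace
        - (imagResolvent X η).trace‖
      ≤ 1 / η + n * √((a - b) ^ 2 / (4 * η ^ 4) * ⨆ k, blockProportion part k) := by
  have hn' : (n : ℝ) ≠ 0 := by exact_mod_cast hn
  refine (norm_trace_imagResolvent_add_blockMatrix_sub_le part a b _ hX hη).trans
    (add_le_add le_rfl ?_)
  set t : ℝ := 1 / (2 * √n) with ht
  have htsq : t ^ 2 = (4 * (n : ℝ))⁻¹ := by
    rw [ht, one_div, inv_pow, mul_pow, Real.sq_sqrt (Nat.cast_nonneg n)]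
    norm_num
  have hs : (X + t • blockMatrix part (a - b) 0).IsSymm :=
    hX.add ((isSymm_blockMatrix _ _ _).smul _)
  have hsum : ∑ i, ∑ j, ((X + t • blockMatrix part (a - b) 0) i j - X i j) ^ 2
      ≤ (a - b) ^ 2 / 4 * n * ⨆ k, blockProportion part k := by
    have h1 : ∀ i j, ((X + t • blockMatrix part (a - b) 0) i j - X i j) ^ 2
        = (4 * (n : ℝ))⁻¹ * (a - b) ^ 2 * blockMatrix part 1 0 i j := by
      intro i j
      rw [Matrix.add_apply, add_sub_cancel_left, Matrix.smul_apply, smul_eq_mul, mul_pow, htsq,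
        blockMatrix_apply, blockMatrix_apply]
      split_ifs <;> ring
    simp only [h1, ← Finset.mul_sum, sum_blockMatrix, mul_one, mul_zero, add_zero]
    calc (4 * (n : ℝ))⁻¹ * (a - b) ^ 2 * (n * ∑ i, blockProportion part (part i))
        ≤ (4 * (n : ℝ))⁻¹ * (a - b) ^ 2 * (n * ∑ _i : Fin n, ⨆ k, blockProportion part k) := by
          gcongr
          exact blockProportion_le_iSup _ _
      _ = _ := by
          rw [Finset.sum_const, Finset.card_univ, Fintype.card_fin, nsmul_eq_mul]
          field_simp
  refine abs_le_of_sq_le_sq' ?_ (by positivity) |>.2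
  refine (norm_trace_imagResolvent_sub_sq_le hs hX hη).trans ?_
  have hsup : 0 ≤ ⨆ k, blockProportion part k := Real.iSup_nonneg (blockProportion_nonneg part)
  rw [mul_pow, Real.sq_sqrt (by positivity), Fintype.card_fin]
  calc (n : ℝ) / η ^ 4 * _ ≤ n / η ^ 4 * ((a - b) ^ 2 / 4 * n * ⨆ k, blockProportion part k) := by
        gcongr
    _ = _ := by field_simp

end MeanPerturbation

/-! ### Asymptotics of the block proportions. -/

section BlockProportions

variable {m : ℕ → ℕ} {part : (n : ℕ) → Fin n → Fin (m n)}

/-- Compare every block with a largest one, whose proportion `w` is positive since the proportions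
sum to one. Then `|ν k - w| ≤ εw`, and summing over `k` gives `|1 - mw| ≤ ε * mw`. -/
theorem tendsto_card_mul_iSup_blockProportion (hm : ∀ n, 2 ≤ m n)
    (hratio : ∀ ε : ℝ, 0 < ε → ∀ᶠ n in atTop, ∀ i j : Fin (m n),
      |blockProportion (part n) i / blockProportion (part n) j - 1| < ε) :
    (∀ ε : ℝ, 0 < ε → ∀ᶠ n in atTop, ∀ k,
      |blockProportion (part n) k - ⨆ k, blockProportion (part n) k| ≤ ε) ∧
    Tendsto (fun n => m n * ⨆ k, blockProportion (part n) k) atTop (𝓝 1) := by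
  have key : ∀ ε : ℝ, 0 < ε → ε ≤ 1 / 2 → ∀ᶠ n in atTop,
      (∀ k, |blockProportion (part n) k - ⨆ k, blockProportion (part n) k| ≤ ε) ∧
      |m n * (⨆ k, blockProportion (part n) k) - 1| ≤ 2 * ε := by
    intro ε hε hε2
    filter_upwards [hratio ε hε, eventually_ne_atTop 0] with n hn hn0
    have : Nonempty (Fin (m n)) := ⟨⟨0, by have := hm n; omega⟩⟩
    obtain ⟨k₀, hk₀⟩ := exists_eq_ciSup_of_finite (f := blockProportion (part n))
    set w := ⨆ k, blockProportion (part n) k with hw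
    have hsum := sum_blockProportion hn0 (part n)
    have hw0 : 0 < w := by
      by_contra! h
      have : ∑ k, blockProportion (part n) k ≤ 0 :=
        Finset.sum_nonpos fun k _ => (blockProportion_le_iSup _ k).trans h
      linarith
    have hk : ∀ k, |blockProportion (part n) k - w| ≤ ε * w := by
      intro k
      have h := (hn k k₀).le
      rw [hk₀] at h
      have e : blockProportion (part n) k - w = (blockProportion (part n) k / w - 1) * w := by
        field_simp
      rw [e, abs_mul, abs_of_pos hw0]
      gcongr
    have hw1 : w ≤ 1 := by
      rw [← hk₀, ← hsum]
      exact Finset.single_le_sum (fun k _ => blockProportion_nonneg _ k) (Finset.mem_univ k₀)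
    refine ⟨fun k => (hk k).trans (by nlinarith), ?_⟩
    have h1 : |m n * w - 1| ≤ ε * (m n * w) := by
      rw [abs_sub_comm]
      have e : 1 - m n * w = ∑ k, (blockProportion (part n) k - w) := by
        rw [Finset.sum_sub_distrib, hsum]
        simp
      rw [e]
      refine (Finset.abs_sum_le_sum_abs _ _).trans ((Finset.sum_le_sum fun k _ => hk k).trans_eq ?_)
      simp only [Finset.sum_const, Finset.card_univ, Fintype.card_fin, nsmul_eq_mul]
      ring
    -- This is where `ε ≤ 1/2` enters; it turns the relative error into the absolute error `2ε`.
    have h2 : m n * w ≤ 2 := by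
      have h3 := (abs_le.1 h1).2
      have h4 : 0 ≤ m n * w := by positivity
      nlinarith
    nlinarith
  constructor
  · intro ε hε
    filter_upwards [key (min ε (1 / 2)) (by positivity) (min_le_right _ _)] with n hn k
    exact (hn.1 k).trans (min_le_left _ _)
  · rw [Metric.tendsto_nhds]
    intro ε hε
    filter_upwards [key (min (ε / 4) (1 / 2)) (by positivity) (min_le_right _ _)] with n hn
    rw [Real.dist_eq]
    linarith [hn.2, min_le_left (ε / 4) (1 / 2)]

theorem exists_eventually_eq_of_tendsto_natCast {m : ℕ → ℕ} {a : ℝ}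
    (h : Tendsto (fun n => (m n : ℝ)) atTop (𝓝 a)) : ∃ n₀, ∀ᶠ n in atTop, m n = m n₀ := by
  have h1 := Metric.tendsto_nhds.1 h (1 / 2) (by norm_num)
  obtain ⟨n₀, hn₀⟩ := h1.exists
  refine ⟨n₀, h1.mono fun n hn => ?_⟩
  have h2 : dist (m n : ℝ) (m n₀) < 1 := by
    linarith [dist_triangle_right (m n : ℝ) (m n₀) a]
  rw [Nat.dist_cast_real] at h2
  by_contra hne
  exact absurd (Nat.pairwise_one_le_dist hne) (not_le.2 h2)

/-- From `m * max ν → 1` and `max ν → c > 0` one gets `m → 1/c`, and a convergent sequence of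
integers is eventually constant. Hence `c = 1/M`, the common limit of the proportions. -/
theorem exists_eventually_card_eq (hm : ∀ n, 2 ≤ m n) {c : ℝ} (hc : 0 < c)
    (hsup : Tendsto (fun n => ⨆ k, blockProportion (part n) k) atTop (𝓝 c))
    (hratio : ∀ ε : ℝ, 0 < ε → ∀ᶠ n in atTop, ∀ i j : Fin (m n),
      |blockProportion (part n) i / blockProportion (part n) j - 1| < ε) :
    ∃ M : ℕ, 2 ≤ M ∧ (∀ᶠ n in atTop, m n = M) ∧
      ∀ ε : ℝ, 0 < ε → ∀ᶠ n in atTop, ∀ k, |blockProportion (part n) k - (M : ℝ)⁻¹| ≤ ε := by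
  obtain ⟨hunif, hprod⟩ := tendsto_card_mul_iSup_blockProportion hm hratio
  have hmlim : Tendsto (fun n => (m n : ℝ)) atTop (𝓝 (1 / c)) := by
    refine (hprod.div hsup hc.ne').congr' ?_
    filter_upwards [hsup.eventually (lt_mem_nhds hc)] with n hn
    exact mul_div_cancel_right₀ _ hn.ne'
  obtain ⟨n₀, hn₀⟩ := exists_eventually_eq_of_tendsto_natCast hmlim
  refine ⟨m n₀, hm n₀, hn₀, fun ε hε => ?_⟩
  have hM : (m n₀ : ℝ) = 1 / c := tendsto_nhds_unique
    (tendsto_const_nhds.congr' (hn₀.mono fun n hn => by rw [hn])) hmlim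
  filter_upwards [hunif (ε / 2) (by positivity),
    Metric.tendsto_nhds.1 hsup (ε / 2) (by positivity)] with n h1 h2 k
  rw [hM, one_div, inv_inv]
  rw [Real.dist_eq] at h2
  have h3 := abs_sub_le (blockProportion (part n) k) (⨆ k, blockProportion (part n) k) c
  linarith [h1 k]

theorem eventually_row_average_sub_le {ρ : ℝ}
    (hν : ∀ ε : ℝ, 0 < ε → ∀ᶠ n in atTop, ∀ k, |blockProportion (part n) k - ρ| ≤ ε) (v₁ v₂ : ℝ)
    {ε : ℝ} (hε : 0 < ε) :
    ∀ᶠ n in atTop, ∀ i : Fin n, |blockProportion (part n) (part n i) * v₁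
      + (1 - blockProportion (part n) (part n i)) * v₂ - (ρ * v₁ + (1 - ρ) * v₂)| ≤ ε := by
  filter_upwards [hν (ε / (|v₁ - v₂| + 1)) (by positivity)] with n hn i
  have e : blockProportion (part n) (part n i) * v₁
      + (1 - blockProportion (part n) (part n i)) * v₂ - (ρ * v₁ + (1 - ρ) * v₂)
      = (blockProportion (part n) (part n i) - ρ) * (v₁ - v₂) := by ring
  rw [e, abs_mul]
  calc _ ≤ ε / (|v₁ - v₂| + 1) * (|v₁ - v₂| + 1) := by
        gcongr
        · exact hn _
        · linarith
    _ = ε := by field_simp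

end BlockProportions

/-! ### The two regimes. -/

theorem theorem2 {Ω : Type*} [MeasurableSpace Ω] (P : Measure Ω) [IsProbabilityMeasure P]
    (F₁ F₂ : Measure ℝ) [IsProbabilityMeasure F₁] [IsProbabilityMeasure F₂]
    (σ₁ σ₂ : ℝ) (hσ₁ : 0 ≤ σ₁) (hσ₂ : 0 ≤ σ₂)
    (hF₁ : variance id F₁ = σ₁ ^ 2) (hF₂ : variance id F₂ = σ₂ ^ 2)
    (K : ℝ)
    (m : ℕ → ℕ) (hm : ∀ n, 2 ≤ m n)
    (part : (n : ℕ) → Fin n → Fin (m n))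
    (A : (n : ℕ) → Ω → Matrix (Fin n) (Fin n) ℝ)
    (hA : ∀ n, IsBlockRandomMatrix P (part n) F₁ F₂ K (A n)) :
    ((∃ c : ℝ, 0 < c ∧
          Tendsto (fun n => ⨆ k : Fin (m n), blockProportion (part n) k) atTop (𝓝 c)) →
      (∀ ε : ℝ, 0 < ε → ∀ᶠ n in atTop, ∀ i j : Fin (m n),
          |blockProportion (part n) i / blockProportion (part n) j - 1| < ε) →
      ∃ M : ℕ, 2 ≤ M ∧ (∀ᶠ n in atTop, m n = M) ∧
        (0 < σ₁ ^ 2 + ((M : ℝ) - 1) * σ₂ ^ 2 →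
          ∀ᵐ ω ∂P, ∀ x : ℝ,
            Tendsto (fun n : ℕ => esd ((1 / (2 * Real.sqrt n)) • A n ω) x) atTop
              (𝓝 (semicircleCDF
                (Real.sqrt ((σ₁ ^ 2 + ((M : ℝ) - 1) * σ₂ ^ 2) / M)) x)))) ∧
    (Tendsto (fun n => ⨆ k : Fin (m n), blockProportion (part n) k) atTop (𝓝 0) →
      0 < σ₂ →
      ∀ᵐ ω ∂P, ∀ x : ℝ,
        Tendsto (fun n : ℕ => esd ((1 / (2 * Real.sqrt n)) • A n ω) x) atTop
          (𝓝 (semicircleCDF σ₂ x))) := by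
  refine ⟨?_, fun hsup hσ => ?_⟩
  · rintro ⟨c, hc, hsup⟩ hratio
    obtain ⟨M, hM2, hM, hν⟩ := exists_eventually_card_eq hm hc hsup hratio
    have hM0 : (0 : ℝ) < M := by exact_mod_cast (by omega : 0 < M)
    refine ⟨M, hM2, hM, fun hpos => ?_⟩
    refine ae_tendsto_esd_of_row_averages hA (by positivity) (fun ε hε => ?_) fun η hη =>
      ⟨fun n : ℕ => (1 + M) / η / n, tendsto_const_div_atTop_nhds_zero_nat _, ?_⟩
    -- All proportions tend to `1/M`, so the row averages tend to `σ₁²/M + (1 - 1/M)σ₂²`, which is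
    -- the square of the radius.
    · have h := eventually_row_average_sub_le hν (σ₁ ^ 2) (σ₂ ^ 2) hε
      rw [hF₁, hF₂, Real.sq_sqrt (by positivity)]
      convert h using 6
      field_simp
    · filter_upwards [hM, eventually_ne_atTop 0] with n hn hn0 X hX
      have hn' : (n : ℝ) ≠ 0 := by exact_mod_cast hn0
      rw [mul_div_cancel₀ _ hn', ← hn]
      exact norm_trace_imagResolvent_add_blockMatrix_sub_le_card _ _ _ _ hX hη
  · refine ae_tendsto_esd_of_row_averages hA hσ (fun ε hε => ?_) fun η hη =>
      ⟨fun n : ℕ => 1 / η / n + √(((∫ x, x ∂F₁) - ∫ x, x ∂F₂) ^ 2 / (4 * η ^ 4)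
        * ⨆ k, blockProportion (part n) k), ?_, ?_⟩
    -- Here all proportions tend to zero, so only the variance between blocks survives in the row
    -- averages.
    · have h := eventually_row_average_sub_le (part := part) (ρ := 0) (fun ε hε => ?_)
        (σ₁ ^ 2) (σ₂ ^ 2) hε
      · rw [hF₁, hF₂]
        simpa using h
      · filter_upwards [hsup.eventually_le_const hε] with n hn k
        rw [sub_zero, abs_of_nonneg (blockProportion_nonneg _ _)]
        exact (blockProportion_le_iSup _ k).trans hn
    · simpa using (tendsto_const_div_atTop_nhds_zero_nat (1 / η)).add
        (Real.continuous_sqrt.continuousAt.tendsto.comp (hsup.const_mul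
          (((∫ x, x ∂F₁) - ∫ x, x ∂F₂) ^ 2 / (4 * η ^ 4))))
    · filter_upwards [eventually_ne_atTop 0] with n hn0 X hX
      have hn' : (n : ℝ) ≠ 0 := by exact_mod_cast hn0
      rw [mul_add, mul_div_cancel₀ _ hn']
      exact norm_trace_imagResolvent_add_blockMatrix_sub_le_iSup hn0 _ _ _ hX hη
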